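/- **Setting.** In a strategic game with players $1,\dots,n$ and utilities $u_i$, the *state graph* (Nash dynamics) has the strategy profiles as vertices and an arc labelled $i$ from $S$ to $S'$ whenever $S'$ arises from $S$ by a move of the single player $i$ and $u_i(S)<u_i(S')$. A *sink equilibrium* is a strongly connected component of the state graph without outgoing arcs. For a class of succinctly represented games, IN A SINK is the problem: given a game of the class and a strategy profile, does the profile belong to a sink equilibrium? All numbers are integers written in binary, and finite sets are given by lists. *Two-sided market games.* There are active agents $\mathcal X$ (the players) and passive agents $\mathcal Y$; a strategy of $x\in\mathcal X$ is a member $s_x$ of a family $F_x\subseteq 2^{\mathcal Y}$; each $y\in\mathcal Y$ has a strict preference list over the active agents that can play it. In a profile, $x$ wins the agents $y\in s_x$ for which $x$ is the agent most preferred by $y$ among those playing $y$; the utility of $x$ is $u_x(T_x)$, where $T_x$ is the set of agents that $x$ wins. (i) In a *uniform utility-based* two-sided market game each $y$ has a value $v_y\in\mathbb N$, the same for all active agents, and $u_x(T)=\sum_{y\in T}v_y$. The families $F_x$ are given by listing their members or, in a second variant, are the lower ideals (families closed under subsets) generated by listed sets. (ii) In a *many-to-one* two-sided market game each $F_x$ is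 a lower ideal, given by generators, and $u_x:2^{\mathcal Y}\to\mathbb Z$ is an arbitrary set function given by a list of rules $(P,N,c)$: each rule contributes $c$ to $u_x(T)$ if $P\subseteq T$ and $N\cap T=\emptyset$. (iii) In a *valid-utility game* each player $i$ has a listed family $F_i$ of subsets of a finite set $V$, with $\emptyset\in F_i$, and there is a social function $\gamma:(2^V)^n\to\mathbb R_{\ge0}$ that is non-decreasing and submodular (for componentwise inclusion, union and intersection), such that for every strategy profile $S$ one has $u_i(S)\ge\gamma(S)-\gamma(S_{-i},\emptyset)$ for all $i$, and $\sum_i u_i(S)\le\gamma(S)$. Here $u_i$ and $\gamma$ are given by lists of rules as in (ii), a profile being regarded as a set of pairs (player, element). A *weighted congestion game* has listed strategy families of subsets of a set $E$ of resources, positive integer weights $w_i$, and delay functions $d_e:\mathbb N\to\mathbb Z$ (given by finite tables); player $i$ minimizes $\sum_{e\in s_i}d_e\bigl(\sum_{k:\,e\in s_k}w_k\bigr)$. **Theorem.** IN A SINK is $\mathsf{PSPACE}$-hard, under polynomial-time many-one reductions, for (i) uniform utility-based two-sided market games (in both variants), (ii) many-to-one two-sided market games, and (iii) valid-utility games. Moreover,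 for every language $L\in\mathsf{PSPACE}$ there are polynomial-time many-one reductions $f$ from $L$ to IN A SINK for uniform utility-based two-sided market games with listed strategies, and $g$ from $L$ to IN A SINK for weighted congestion games, such that for every input $x$ the state graphs of the games in $f(x)$ and $g(x)$ are isomorphic as arc-labelled directed graphs (by a bijection of players together with a bijection of states), the given profile of $f(x)$ corresponding to that of $g(x)$. -/

import Mathlib

namespace SinkEq

/-! ## Strategic games, Nash dynamics and sink equilibria -/

/-- A strategic game with player set `{0, …, n - 1}`. -/
structure StrategicGame (n : ℕ) where
  Strat : Fin n → Type
  u : Fin n → (∀ i, Strat i) → ℝ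

namespace StrategicGame

/-- Strategy profiles. -/
abbrev State {n : ℕ} (G : StrategicGame n) : Type := ∀ i, G.Strat i

/-- The arc with label `i` from `S` to `S'` of the state graph: `S'` arises from `S` by a move of the
single player `i`, and the move improves the utility of `i`. -/
def Arc {n : ℕ} (G : StrategicGame n) (i : Fin n) (S S' : G.State) : Prop :=
  (∃ s : G.Strat i, S' = Function.update S i s) ∧ G.u i S < G.u i S'

def Step {n : ℕ} (G : StrategicGame n) (S S' : G.State) : Prop := ∃ i, G.Arc i S S'

/-- There is a walk from `S` to `S'` in the state graph. -/
def Reach {n : ℕ} (G : StrategicGame n) : G.State → G.State → Prop :=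
  Relation.ReflTransGen G.Step

/-- `T` is a strongly connected component of the state graph without outgoing arcs. -/
def IsSinkEquilibrium {n : ℕ} (G : StrategicGame n) (T : Set G.State) : Prop :=
  (∃ S, T = {S' | G.Reach S S' ∧ G.Reach S' S}) ∧ ∀ S ∈ T, ∀ S', G.Step S S' → S' ∈ T

/-- `S` belongs to some sink equilibrium. -/
def InASink {n : ℕ} (G : StrategicGame n) (S : G.State) : Prop :=
  ∃ T, G.IsSinkEquilibrium T ∧ S ∈ T

/-- An isomorphism of arc-labelled state graphs (a bijection of players and a bijection of states)
that maps the state `S₀` to the state `T₀`. -/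
def DynamicsIso {n n' : ℕ} (G : StrategicGame n) (S₀ : G.State)
    (H : StrategicGame n') (T₀ : H.State) : Prop :=
  ∃ (σ : Fin n ≃ Fin n') (Φ : G.State ≃ H.State), Φ S₀ = T₀ ∧
    ∀ i S S', G.Arc i S S' ↔ H.Arc (σ i) (Φ S) (Φ S')

end StrategicGame

/-- Games in which a strategy of each of the `n` players is a subset of a set of `m` elements
(markets, passive agents, resources). -/
structure SetGame (n m : ℕ) where
  /-- the family of feasible strategies of each player -/
  F : Fin n → Set (Finset (Fin m))
  /-- utilities (only the values at profiles of feasible strategies matter) -/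
  u : Fin n → (Fin n → Finset (Fin m)) → ℝ

namespace SetGame

def toGame {n m : ℕ} (G : SetGame n m) : StrategicGame n where
  Strat i := {s : Finset (Fin m) // s ∈ G.F i}
  u i S := G.u i (fun k => (S k).1)

def Feasible {n m : ℕ} (G : SetGame n m) (p : Fin n → Finset (Fin m)) : Prop := ∀ i, p i ∈ G.F i

def state {n m : ℕ} (G : SetGame n m) (p : Fin n → Finset (Fin m)) (h : G.Feasible p) :
    G.toGame.State :=
  fun i => ⟨p i, h i⟩

/-- `p` is a strategy profile of the game, and it belongs to a sink equilibrium. -/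
def InASinkAt {n m : ℕ} (G : SetGame n m) (p : Fin n → Finset (Fin m)) : Prop :=
  ∃ h : G.Feasible p, G.toGame.InASink (G.state p h)

/-- `p` and `q` are strategy profiles of the two games, and the Nash dynamics of the games are
isomorphic by an isomorphism that maps `p` to `q`. -/
def DynamicsIsoAt {n m n' m' : ℕ} (G : SetGame n m) (p : Fin n → Finset (Fin m))
    (H : SetGame n' m') (q : Fin n' → Finset (Fin m')) : Prop :=
  ∃ (hp : G.Feasible p) (hq : H.Feasible q),
    StrategicGame.DynamicsIso G.toGame (G.state p hp) H.toGame (H.state q hq)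

end SetGame

/-- The family of the sets listed in `l`. -/
def listed {m : ℕ} (l : List (List (Fin m))) : Set (Finset (Fin m)) :=
  {s | ∃ a ∈ l, s = a.toFinset}

/-- The lower ideal generated by the sets listed in `l`. -/
def lowerIdeal {m : ℕ} (l : List (List (Fin m))) : Set (Finset (Fin m)) :=
  {s | ∃ a ∈ l, s ⊆ a.toFinset}

/-! ## Two-sided markets, valid-utility games and weighted congestion games -/

/-- A two-sided market with active agents `Fin n` and passive agents `Fin m`. -/
structure TwoSidedMarket (n m : ℕ) where
  /-- the strategies of each active agent -/
  F : Fin n → Set (Finset (Fin m))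
  /-- the utility of an active agent for a set of passive agents -/
  u : Fin n → Finset (Fin m) → ℝ
  /-- `r y x`: the utility of the passive agent `y` for the active agent `x` -/
  r : Fin m → Fin n → ℝ
  /-- the preferences of `y` are strict on the active agents that can play `y` -/
  strict : ∀ y x x', (∃ s ∈ F x, y ∈ s) → (∃ s ∈ F x', y ∈ s) → x ≠ x' → r y x ≠ r y x'

open scoped Classical in
/-- The passive agents that the active agent `x` wins. -/
noncomputable def TwoSidedMarket.won {n m : ℕ} (A : TwoSidedMarket n m)
    (S : Fin n → Finset (Fin m)) (x : Fin n) : Finset (Fin m) :=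
  (S x).filter (fun y => ∀ x', x' ≠ x → y ∈ S x' → A.r y x' < A.r y x)

/-- The game among the active agents. -/
noncomputable def TwoSidedMarket.game {n m : ℕ} (A : TwoSidedMarket n m) : SetGame n m where
  F := A.F
  u x S := A.u x (A.won S x)

/-- The conditions on a game with null actions and a social function `γ`, defined on all families of
sets, to be a valid-utility game. (The ground sets of the players are subsumed in the strategy
families.) -/
structure IsValidUtility {n m : ℕ} (G : SetGame n m) (γ : (Fin n → Finset (Fin m)) → ℝ) :
    Prop where
  null_mem : ∀ i, ∅ ∈ G.F i
  nonneg : ∀ A, 0 ≤ γ A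
  mono : ∀ A B, (∀ i, A i ⊆ B i) → γ A ≤ γ B
  submodular : ∀ A B : Fin n → Finset (Fin m),
    γ (fun i => A i ∪ B i) + γ (fun i => A i ∩ B i) ≤ γ A + γ B
  marginal : ∀ S, G.Feasible S → ∀ i, γ S - γ (Function.update S i ∅) ≤ G.u i S
  sum_le : ∀ S, G.Feasible S → ∑ i, G.u i S ≤ γ S

/-- The weighted congestion game with strategy families `F`, weights `w` and delay functions `d`;
the utility is minus the delay. -/
noncomputable def congestionGame {n m : ℕ} (F : Fin n → Set (Finset (Fin m))) (w : Fin n → ℕ)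
    (d : Fin m → ℕ → ℤ) : SetGame n m where
  F := F
  u i S := -∑ e ∈ S i, (d e (∑ k with e ∈ S k, w k) : ℝ)

/-! ## Succinct representations -/

/-- A rule `(pos, neg, val)` contributes `val` to the value of every set that contains all elements
of `pos` and no element of `neg`. -/
structure Rule (α : Type) where
  pos : List α
  neg : List α
  val : ℤ

open scoped Classical in
/-- The set function given by a list of rules. Every integer-valued set function on a finite set is
of this form. -/
noncomputable def evalRules {α : Type} (l : List (Rule α)) (T : Set α) : ℝ :=
  (l.map fun r => if (∀ a ∈ r.pos, a ∈ T) ∧ (∀ a ∈ r.neg, a ∉ T) then (r.val : ℝ) else 0).sum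

/-- A finite list of strategies (or of generators of the lower ideal of strategies) of each active
agent; the preference list of each passive agent `y`, best agent first: it has no repetitions and
contains every active agent that can play `y`. -/
structure MarketData where
  n : ℕ
  m : ℕ
  strat : Fin n → List (List (Fin m))
  pref : Fin m → List (Fin n)
  pref_nodup : ∀ y, (pref y).Nodup
  mem_pref : ∀ x, ∀ s ∈ strat x, ∀ y ∈ s, x ∈ pref y

/-- The utilities of a passive agent that express its preference list. -/
def MarketData.rank (D : MarketData) (y : Fin D.m) (x : Fin D.n) : ℝ :=
  -((D.pref y).idxOf x : ℝ)

theorem MarketData.rank_ne (D : MarketData) {y : Fin D.m} {x x' : Fin D.n}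
    (hx : x ∈ D.pref y) (h : x ≠ x') : D.rank y x ≠ D.rank y x' := by
  intro e
  have e' : (D.pref y).idxOf x = (D.pref y).idxOf x' := by
    simpa [MarketData.rank] using e
  exact h ((List.idxOf_inj hx).1 e')

/-- The market in which the strategies are the listed sets. -/
def MarketData.explicitMarket (D : MarketData) (u : Fin D.n → Finset (Fin D.m) → ℝ) :
    TwoSidedMarket D.n D.m where
  F x := listed (D.strat x)
  u := u
  r := D.rank
  strict := by
    rintro y x x' ⟨_, ⟨a, ha, rfl⟩, hy⟩ - h
    exact D.rank_ne (D.mem_pref x a ha y (List.mem_toFinset.1 hy)) h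

/-- The market in which the strategies are the subsets of the listed sets. -/
def MarketData.idealMarket (D : MarketData) (u : Fin D.n → Finset (Fin D.m) → ℝ) :
    TwoSidedMarket D.n D.m where
  F x := lowerIdeal (D.strat x)
  u := u
  r := D.rank
  strict := by
    rintro y x x' ⟨s, ⟨a, ha, hs⟩, hy⟩ - h
    exact D.rank_ne (D.mem_pref x a ha y (List.mem_toFinset.1 (hs hy))) h

/-- A uniform utility-based market: every passive agent has one value, the same for all active
agents. -/
structure UniformMarket extends MarketData where
  value : Fin m → ℕ

/-- The utility of a set of passive agents is the sum of their values. -/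
def UniformMarket.u (I : UniformMarket) (_ : Fin I.n) (T : Finset (Fin I.m)) : ℝ :=
  ∑ y ∈ T, (I.value y : ℝ)

noncomputable def UniformMarket.game (I : UniformMarket) : SetGame I.n I.m :=
  (I.explicitMarket I.u).game

noncomputable def UniformMarket.idealGame (I : UniformMarket) : SetGame I.n I.m :=
  (I.idealMarket I.u).game

/-- A many-to-one market: the strategy families are lower ideals, given by generators, and each
active agent has its own utility function on sets, given by rules. -/
structure ManyToOneMarket extends MarketData where
  util : Fin n → List (Rule (Fin m))

noncomputable def ManyToOneMarket.game (I : ManyToOneMarket) : SetGame I.n I.m :=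
  (I.idealMarket fun x T => evalRules (I.util x) (T : Set (Fin I.m))).game

/-- A family of sets as a set of pairs. -/
def pairs {n m : ℕ} (S : Fin n → Finset (Fin m)) : Set (Fin n × Fin m) := {a | a.2 ∈ S a.1}

/-- Listed strategies; utilities and social function given by rules. -/
structure ValidUtilityData where
  n : ℕ
  m : ℕ
  strat : Fin n → List (List (Fin m))
  util : Fin n → List (Rule (Fin n × Fin m))
  social : List (Rule (Fin n × Fin m))

noncomputable def ValidUtilityData.game (I : ValidUtilityData) : SetGame I.n I.m where
  F i := listed (I.strat i)
  u i S := evalRules (I.util i) (pairs S)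

noncomputable def ValidUtilityData.γ (I : ValidUtilityData) (S : Fin I.n → Finset (Fin I.m)) : ℝ :=
  evalRules I.social (pairs S)

/-- Listed strategies, positive weights, and delay functions given by a list of pairs
(load, delay); the delay is `0` at loads that are not listed. -/
structure CongestionData where
  n : ℕ
  m : ℕ
  strat : Fin n → List (List (Fin m))
  weight : Fin n → ℕ
  weight_pos : ∀ i, 0 < weight i
  delay : Fin m → List (ℕ × ℤ)

noncomputable def CongestionData.game (I : CongestionData) : SetGame I.n I.m :=
  congestionGame (fun i => listed (I.strat i)) I.weight
    (fun e load => ((I.delay e).lookup load).getD 0)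

/-! ## Strings

Numbers are written in binary and ended by a comma, lists are put between brackets. -/

/-- Words over Mathlib's alphabet of bits, brackets, comma and blank. -/
abbrev Word : Type := List Computability.Γ'

def encNat (k : ℕ) : Word :=
  (Computability.encodeNat k).map Computability.Γ'.bit ++ [Computability.Γ'.comma]

def encInt (z : ℤ) : Word :=
  Computability.Γ'.bit (decide (z < 0)) :: encNat z.natAbs

def encList {α : Type} (e : α → Word) (l : List α) : Word :=
  Computability.Γ'.bra :: (l.flatMap e ++ [Computability.Γ'.ket])

def encFun {k : ℕ} (e : Fin k → Word) : Word := encList e (List.finRange k)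

def encIdx {k : ℕ} (l : List (Fin k)) : Word := encList (fun j => encNat j.val) l

def encRules {α : Type} (e : α → Word) (l : List (Rule α)) : Word :=
  encList (fun r => encList e r.pos ++ encList e r.neg ++ encInt r.val) l

def encPair {n m : ℕ} (a : Fin n × Fin m) : Word := encNat a.1.val ++ encNat a.2.val

def UniformMarket.enc (I : UniformMarket) : Word :=
  encFun (fun x => encList encIdx (I.strat x)) ++
    encFun (fun y => encNat (I.value y) ++ encIdx (I.pref y))

def ManyToOneMarket.enc (I : ManyToOneMarket) : Word :=
  encFun (fun x => encList encIdx (I.strat x) ++ encRules (fun y => encNat y.val) (I.util x)) ++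
    encFun (fun y => encIdx (I.pref y))

def ValidUtilityData.enc (I : ValidUtilityData) : Word :=
  encNat I.m ++
    encFun (fun i => encList encIdx (I.strat i) ++ encRules encPair (I.util i)) ++
    encRules encPair I.social

def CongestionData.enc (I : CongestionData) : Word :=
  encFun (fun i => encNat (I.weight i) ++ encList encIdx (I.strat i)) ++
    encFun (fun e => encList (fun a : ℕ × ℤ => encNat a.1 ++ encInt a.2) (I.delay e))

/-- A profile, each strategy being given as a list of its elements. -/
def encProfile {n m : ℕ} (p : Fin n → List (Fin m)) : Word := encFun (fun i => encIdx (p i))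

def profile {n m : ℕ} (p : Fin n → List (Fin m)) : Fin n → Finset (Fin m) :=
  fun i => (p i).toFinset

/-! ## The decision problems -/

def uniformInASink : Set Word :=
  {w | ∃ (I : UniformMarket) (p : Fin I.n → List (Fin I.m)),
    w = I.enc ++ encProfile p ∧ I.game.InASinkAt (profile p)}

/-- The variant in which the listed strategies generate lower ideals. -/
def uniformIdealInASink : Set Word :=
  {w | ∃ (I : UniformMarket) (p : Fin I.n → List (Fin I.m)),
    w = I.enc ++ encProfile p ∧ I.idealGame.InASinkAt (profile p)}

def manyToOneInASink : Set Word :=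
  {w | ∃ (I : ManyToOneMarket) (p : Fin I.n → List (Fin I.m)),
    w = I.enc ++ encProfile p ∧ I.game.InASinkAt (profile p)}

def validUtilityInASink : Set Word :=
  {w | ∃ (I : ValidUtilityData) (p : Fin I.n → List (Fin I.m)),
    w = I.enc ++ encProfile p ∧ IsValidUtility I.game I.γ ∧ I.game.InASinkAt (profile p)}

def congestionInASink : Set Word :=
  {w | ∃ (I : CongestionData) (p : Fin I.n → List (Fin I.m)),
    w = I.enc ++ encProfile p ∧ I.game.InASinkAt (profile p)}

/-! ## PSPACE and polynomial-time reductions -/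

inductive Move
  | left
  | stay
  | right

/-- A deterministic Turing machine with one tape, infinite to the right, and inputs over
`{0, 1}`. -/
structure TapeMachine where
  Q : Type
  Γ : Type
  finite_Q : Finite Q
  finite_Γ : Finite Γ
  blank : Γ
  symbol : Bool → Γ
  symbol_injective : Function.Injective symbol
  symbol_ne_blank : ∀ b, symbol b ≠ blank
  start : Q
  accept : Q
  reject : Q
  accept_ne_reject : accept ≠ reject
  δ : Q → Γ → Q × Γ × Move

namespace TapeMachine

structure Cfg (M : TapeMachine) where
  state : M.Q
  head : ℕ
  tape : ℕ → M.Γ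

def moveHead : Move → ℕ → ℕ
  | .left, k => k - 1
  | .stay, k => k
  | .right, k => k + 1

open scoped Classical in
/-- One step; the machine stops in the states `accept` and `reject`. A move to the left in the
leftmost cell leaves the head there. -/
noncomputable def step (M : TapeMachine) (c : M.Cfg) : M.Cfg :=
  if c.state = M.accept ∨ c.state = M.reject then c
  else
    let a := M.δ c.state (c.tape c.head)
    { state := a.1
      head := moveHead a.2.2 c.head
      tape := Function.update c.tape c.head a.2.1 }

def init (M : TapeMachine) (x : List Bool) : M.Cfg where
  state := M.start
  head := 0
  tape k := (x.map M.symbol).getD k M.blank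

/-- The configuration after `t` steps on the input `x`. -/
noncomputable def run (M : TapeMachine) (x : List Bool) (t : ℕ) : M.Cfg := M.step^[t] (M.init x)

end TapeMachine

/-- `L` is decided by a Turing machine that, on inputs of length `k`, visits only the first `p(k)`
cells of its tape, for a polynomial `p`. -/
def InPSPACE (L : Set (List Bool)) : Prop :=
  ∃ (M : TapeMachine) (p : Polynomial ℕ), ∀ x : List Bool,
    (∀ t, (M.run x t).head < p.eval x.length) ∧
    (x ∈ L → ∃ t, (M.run x t).state = M.accept) ∧
    (x ∉ L → ∃ t, (M.run x t).state = M.reject)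

/-- `f` is a polynomial-time many-one reduction from `L` to `P`. -/
def IsPolyReduction (f : List Bool → Word) (L : Set (List Bool)) (P : Set Word) : Prop :=
  Nonempty (Turing.TM2ComputableInPolyTime (id : List Bool → List Bool) (id : Word → Word) f) ∧
    ∀ x, x ∈ L ↔ f x ∈ P

def PSPACEHard (P : Set Word) : Prop :=
  ∀ L : Set (List Bool), InPSPACE L → ∃ f, IsPolyReduction f L P

end SinkEq

/-! A computation in polynomial space is turned into a game whose Nash dynamics, started in one
particular profile, is deterministic and carries out the computation. The machine is altered: after
acceptance it restores its input and returns to its very first configuration, after rejection it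
stands still. If the input is accepted, the first profile lies on a cycle of forced moves and so
belongs to a sink equilibrium (`inASink_of_cycle`); otherwise it leads to a profile without
improving moves and does not (`not_inASink_of_reach`).

The players are two controllers and one player for each tape cell. A controller plays a label
(position, control state, symbol read), a cell plays its content. Each resource is meant for two
players: an owner, who has priority, and a guest, who wins it only if the owner stays away. All
strategies of a player contain the same number of owned resources (`CellMachine.sum_high`), so
incentives depend only on the resources won as a guest (`CellMachine.sum_gain`). One machine step
becomes three forced moves: the cell under the head takes the new symbol (`uniqueStep_written`;
omitted if nothing changes), the first controller goes to the next label (`uniqueStep_go`), and the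
second one copies it (`uniqueStep_copy`). A stationary configuration admits no move (`not_step`).

This is proved once, for every game that satisfies `Simulates`: the strategies are the sets just
described, possibly with some of their subsets, and the utility is the number of won resources up to
a constant. In the positions that occur, every player is at most one below its maximum, so an
improving strategy wins a full strategy's worth of resources and must be one. Hence lower ideals and
null actions add no arcs there (`Simulates.step_iff`). The instances are markets with all values
`1`, a valid-utility game whose social function counts the used resources, and a congestion game
whose delays recognise from the load that the guest is alone (`lookup_load`). The uniform market
with listed strategies and the congestion game have the same strategies and equally ordered
utilities, so the identity is an isomorphism of their dynamics (`dynamicsIsoAt_of_simulates`).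

For polynomial time, programs with loops over registers are compiled to stack machines
(`Exec.stepsTo`), and closure properties of `Count`, `Test` and `Printable` reduce the printing of
an instance to local tests (`IsUniform`, `Printable.polyTime`). Encodings are injective, so
membership of a printed word in a decision problem is a statement about the game that was printed.
-/

namespace SinkEq

open Computability Turing Function

/-! ## A structured programming language for stack machines -/

/-- The memory of a program: an input stack (`bits false`), an auxiliary stack of bits
(`bits true`), an output stack and registers. -/
@[ext]
structure Store where
  bits : Bool → List Bool
  out : Word
  reg : ℕ → ℕ

namespace Store

def setReg (S : Store) (r n : ℕ) : Store := { S with reg := update S.reg r n }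

def setBits (S : Store) (k : Bool) (l : List Bool) : Store := { S with bits := update S.bits k l }

def prepend (S : Store) (w : Word) : Store := { S with out := w ++ S.out }

end Store

inductive Prog
  | skip
  | inc (r : ℕ)
  | emit (a : Γ')
  | pushBit (k b : Bool)
  | seq (p q : Prog)
  /-- while register `r` is positive, decrease it and run `p` -/
  | loop (r : ℕ) (p : Prog)
  /-- if register `r` is positive, decrease it and run `p`, otherwise run `q` -/
  | ifpop (r : ℕ) (p q : Prog)
  /-- while the stack is non-empty, pop a bit and run `p` (if it is `true`) or `q` -/
  | loopBit (k : Bool) (p q : Prog)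

/-- `Exec p S S' t`: the program `p` turns the memory `S` into `S'` in `t` steps. -/
inductive Exec : Prog → Store → Store → ℕ → Prop
  | skip (S) : Exec .skip S S 1
  | inc (S r) : Exec (.inc r) S (S.setReg r (S.reg r + 1)) 1
  | emit (S a) : Exec (.emit a) S (S.prepend [a]) 1
  | pushBit (S k b) : Exec (.pushBit k b) S (S.setBits k (b :: S.bits k)) 1
  | seq {p q S S' S'' t t'} : Exec p S S' t → Exec q S' S'' t' → Exec (.seq p q) S S'' (t + t')
  | loop_done {S r p} : S.reg r = 0 → Exec (.loop r p) S S 1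
  | loop_step {S S' S'' r p n t t'} : S.reg r = n + 1 → Exec p (S.setReg r n) S' t →
      Exec (.loop r p) S' S'' t' → Exec (.loop r p) S S'' (1 + t + t')
  | ifpop_zero {S S' r p q t} : S.reg r = 0 → Exec q S S' t → Exec (.ifpop r p q) S S' (1 + t)
  | ifpop_pos {S S' r p q n t} : S.reg r = n + 1 → Exec p (S.setReg r n) S' t →
      Exec (.ifpop r p q) S S' (1 + t)
  | loopBit_done {S k p q} : S.bits k = [] → Exec (.loopBit k p q) S S 1
  | loopBit_step {S S' S'' k p q b l t t'} : S.bits k = b :: l →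
      Exec (cond b p q) (S.setBits k l) S' t → Exec (.loopBit k p q) S' S'' t' →
      Exec (.loopBit k p q) S S'' (1 + t + t')

namespace Prog

/-- All registers of the program are below this bound. -/
def regBound : Prog → ℕ
  | skip => 0
  | inc r => r + 1
  | emit _ => 0
  | pushBit _ _ => 0
  | seq p q => max p.regBound q.regBound
  | loop r p => max (r + 1) p.regBound
  | ifpop r p q => max (r + 1) (max p.regBound q.regBound)
  | loopBit _ p q => max p.regBound q.regBound

/-- Labels of the compiled program. -/
def Lab : Prog → Type
  | skip => Unit
  | inc _ => Unit
  | emit _ => Unit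
  | pushBit _ _ => Unit
  | seq p q => p.Lab ⊕ q.Lab
  | loop _ p => Option p.Lab
  | ifpop _ p q => Option (p.Lab ⊕ q.Lab)
  | loopBit _ p q => Option (p.Lab ⊕ q.Lab)

@[reducible]
def fintypeLab : (p : Prog) → Fintype p.Lab
  | skip => inferInstanceAs (Fintype Unit)
  | inc _ => inferInstanceAs (Fintype Unit)
  | emit _ => inferInstanceAs (Fintype Unit)
  | pushBit _ _ => inferInstanceAs (Fintype Unit)
  | seq p q => @instFintypeSum _ _ p.fintypeLab q.fintypeLab
  | loop _ p => @instFintypeOption _ p.fintypeLab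
  | ifpop _ p q => @instFintypeOption _ (@instFintypeSum _ _ p.fintypeLab q.fintypeLab)
  | loopBit _ p q => @instFintypeOption _ (@instFintypeSum _ _ p.fintypeLab q.fintypeLab)

def entry : (p : Prog) → p.Lab
  | skip => ()
  | inc _ => ()
  | emit _ => ()
  | pushBit _ _ => ()
  | seq p _ => Sum.inl p.entry
  | loop _ _ => (none : Option _)
  | ifpop _ _ _ => (none : Option _)
  | loopBit _ _ _ => (none : Option _)

/-- Stacks of the machine with `R` registers. -/
inductive Stk (R : ℕ)
  | bits (k : Bool)
  | out
  | reg (i : Fin R)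
  deriving DecidableEq, Fintype

/-- The stack alphabets; registers are in unary. -/
abbrev StkΓ {R : ℕ} : Stk R → Type
  | .bits _ => Bool
  | .out => Γ'
  | .reg _ => Unit

def _root_.SinkEq.Store.stk (S : Store) {R : ℕ} : (k : Stk R) → List (StkΓ k)
  | .bits k => S.bits k
  | .out => S.out
  | .reg i => List.replicate (S.reg i) ()

open TM2.Stmt in
/-- The statements of the compiled program; `emb` embeds its labels, `exit` is the next label. -/
def trans {R : ℕ} [NeZero R] : (p : Prog) → {Λ : Type} → (p.Lab → Λ) → Λ → p.Lab →
    TM2.Stmt (StkΓ (R := R)) Λ (Option Bool)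
  | skip, _, _, exit, _ => goto fun _ => exit
  | inc r, _, _, exit, _ => push (Stk.reg (Fin.ofNat R r)) (fun _ => ()) (goto fun _ => exit)
  | emit a, _, _, exit, _ => push Stk.out (fun _ => a) (goto fun _ => exit)
  | pushBit k b, _, _, exit, _ => push (Stk.bits k) (fun _ => b) (goto fun _ => exit)
  | seq p q, _, emb, exit, l =>
      Sum.rec (fun l => p.trans (fun l => emb (Sum.inl l)) (emb (Sum.inr q.entry)) l)
        (fun l => q.trans (fun l => emb (Sum.inr l)) exit l) l
  | loop r p, _, emb, exit, l =>
      Option.rec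
        (pop (Stk.reg (Fin.ofNat R r)) (fun _ o => o.map fun _ => true)
          (branch Option.isSome
            (load (fun _ => none) (goto fun _ => emb (some p.entry : Option _)))
            (load (fun _ => none) (goto fun _ => exit))))
        (fun l => p.trans (fun l => emb (some l : Option _)) (emb (none : Option _)) l) l
  | ifpop r p q, _, emb, exit, l =>
      Option.rec
        (pop (Stk.reg (Fin.ofNat R r)) (fun _ o => o.map fun _ => true)
          (branch Option.isSome
            (load (fun _ => none) (goto fun _ => emb (some (Sum.inl p.entry) : Option _)))
            (load (fun _ => none) (goto fun _ => emb (some (Sum.inr q.entry) : Option _)))))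
        (fun l => Sum.rec (fun l => p.trans (fun l => emb (some (Sum.inl l) : Option _)) exit l)
          (fun l => q.trans (fun l => emb (some (Sum.inr l) : Option _)) exit l) l) l
  | loopBit k p q, _, emb, exit, l =>
      Option.rec
        (pop (Stk.bits k) (fun _ o => o)
          (branch Option.isSome
            (branch (fun o => o == some true)
              (load (fun _ => none) (goto fun _ => emb (some (Sum.inl p.entry) : Option _)))
              (load (fun _ => none) (goto fun _ => emb (some (Sum.inr q.entry) : Option _))))
            (load (fun _ => none) (goto fun _ => exit))))
        (fun l => Sum.rec
          (fun l => p.trans (fun l => emb (some (Sum.inl l) : Option _)) (emb (none : Option _)) l)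
          (fun l => q.trans (fun l => emb (some (Sum.inr l) : Option _)) (emb (none : Option _)) l)
          l) l

end Prog

/-! ### Correctness of the compilation -/

open Prog

/-- `Fin.ofNat` reduces modulo `R`; the bound on `r` makes the stack with this index the one that
holds register `r`. -/
theorem Store.stk_setReg (S : Store) {R : ℕ} [NeZero R] {r : ℕ} (hr : r < R) (n : ℕ) :
    (S.setReg r n).stk (R := R) = update S.stk (Stk.reg (Fin.ofNat R r)) (List.replicate n ()) := by
  funext k
  rcases k with k | _ | i
  · simp [Store.stk, Store.setReg]
  · simp [Store.stk, Store.setReg]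
  · by_cases h : i = Fin.ofNat R r
    · subst h
      simp [Store.stk, Store.setReg, Nat.mod_eq_of_lt hr]
    · have h' : i.val ≠ r := by
        rintro rfl
        exact h (by ext; simp)
      rw [update_of_ne (by simpa using h)]
      simp [Store.stk, Store.setReg, h']

theorem Store.stk_setBits (S : Store) {R : ℕ} (k : Bool) (l : List Bool) :
    (S.setBits k l).stk (R := R) = update S.stk (Stk.bits k) l := by
  funext j
  rcases j with j | _ | i
  · by_cases h : j = k
    · subst h; simp [Store.stk, Store.setBits]
    · rw [update_of_ne (by simpa using h)]
      simp [Store.stk, Store.setBits, h]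
  · simp [Store.stk, Store.setBits]
  · simp [Store.stk, Store.setBits]

theorem Store.stk_prepend (S : Store) {R : ℕ} (w : Word) :
    (S.prepend w).stk (R := R) = update S.stk Stk.out (w ++ S.out) := by
  funext j
  rcases j with j | _ | i <;> simp [Store.stk, Store.prepend]

theorem Store.stk_reg (S : Store) {R : ℕ} [NeZero R] {r : ℕ} (hr : r < R) :
    S.stk (Stk.reg (Fin.ofNat R r)) = List.replicate (S.reg r) () := by
  simp [Store.stk, Nat.mod_eq_of_lt hr]

/-- `n` steps lead from `c` to `c'`. -/
def StepsTo {X : Type} (f : X → Option X) (n : ℕ) (c c' : X) : Prop :=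
  (flip bind f)^[n] (some c) = some c'

theorem StepsTo.trans {X : Type} {f : X → Option X} {m n : ℕ} {a b c : X}
    (h : StepsTo f m a b) (h' : StepsTo f n b c) : StepsTo f (m + n) a c := by
  unfold StepsTo at *
  rw [Nat.add_comm, Function.iterate_add_apply, h, h']

theorem StepsTo.one {X : Type} {f : X → Option X} {a b : X} (h : f a = some b) :
    StepsTo f 1 a b := by
  simpa [StepsTo, flip] using h

theorem step_of_eq {R : ℕ} {Λ : Type} {M : Λ → TM2.Stmt (StkΓ (R := R)) Λ (Option Bool)} {l : Λ}
    {s : TM2.Stmt (StkΓ (R := R)) Λ (Option Bool)} (h : M l = s) (v : Option Bool)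
    (S : (k : Stk R) → List (StkΓ k)) :
    TM2.step M ⟨some l, v, S⟩ = some (TM2.stepAux s v S) := by
  rw [← h]; rfl

/-- The compiled program simulates the program. -/
theorem Exec.stepsTo {R : ℕ} [NeZero R] {p : Prog} {S S' : Store} {t : ℕ} (h : Exec p S S' t)
    (hR : p.regBound ≤ R) {Λ : Type} (M : Λ → TM2.Stmt (StkΓ (R := R)) Λ (Option Bool))
    (emb : p.Lab → Λ) (exit : Λ) (hM : ∀ l, M (emb l) = p.trans emb exit l) :
    StepsTo (TM2.step M) t ⟨some (emb p.entry), none, S.stk⟩ ⟨some exit, none, S'.stk⟩ := by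
  -- The exit label has to vary: the first half of a `seq` leaves to the entry of the second, a loop
  -- body leaves to the test of its loop. The internal state is `none` at every label, and each unit
  -- of cost in `Exec` is one step of the compiled machine.
  induction h generalizing exit with
  | skip S =>
    refine StepsTo.one ((step_of_eq (hM _) _ _).trans ?_)
    simp [Prog.trans]
  | inc S r =>
    have hr : r < R := hR
    refine StepsTo.one ((step_of_eq (hM _) _ _).trans ?_)
    simp [-Fin.ofNat_eq_cast, Prog.trans, Store.stk_setReg S hr, Store.stk_reg S hr,
      List.replicate_succ]
  | emit S a =>
    refine StepsTo.one ((step_of_eq (hM _) _ _).trans ?_)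
    simp [Prog.trans, Store.stk_prepend]
    rfl
  | pushBit S k b =>
    refine StepsTo.one ((step_of_eq (hM _) _ _).trans ?_)
    simp [Prog.trans, Store.stk_setBits]
    rfl
  | @seq p q S S' S'' t t' h1 h2 ih1 ih2 =>
    have hR' : p.regBound ≤ R ∧ q.regBound ≤ R := by simpa [regBound] using hR
    exact (ih1 hR'.1 (fun l => emb (Sum.inl l)) (emb (Sum.inr q.entry))
      (fun l => hM (Sum.inl l))).trans
      (ih2 hR'.2 (fun l => emb (Sum.inr l)) exit (fun l => hM (Sum.inr l)))
  | @loop_done S r p h0 =>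
    have hR' : r < R ∧ p.regBound ≤ R := by simpa [regBound] using hR
    refine StepsTo.one ((step_of_eq (hM _) _ _).trans ?_)
    have h1 := Store.stk_reg S hR'.1
    rw [h0] at h1
    have h2 : update S.stk (Stk.reg (Fin.ofNat R r)) [] = S.stk := by
      rw [update_eq_self_iff, h1]; rfl
    simp [-Fin.ofNat_eq_cast, Prog.trans, Prog.entry, h1, h2]
  | @loop_step S S' S'' r p n t t' h0 h1 h2 ih1 ih2 =>
    have hR' : r < R ∧ p.regBound ≤ R := by simpa [regBound] using hR
    have e1 := Store.stk_reg S hR'.1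
    rw [h0] at e1
    refine ((StepsTo.one ((step_of_eq (hM _) _ _).trans ?_)).trans
      (ih1 hR'.2 (fun l => emb (some l : Option _)) (emb (none : Option _))
        (fun l => hM (some l : Option _)))).trans (ih2 hR emb exit hM)
    simp [-Fin.ofNat_eq_cast, Prog.trans, Prog.entry, e1, List.replicate_succ,
      Store.stk_setReg S hR'.1]
  | @ifpop_zero S S' r p q t h0 h1 ih =>
    have hR' : r < R ∧ p.regBound ≤ R ∧ q.regBound ≤ R := by simpa [regBound] using hR
    have e1 := Store.stk_reg S hR'.1
    rw [h0] at e1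
    have e2 : update S.stk (Stk.reg (Fin.ofNat R r)) [] = S.stk := by
      rw [update_eq_self_iff, e1]; rfl
    refine (StepsTo.one ((step_of_eq (hM _) _ _).trans ?_)).trans
      (ih hR'.2.2 (fun l => emb (some (Sum.inr l) : Option _)) exit
        (fun l => hM (some (Sum.inr l) : Option _)))
    simp [-Fin.ofNat_eq_cast, Prog.trans, Prog.entry, e1, e2]
  | @ifpop_pos S S' r p q n t h0 h1 ih =>
    have hR' : r < R ∧ p.regBound ≤ R ∧ q.regBound ≤ R := by simpa [regBound] using hR
    have e1 := Store.stk_reg S hR'.1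
    rw [h0] at e1
    refine (StepsTo.one ((step_of_eq (hM _) _ _).trans ?_)).trans
      (ih hR'.2.1 (fun l => emb (some (Sum.inl l) : Option _)) exit
        (fun l => hM (some (Sum.inl l) : Option _)))
    simp [-Fin.ofNat_eq_cast, Prog.trans, Prog.entry, e1, List.replicate_succ,
      Store.stk_setReg S hR'.1]
  | @loopBit_done S k p q h0 =>
    have e1 : S.stk (R := R) (Stk.bits k) = [] := h0
    have e2 : update S.stk (Stk.bits k) [] = S.stk (R := R) := by
      rw [update_eq_self_iff, e1]
    refine StepsTo.one ((step_of_eq (hM _) _ _).trans ?_)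
    simp [Prog.trans, Prog.entry, e1, e2]
  | @loopBit_step S S' S'' k p q b l t t' h0 h1 h2 ih1 ih2 =>
    have hR' : p.regBound ≤ R ∧ q.regBound ≤ R := by simpa [regBound] using hR
    have e1 : S.stk (R := R) (Stk.bits k) = b :: l := h0
    cases b with
    | true =>
      refine ((StepsTo.one ((step_of_eq (hM _) _ _).trans ?_)).trans
        (ih1 hR'.1 (fun l => emb (some (Sum.inl l) : Option _)) (emb (none : Option _))
          (fun l => hM (some (Sum.inl l) : Option _)))).trans (ih2 hR emb exit hM)
      simp [Prog.trans, Prog.entry, e1, Store.stk_setBits]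
    | false =>
      refine ((StepsTo.one ((step_of_eq (hM _) _ _).trans ?_)).trans
        (ih1 hR'.2 (fun l => emb (some (Sum.inr l) : Option _)) (emb (none : Option _))
          (fun l => hM (some (Sum.inr l) : Option _)))).trans (ih2 hR emb exit hM)
      simp [Prog.trans, Prog.entry, e1, Store.stk_setBits]

/-- The memory with input `x` and nothing else. -/
def Store.init (x : List Bool) : Store where
  bits k := cond k [] x
  out := []
  reg _ := 0

/-- The memory with output `w` and nothing else. -/
def Store.final (w : Word) : Store where
  bits _ := []
  out := w
  reg _ := 0

/-- The stack machine of a program. -/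
def Prog.machine (p : Prog) : FinTM2 where
  K := Stk (p.regBound + 1)
  k₀ := .bits false
  k₁ := .out
  Γ := StkΓ
  Λ := Option p.Lab
  main := some p.entry
  ΛFin := @instFintypeOption _ p.fintypeLab
  σ := Option Bool
  initialState := none
  Γk₀Fin := inferInstanceAs (Fintype Bool)
  m l := Option.rec TM2.Stmt.halt (p.trans some none) l

/-- A function computed by a program in polynomial time is computed by a stack machine in
polynomial time. -/
theorem Prog.polyTime (p : Prog) (f : List Bool → Word) (q : Polynomial ℕ)
    (h : ∀ x, ∃ t ≤ q.eval x.length, Exec p (Store.init x) (Store.final (f x)) t) :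
    Nonempty (TM2ComputableInPolyTime (id : List Bool → List Bool) (id : Word → Word) f) := by
  choose t ht hx using h
  -- The additional step executes the `halt` statement at the exit label `none`.
  refine ⟨{ tm := p.machine, inputAlphabet := Equiv.refl Bool, outputAlphabet := Equiv.refl Γ',
            time := q + 1, outputsFun := fun x => ⟨⟨t x + 1, ?_⟩, ?_⟩ }⟩
  · have h1 := (hx x).stepsTo (R := p.regBound + 1) (Nat.le_succ _) (Λ := Option p.Lab)
      p.machine.m some none (fun l => rfl)
    have h2 : StepsTo (TM2.step p.machine.m) 1 ⟨some none, none, (Store.final (f x)).stk⟩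
      ⟨none, none, (Store.final (f x)).stk⟩ := StepsTo.one rfl
    have h3 := h1.trans h2
    unfold StepsTo at h3
    have e1 : initList p.machine (List.map (Equiv.refl Bool).invFun (id x)) =
        ⟨some (some p.entry), none, (Store.init x).stk⟩ := by
      unfold initList
      congr 1
      funext k
      rcases k with (_ | _) | _ | i
      · exact (dif_pos rfl).trans (List.map_id x)
      · rw [dif_neg (by intro h; cases h)]; rfl
      · rw [dif_neg (by intro h; cases h)]; rfl
      · rw [dif_neg (by intro h; cases h)]; rfl
    have e2 : haltList p.machine (List.map (Equiv.refl Γ').invFun (id (f x))) =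
        ⟨none, none, (Store.final (f x)).stk⟩ := by
      unfold haltList
      congr 1
      funext k
      rcases k with _ | _ | i
      · rw [dif_neg (by intro h; cases h)]; rfl
      · exact (dif_pos rfl).trans (List.map_id (f x))
      · rw [dif_neg (by intro h; cases h)]; rfl
    erw [e1, Option.map_some, e2]
    exact h3
  · simpa using ht x

end SinkEq

namespace SinkEq

open Computability Turing Function Polynomial

/-! ## Polynomial-time printing -/

theorem eval_mono_nat (q : ℕ[X]) {m n : ℕ} (h : m ≤ n) : q.eval m ≤ q.eval n := by
  induction q using Polynomial.induction_on' with
  | add p q hp hq => simpa using add_le_add hp hq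
  | monomial k c => simpa using Nat.mul_le_mul_left c (Nat.pow_le_pow_left h k)

theorem encodeNat_zero : encodeNat 0 = [] := rfl

theorem encodeNat_odd (j : ℕ) : encodeNat (2 * j + 1) = true :: encodeNat j := by
  unfold encodeNat
  have h : ((2 * j + 1 : ℕ) : Num) = Num.bit1 (j : Num) := by
    rw [← Num.bit1_of_bit1]; push_cast; ring
  rw [h]
  cases (j : Num) <;> rfl

/-- The form `2 * (j + 1)` excludes zero, whose numeral is empty. -/
theorem encodeNat_even (j : ℕ) : encodeNat (2 * (j + 1)) = false :: encodeNat (j + 1) := by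
  unfold encodeNat
  have h : ((2 * (j + 1) : ℕ) : Num) = Num.bit0 ((j + 1 : ℕ) : Num) := by
    rw [← Num.bit0_of_bit0]; push_cast; ring
  rw [h]
  have h' : ((j + 1 : ℕ) : Num) ≠ 0 := by
    intro h0
    have h1 := congrArg (fun n : Num => (n : ℕ)) h0
    simp only [Num.to_of_nat, Num.cast_zero] at h1
    omega
  revert h'
  cases ((j + 1 : ℕ) : Num)
  · intro h'; exact absurd rfl h'
  · intro; rfl

/-! ### Elementary loops on registers and stacks -/

namespace Exec

/-- A register grows by at most one per step. So a program that writes a number in polynomial time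
also shows that the number is polynomially bounded, and with it the number of rounds of a loop that
it controls. -/
theorem reg_le {p : Prog} {S S' : Store} {t : ℕ} (h : Exec p S S' t) (r : ℕ) :
    S'.reg r ≤ S.reg r + t := by
  induction h with
  | skip | emit | pushBit | loop_done | loopBit_done => simp [Store.prepend, Store.setBits]
  | inc S r' =>
    simp only [Store.setReg, update_apply]
    split_ifs with h
    · subst h; rfl
    · omega
  | seq _ _ h1 h2 => omega
  | @loop_step S S' S'' r' p n t t' h0 _ _ h1 h2 =>
    have : (S.setReg r' n).reg r ≤ S.reg r := by
      simp only [Store.setReg, update_apply]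
      split_ifs with h
      · subst h; omega
      · omega
    omega
  | ifpop_zero _ _ h => omega
  | @ifpop_pos S S' r' p q n t h0 _ h1 =>
    have : (S.setReg r' n).reg r ≤ S.reg r := by
      simp only [Store.setReg, update_apply]
      split_ifs with h
      · subst h; omega
      · omega
    omega
  | loopBit_step _ _ _ h1 h2 =>
    simp only [Store.setBits] at h1
    omega

/-- `T n` is the memory when the test finds `n` in the counter. The loop therefore runs from `T N`
down to `T 0`, and the body starts with the counter already decreased. -/
theorem loop_of {r : ℕ} {p : Prog} {B : ℕ} (T : ℕ → Store) (N : ℕ)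
    (hreg : ∀ n ≤ N, (T n).reg r = n)
    (hbody : ∀ n < N, ∃ t ≤ B, Exec p ((T (n + 1)).setReg r n) (T n) t) :
    ∃ t ≤ N * (B + 1) + 1, Exec (.loop r p) (T N) (T 0) t := by
  induction N with
  | zero => exact ⟨1, by omega, .loop_done (hreg 0 le_rfl)⟩
  | succ N ih =>
    obtain ⟨t, ht, h⟩ := ih (fun n hn => hreg n (by omega)) (fun n hn => hbody n (by omega))
    obtain ⟨t', ht', h'⟩ := hbody N (by omega)
    refine ⟨1 + t' + t, ?_, .loop_step (hreg (N + 1) le_rfl) h' h⟩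
    have : (N + 1) * (B + 1) = N * (B + 1) + B + 1 := by ring
    omega

/-- Move the content of register `r` to register `d`. -/
theorem drain {r d : ℕ} (hrd : r ≠ d) (S : Store) :
    ∃ t ≤ 2 * S.reg r + 1,
      Exec (.loop r (.inc d)) S ((S.setReg r 0).setReg d (S.reg d + S.reg r)) t := by
  have key := loop_of (r := r) (p := .inc d) (B := 1)
    (fun n => (S.setReg r n).setReg d (S.reg d + (S.reg r - n))) (S.reg r)
    (fun n _ => by simp [Store.setReg, hrd])
    (fun n hn => ⟨1, le_rfl, by
      convert Exec.inc _ _ using 1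
      ext1
      · rfl
      · rfl
      · funext j
        simp only [Store.setReg, update_apply]
        split_ifs <;> omega⟩)
  obtain ⟨t, ht, h⟩ := key
  refine ⟨t, by omega, ?_⟩
  convert h using 1
  · ext1
    · rfl
    · rfl
    · funext j
      simp only [Store.setReg, update_apply]
      split_ifs <;> simp_all
  · simp

theorem zero (r : ℕ) (S : Store) :
    ∃ t ≤ 2 * S.reg r + 1, Exec (.loop r .skip) S (S.setReg r 0) t := by
  obtain ⟨t, ht, h⟩ := loop_of (r := r) (p := .skip) (B := 1) (fun n => S.setReg r n) (S.reg r)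
    (fun n _ => by simp [Store.setReg])
    (fun n hn => ⟨1, le_rfl, by
      convert Exec.skip _ using 1
      simp [Store.setReg]⟩)
  refine ⟨t, by omega, ?_⟩
  convert h using 1
  simp [Store.setReg]

/-- Move all bits from one stack to the other one. -/
theorem pour (k : Bool) (S : Store) :
    ∃ t ≤ 2 * (S.bits k).length + 1,
      Exec (.loopBit k (.pushBit (!k) true) (.pushBit (!k) false)) S
        ((S.setBits k []).setBits (!k) ((S.bits k).reverse ++ S.bits (!k))) t := by
  generalize hl : S.bits k = l
  induction l generalizing S with
  | nil =>
    refine ⟨1, by simp, ?_⟩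
    convert Exec.loopBit_done hl using 1
    ext1
    · funext j
      cases j <;> cases k <;> simp_all [Store.setBits]
    · rfl
    · rfl
  | cons b l ih =>
    obtain ⟨t, ht, h⟩ := ih ((S.setBits k l).setBits (!k) (b :: S.bits (!k)))
      (by cases k <;> simp [Store.setBits])
    have h1 : Exec (cond b (.pushBit (!k) true) (.pushBit (!k) false)) (S.setBits k l)
        ((S.setBits k l).setBits (!k) (b :: S.bits (!k))) 1 := by
      have : (S.setBits k l).bits (!k) = S.bits (!k) := by cases k <;> simp [Store.setBits]
      rw [← this]
      cases b <;> exact Exec.pushBit _ _ _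
    refine ⟨1 + 1 + t, by simp; omega, ?_⟩
    convert Exec.loopBit_step hl h1 h using 1
    ext1
    · funext j
      cases j <;> cases k <;> simp [Store.setBits]
    · rfl
    · rfl

/-- Empty a stack of bits into the output. -/
theorem emitBits (k : Bool) (S : Store) :
    ∃ t ≤ 2 * (S.bits k).length + 1,
      Exec (.loopBit k (.emit (.bit true)) (.emit (.bit false))) S
        ((S.setBits k []).prepend ((S.bits k).reverse.map Γ'.bit)) t := by
  generalize hl : S.bits k = l
  induction l generalizing S with
  | nil =>
    refine ⟨1, by simp, ?_⟩
    convert Exec.loopBit_done hl using 1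
    ext1
    · simp [Store.setBits, Store.prepend, ← hl]
    · simp [Store.setBits, Store.prepend]
    · rfl
  | cons b l ih =>
    obtain ⟨t, ht, h⟩ := ih ((S.setBits k l).prepend [Γ'.bit b])
      (by simp [Store.setBits, Store.prepend])
    have h1 : Exec (cond b (.emit (.bit true)) (.emit (.bit false))) (S.setBits k l)
        ((S.setBits k l).prepend [Γ'.bit b]) 1 := by
      cases b <;> exact Exec.emit _ _
    refine ⟨1 + 1 + t, by simp; omega, ?_⟩
    convert Exec.loopBit_step hl h1 h using 1
    ext1
    · simp [Store.setBits, Store.prepend]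
    · simp [Store.setBits, Store.prepend]
    · rfl

/-- Forget a stack of bits. -/
theorem clearBits (k : Bool) (S : Store) :
    ∃ t ≤ 2 * (S.bits k).length + 1, Exec (.loopBit k .skip .skip) S (S.setBits k []) t := by
  generalize hl : S.bits k = l
  induction l generalizing S with
  | nil =>
    refine ⟨1, by simp, ?_⟩
    convert Exec.loopBit_done hl using 1
    ext1
    · simp [Store.setBits, ← hl]
    · rfl
    · rfl
  | cons b l ih =>
    obtain ⟨t, ht, h⟩ := ih (S.setBits k l) (by simp [Store.setBits])
    have h1 : Exec (cond b .skip .skip) (S.setBits k l) (S.setBits k l) 1 := by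
      cases b <;> exact Exec.skip _
    refine ⟨1 + 1 + t, by simp; omega, ?_⟩
    convert Exec.loopBit_step hl h1 h using 1
    simp [Store.setBits]

end Exec

end SinkEq

/-! ### Numbers computed from values that are kept in memory -/

namespace SinkEq

open Computability Turing Function Polynomial

/-- Values that are kept in memory: an input word and the contents of the first registers. -/
class Ctx (α : Type) where
  depth : ℕ
  inp : α → List Bool
  reg : α → ℕ → ℕ

instance : Ctx (List Bool) where
  depth := 1
  inp := id
  reg x _ := x.length

instance {α : Type} [Ctx α] : Ctx (α × ℕ) where
  depth := Ctx.depth α + 1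
  inp a := Ctx.inp a.1
  reg a j := if j = Ctx.depth α then a.2 else Ctx.reg a.1 j

namespace Ctx

variable {α : Type} [Ctx α]

def size (a : α) : ℕ := (inp a).length + ∑ j ∈ Finset.range (depth α), reg a j

theorem size_prod (a : α) (i : ℕ) : size (a, i) = size a + i := by
  have h : ∑ j ∈ Finset.range (depth α), reg (a, i) j = ∑ j ∈ Finset.range (depth α), reg a j := by
    refine Finset.sum_congr rfl fun j hj => ?_
    have : j ≠ depth α := (Finset.mem_range.1 hj).ne
    simp [reg, this]
  have h2 : reg (a, i) (depth α) = i := by simp [reg]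
  unfold size
  change (inp a).length + ∑ j ∈ Finset.range (depth α + 1), reg (a, i) j = _
  rw [Finset.sum_range_succ, h, h2]
  omega

theorem reg_le_size (a : α) {j : ℕ} (hj : j < depth α) : reg a j ≤ size a := by
  have := Finset.single_le_sum (f := fun j => reg a j) (fun _ _ => Nat.zero_le _)
    (Finset.mem_range.2 hj)
  unfold size
  omega

theorem length_le_size (a : α) : (inp a).length ≤ size a := Nat.le_add_right _ _

/-- The value `a` is kept in the memory `S`. -/
structure Agree (a : α) (S : Store) : Prop where
  inp : S.bits false = inp a
  aux : S.bits true = []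
  reg : ∀ j < depth α, S.reg j = Ctx.reg a j

theorem Agree.of_eq {a : α} {S S' : Store} (h : Agree a S) (hb : S'.bits = S.bits)
    (hr : ∀ j < depth α, S'.reg j = S.reg j) : Agree a S' :=
  ⟨by rw [hb]; exact h.inp, by rw [hb]; exact h.aux, fun j hj => (hr j hj).trans (h.reg j hj)⟩

theorem Agree.fst {a : α} {i : ℕ} {S : Store} (h : Agree (a, i) S) : Agree a S := by
  refine ⟨h.inp, h.aux, fun j hj => ?_⟩
  rw [h.reg j (Nat.lt_succ_of_lt hj)]
  simp [Ctx.reg, hj.ne]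

end Ctx

open Ctx

variable {α : Type} [Ctx α]

/-- A program can add the number `e a` to a register in polynomial time. -/
def Count (e : α → ℕ) : Prop :=
  ∀ d ≥ depth α, ∃ (p : Prog) (q : ℕ[X]), ∀ (a : α) (S : Store), Agree a S →
    (∀ j > d, S.reg j = 0) →
      ∃ t ≤ q.eval (size a), Exec p S (S.setReg d (S.reg d + e a)) t

/-- A program can print the word `f a` in polynomial time. -/
def Printable (f : α → Word) : Prop :=
  ∃ (p : Prog) (q : ℕ[X]), ∀ (a : α) (S : Store), Agree a S →
    (∀ j ≥ depth α, S.reg j = 0) → ∃ t ≤ q.eval (size a), Exec p S (S.prepend (f a)) t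

namespace Count

theorem const (c : ℕ) : Count (fun _ : α => c) := by
  intro d _
  induction c with
  | zero =>
    refine ⟨.skip, 1, fun a S _ _ => ⟨1, by simp, ?_⟩⟩
    convert Exec.skip S using 1
    simp [Store.setReg]
  | succ c ih =>
    obtain ⟨p, q, h⟩ := ih
    refine ⟨.seq p (.inc d), q + 1, fun a S ha hz => ?_⟩
    obtain ⟨t, ht, h⟩ := h a S ha hz
    refine ⟨t + 1, by simpa using ht, ?_⟩
    convert Exec.seq h (Exec.inc _ d) using 1
    simp [Store.setReg, add_assoc]

theorem fst {e : α → ℕ} (he : Count e) : Count (fun b : α × ℕ => e b.1) := by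
  intro d hd
  obtain ⟨p, q, h⟩ := he d (Nat.le_of_succ_le hd)
  refine ⟨p, q, fun b S hb hz => ?_⟩
  obtain ⟨t, ht, h⟩ := h b.1 S hb.fst hz
  refine ⟨t, ht.trans (eval_mono_nat q ?_), h⟩
  rw [size_prod b.1 b.2]
  omega

/-- Reading a register destroys it, so its content is moved to `d` and to the scratch register `d +
1` at once and then restored from the latter. -/
theorem reg {v : ℕ} (hv : v < depth α) : Count (fun a : α => Ctx.reg a v) := by
  intro d hd
  refine ⟨.seq (.loop v (.seq (.inc d) (.inc (d + 1)))) (.loop (d + 1) (.inc v)), 5 * X + 2,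
    fun a S ha hz => ?_⟩
  have h0 := hz (d + 1) (by omega)
  change ∃ t ≤ _, Exec _ S (S.setReg d (S.reg d + Ctx.reg a v)) t
  rw [← ha.reg v hv]
  obtain ⟨t, ht, h⟩ := Exec.loop_of (r := v) (p := .seq (.inc d) (.inc (d + 1))) (B := 2)
    (fun n => ((S.setReg v n).setReg d (S.reg d + (S.reg v - n))).setReg (d + 1) (S.reg v - n))
    (S.reg v)
    (fun n _ => by
      have h1 : v ≠ d + 1 := by omega
      have h2 : v ≠ d := by omega
      simp [Store.setReg, h1, h2])
    (fun n hn => ⟨2, le_rfl, by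
      convert Exec.seq (Exec.inc _ d) (Exec.inc _ (d + 1)) using 1
      ext1
      · rfl
      · rfl
      · funext j
        simp only [Store.setReg, update_apply]
        split_ifs <;> omega⟩)
  obtain ⟨t', ht', h'⟩ := Exec.drain (r := d + 1) (d := v) (by omega)
    (((S.setReg v 0).setReg d (S.reg d + (S.reg v - 0))).setReg (d + 1) (S.reg v - 0))
  refine ⟨t + t', ?_, ?_⟩
  · have h1 : Ctx.reg a v ≤ size a := reg_le_size a hv
    have h2 : S.reg v = Ctx.reg a v := ha.reg v hv
    simp [Store.setReg] at ht'
    simp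
    omega
  · convert Exec.seq h h' using 1
    · ext1
      · rfl
      · rfl
      · funext j
        simp only [Store.setReg, update_apply]
        split_ifs <;> first | omega | (subst_vars; omega)
    · ext1
      · rfl
      · rfl
      · funext j
        simp only [Store.setReg, update_apply]
        split_ifs <;> first | omega | (subst_vars; omega)

theorem snd : Count (fun b : α × ℕ => b.2) := by
  have h := Count.reg (α := α × ℕ) (v := depth α) (Nat.lt_succ_self _)
  convert h using 2
  simp [Ctx.reg]

theorem length : Count (fun x : List Bool => x.length) :=
  Count.reg (α := List Bool) (v := 0) Nat.zero_lt_one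

theorem add {e e' : α → ℕ} (he : Count e) (he' : Count e') : Count (fun a => e a + e' a) := by
  intro d hd
  obtain ⟨p, q, h⟩ := he d hd
  obtain ⟨p', q', h'⟩ := he' d hd
  refine ⟨.seq p p', q + q', fun a S ha hz => ?_⟩
  obtain ⟨t, ht, h⟩ := h a S ha hz
  obtain ⟨t', ht', h'⟩ := h' a (S.setReg d (S.reg d + e a))
    (ha.of_eq rfl fun j hj => by
      have : j ≠ d := by omega
      simp [Store.setReg, this])
    (fun j hj => by
      have : j ≠ d := by omega
      simp [Store.setReg, this, hz j hj])
  refine ⟨t + t', by simpa using add_le_add ht ht', ?_⟩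
  convert Exec.seq h h' using 1
  simp [Store.setReg, add_assoc]

/-- The first factor, in `d + 1`, counts rounds; each round computes the second factor anew in `d +
2` and drains it into `d`. The number of rounds is at most the time spent on computing the first
factor. -/
theorem mul {e e' : α → ℕ} (he : Count e) (he' : Count e') : Count (fun a => e a * e' a) := by
  intro d hd
  obtain ⟨p, q, h⟩ := he (d + 1) (by omega)
  obtain ⟨p', q', h'⟩ := he' (d + 2) (by omega)
  refine ⟨.seq p (.loop (d + 1) (.seq p' (.loop (d + 2) (.inc d)))),
    q + (q * (q' + (2 * q' + 1) + 1) + 1), fun a S ha hz => ?_⟩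
  obtain ⟨t, ht, h⟩ := h a S ha (fun j hj => hz j (by omega))
  have hle : e a ≤ t := by
    have := h.reg_le (d + 1)
    simp [Store.setReg] at this
    omega
  have z1 := hz (d + 1) (by omega)
  have z2 := hz (d + 2) (by omega)
  obtain ⟨t₂, ht₂, h₂⟩ := Exec.loop_of (r := d + 1) (p := .seq p' (.loop (d + 2) (.inc d)))
    (B := q'.eval (size a) + (2 * q'.eval (size a) + 1))
    (fun n => (S.setReg (d + 1) n).setReg d (S.reg d + (e a - n) * e' a)) (e a)
    (fun n _ => by simp [Store.setReg])
    (fun n hn => by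
      obtain ⟨t, ht, h⟩ := h' a
        (((S.setReg (d + 1) (n + 1)).setReg d (S.reg d + (e a - (n + 1)) * e' a)).setReg (d + 1) n)
        (ha.of_eq rfl fun j hj => by
          have h1 : j ≠ d := by omega
          have h2 : j ≠ d + 1 := by omega
          simp [Store.setReg, h1, h2])
        (fun j hj => by
          have h1 : j ≠ d := by omega
          have h2 : j ≠ d + 1 := by omega
          simp [Store.setReg, h1, h2, hz j (by omega)])
      have hle' : e' a ≤ t := by
        have := h.reg_le (d + 2)
        simp [Store.setReg] at this
        omega
      obtain ⟨t', ht', h'⟩ := Exec.drain (r := d + 2) (d := d) (by omega)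
        ((((S.setReg (d + 1) (n + 1)).setReg d (S.reg d + (e a - (n + 1)) * e' a)).setReg
          (d + 1) n).setReg (d + 2) (0 + e' a))
      refine ⟨t + t', ?_, ?_⟩
      · simp [Store.setReg] at ht'
        omega
      · have hc : (((S.setReg (d + 1) (n + 1)).setReg d (S.reg d + (e a - (n + 1)) * e' a)).setReg
            (d + 1) n).reg (d + 2) = 0 := by simp [Store.setReg, z2]
        rw [hc] at h
        convert Exec.seq h h' using 1
        have hmul : (e a - n) * e' a = (e a - (n + 1)) * e' a + e' a := by
          have : e a - n = e a - (n + 1) + 1 := by omega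
          rw [this]; ring
        ext1
        · rfl
        · rfl
        · funext j
          simp only [Store.setReg, update_apply, hmul]
          split_ifs <;> first | omega | (subst_vars; omega))
  refine ⟨t + t₂, ?_, ?_⟩
  · simp only [eval_add, eval_mul, eval_one, eval_ofNat]
    have : e a * (q'.eval (size a) + (2 * q'.eval (size a) + 1) + 1) ≤
      q.eval (size a) * (q'.eval (size a) + (2 * q'.eval (size a) + 1) + 1) :=
      Nat.mul_le_mul_right _ (hle.trans ht)
    omega
  · convert Exec.seq h (q := .loop (d + 1) (.seq p' (.loop (d + 2) (.inc d)))) ?_ using 1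
    convert h₂ using 1
    · ext1
      · rfl
      · rfl
      · funext j
        simp [Store.setReg, update_apply, z1]
        rintro rfl
        simp
    · ext1
      · rfl
      · rfl
      · funext j
        simp only [Store.setReg, update_apply]
        split_ifs <;> simp_all

/-- Each unit of `e'` in `d + 2` cancels one unit of `e` in `d + 1` as long as there is one, which
gives truncated subtraction. -/
theorem sub {e e' : α → ℕ} (he : Count e) (he' : Count e') : Count (fun a => e a - e' a) := by
  intro d hd
  obtain ⟨p, q, h⟩ := he (d + 1) (by omega)
  obtain ⟨p', q', h'⟩ := he' (d + 2) (by omega)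
  refine ⟨.seq (.seq p p') (.seq (.loop (d + 2) (.ifpop (d + 1) .skip .skip))
    (.loop (d + 1) (.inc d))), q + q' + ((q' * 3 + 1) + (2 * q + 1)), fun a S ha hz => ?_⟩
  obtain ⟨t, ht, h⟩ := h a S ha (fun j hj => hz j (by omega))
  have z1 := hz (d + 1) (by omega)
  have z2 := hz (d + 2) (by omega)
  obtain ⟨t', ht', h'⟩ := h' a (S.setReg (d + 1) (S.reg (d + 1) + e a))
    (ha.of_eq rfl fun j hj => by
      have : j ≠ d + 1 := by omega
      simp [Store.setReg, this])
    (fun j hj => by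
      have : j ≠ d + 1 := by omega
      simp [Store.setReg, this, hz j (by omega)])
  have hle : e a ≤ t := by
    have := h.reg_le (d + 1)
    simp [Store.setReg] at this
    omega
  have hle' : e' a ≤ t' := by
    have := h'.reg_le (d + 2)
    simp [Store.setReg] at this
    omega
  obtain ⟨t₂, ht₂, h₂⟩ := Exec.loop_of (r := d + 2) (p := .ifpop (d + 1) .skip .skip) (B := 2)
    (fun n => (S.setReg (d + 2) n).setReg (d + 1) (e a - (e' a - n))) (e' a)
    (fun n _ => by simp [Store.setReg])
    (fun n hn => by
      refine ⟨2, le_rfl, ?_⟩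
      have h1 : (((S.setReg (d + 2) (n + 1)).setReg (d + 1) (e a - (e' a - (n + 1)))).setReg
          (d + 2) n).reg (d + 1) = e a - (e' a - (n + 1)) := by simp [Store.setReg]
      by_cases h0 : e a - (e' a - (n + 1)) = 0
      · convert Exec.ifpop_zero (h1.trans h0) (Exec.skip _) using 1
        ext1
        · rfl
        · rfl
        · funext j
          simp only [Store.setReg, update_apply]
          split_ifs <;> omega
      · convert Exec.ifpop_pos (n := e a - (e' a - (n + 1)) - 1) (h1.trans (by omega))
          (Exec.skip _) using 1
        ext1
        · rfl
        · rfl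
        · funext j
          simp only [Store.setReg, update_apply]
          split_ifs <;> omega)
  obtain ⟨t₃, ht₃, h₃⟩ := Exec.drain (r := d + 1) (d := d) (by omega)
    ((S.setReg (d + 2) 0).setReg (d + 1) (e a - (e' a - 0)))
  refine ⟨t + t' + (t₂ + t₃), ?_, .seq (.seq h h') ?_⟩
  · simp [Store.setReg] at ht₃
    simp only [eval_add, eval_mul, eval_one, eval_ofNat]
    omega
  · convert Exec.seq ?_ h₃ using 1
    · ext1
      · rfl
      · rfl
      · funext j
        simp only [Store.setReg, update_apply]
        split_ifs <;> first | omega | simp_all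
    · convert h₂ using 1
      ext1
      · rfl
      · rfl
      · funext j
        simp only [Store.setReg, update_apply]
        split_ifs <;> omega

end Count

/-- Decrease register `c` if it is positive, and run `p` when it becomes zero. -/
def Prog.countdown (c : ℕ) (p : Prog) : Prog := .ifpop c (.ifpop c (.inc c) p) .skip

theorem Exec.countdown_zero {c : ℕ} {p : Prog} {S : Store} (h : S.reg c = 0) :
    Exec (.countdown c p) S S (1 + 1) := .ifpop_zero h (.skip S)

theorem Exec.countdown_one {c : ℕ} {p : Prog} {S S' : Store} {t : ℕ} (h : S.reg c = 1)
    (hp : Exec p (S.setReg c 0) S' t) : Exec (.countdown c p) S S' (1 + (1 + t)) :=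
  .ifpop_pos h (.ifpop_zero (by simp [Store.setReg]) hp)

theorem Exec.countdown_succ {c n : ℕ} {p : Prog} {S : Store} (h : S.reg c = n + 2) :
    Exec (.countdown c p) S (S.setReg c (n + 1)) (1 + (1 + 1)) := by
  refine .ifpop_pos (n := n + 1) h ?_
  have hr : (S.setReg c (n + 1)).reg c = n + 1 := by simp [Store.setReg]
  convert Exec.ifpop_pos (q := p) hr (Exec.inc _ c) using 1
  simp [Store.setReg]

/-- A letter as a number. -/
def letterCode (o : Option Bool) : ℕ := o.elim 0 fun b => b.toNat + 1

/-- Pop a bit from the input, and add its code to register `d` if the countdown `d + 1` ends. -/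
def Prog.scanBit (d : ℕ) (b : Bool) : Prog :=
  .seq (.pushBit true b) (.countdown (d + 1) (cond b (.seq (.inc d) (.inc d)) (.inc d)))

/-- The memory during a scan of the input: `l` is still unread, `acc` has been read, `m` is the
countdown and `n` the result so far. -/
def Store.scanned (S : Store) (d : ℕ) (l acc : List Bool) (m n : ℕ) : Store where
  bits k := cond k acc l
  out := S.out
  reg j := if j = d then n else if j = d + 1 then m else S.reg j

theorem Exec.scanBit (d : ℕ) (b : Bool) (S : Store) (l acc : List Bool) (m n : ℕ) :
    ∃ t ≤ 6, Exec (.scanBit d b) (S.scanned d l acc m n)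
      (S.scanned d l (b :: acc) (m - 1) (if m = 1 then n + (b.toNat + 1) else n)) t := by
  have h1 : Exec (.pushBit true b) (S.scanned d l acc m n) (S.scanned d l (b :: acc) m n) 1 := by
    convert Exec.pushBit _ true b using 1
    ext1
    · funext j
      cases j <;> simp [Store.setBits, Store.scanned]
    · rfl
    · rfl
  have hm : (S.scanned d l (b :: acc) m n).reg (d + 1) = m := by simp [Store.scanned]
  rcases m with _ | _ | m
  · exact ⟨_, by norm_num, Exec.seq h1 (Exec.countdown_zero hm)⟩
  · cases b
    · refine ⟨1 + (1 + (1 + 1)), by norm_num, Exec.seq h1 (Exec.countdown_one hm ?_)⟩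
      change Exec (.inc d) _ _ _
      convert Exec.inc _ d using 1
      ext1
      · rfl
      · rfl
      · funext j
        simp only [Store.scanned, Store.setReg, update_apply]
        split_ifs <;> first | omega | simp
    · refine ⟨1 + (1 + (1 + (1 + 1))), by norm_num, Exec.seq h1 (Exec.countdown_one hm ?_)⟩
      change Exec (.seq (.inc d) (.inc d)) _ _ _
      convert Exec.seq (Exec.inc _ d) (Exec.inc _ d) using 1
      ext1
      · rfl
      · rfl
      · funext j
        simp only [Store.scanned, Store.setReg, update_apply]
        split_ifs <;> first | omega | simp
  · refine ⟨1 + (1 + (1 + 1)), by norm_num, Exec.seq h1 ?_⟩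
    convert Exec.countdown_succ hm using 1
    ext1
    · rfl
    · rfl
    · funext j
      simp only [Store.scanned, Store.setReg, update_apply]
      split_ifs <;> omega

/-- The countdown is one-based: `m = 1` singles out the next bit, and at `m = 0` nothing more is
recorded. The bits read pile up in reverse order on the auxiliary stack, from which they can be
poured back. -/
theorem Exec.scan (d : ℕ) (S : Store) (l acc : List Bool) (m n : ℕ) :
    ∃ t ≤ l.length * 7 + 1, Exec (.loopBit false (.scanBit d true) (.scanBit d false))
      (S.scanned d l acc m n) (S.scanned d [] (l.reverse ++ acc) (m - l.length)
        (n + if m = 0 then 0 else letterCode l[m - 1]?)) t := by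
  induction l generalizing acc m n with
  | nil => exact ⟨1, by simp, by simpa [letterCode] using Exec.loopBit_done rfl⟩
  | cons b l ih =>
    obtain ⟨t', ht', h'⟩ := Exec.scanBit d b S l acc m n
    obtain ⟨t, ht, h⟩ := ih (b :: acc) (m - 1) (if m = 1 then n + (b.toNat + 1) else n)
    have h0 : (S.scanned d (b :: l) acc m n).bits false = b :: l := rfl
    have h1 : Exec (cond b (.scanBit d true) (.scanBit d false))
        ((S.scanned d (b :: l) acc m n).setBits false l)
        (S.scanned d l (b :: acc) (m - 1) (if m = 1 then n + (b.toNat + 1) else n)) t' := by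
      have e : (S.scanned d (b :: l) acc m n).setBits false l = S.scanned d l acc m n := by
        ext1
        · funext j
          cases j <;> simp [Store.setBits, Store.scanned]
        · rfl
        · rfl
      rw [e]
      cases b <;> exact h'
    refine ⟨1 + t' + t, by simp only [List.length_cons]; omega, ?_⟩
    convert Exec.loopBit_step h0 h1 h using 1
    congr 1
    · simp
    · simp only [List.length_cons]; omega
    · rcases m with _ | _ | m <;> simp [letterCode]

/-- The letter at a given position of the input, as a number: `0` if there is none. -/
theorem Count.inp {e : α → ℕ} (he : Count e) : Count (fun a => letterCode (Ctx.inp a)[e a]?) := by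
  intro d hd
  obtain ⟨p, q, h⟩ := he (d + 1) (by omega)
  -- The extra `inc` makes the position one-based. After the scan, what is left of the countdown is
  -- cleared (the position may lie beyond the input) and the input is poured back.
  refine ⟨.seq (.seq p (.inc (d + 1))) (.seq (.seq
        (.loopBit false (.scanBit d true) (.scanBit d false)) (.loop (d + 1) .skip))
        (.loopBit true (.pushBit false true) (.pushBit false false))),
      (q + 1) + ((7 * X + 1 + (2 * (q + 1) + 1)) + (2 * X + 1)), fun a S ha hz => ?_⟩
  obtain ⟨t, ht, h⟩ := h a S ha (fun j hj => hz j (by omega))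
  have z1 := hz (d + 1) (by omega)
  have hle : e a ≤ t := by
    have := h.reg_le (d + 1)
    simp [Store.setReg] at this
    omega
  have h' := Exec.seq h (Exec.inc _ (d + 1))
  have e1 : (S.setReg (d + 1) (S.reg (d + 1) + e a)).setReg (d + 1)
      ((S.setReg (d + 1) (S.reg (d + 1) + e a)).reg (d + 1) + 1) =
      S.scanned d (Ctx.inp a) [] (e a + 1) (S.reg d) := by
    ext1
    · funext k
      cases k
      · exact ha.inp
      · exact ha.aux
    · rfl
    · funext j
      simp only [Store.scanned, Store.setReg, update_apply, z1]
      split_ifs <;> first | omega | (subst_vars; omega)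
  rw [e1] at h'
  obtain ⟨t₂, ht₂, h₂⟩ := Exec.scan d S (Ctx.inp a) [] (e a + 1) (S.reg d)
  generalize hn : (S.reg d + if e a + 1 = 0 then 0 else letterCode (Ctx.inp a)[e a + 1 - 1]?) = n
    at h₂
  obtain ⟨t₃, ht₃, h₃⟩ := Exec.zero (d + 1) (S.scanned d [] ((Ctx.inp a).reverse ++ [])
    (e a + 1 - (Ctx.inp a).length) n)
  have e2 : (S.scanned d [] ((Ctx.inp a).reverse ++ []) (e a + 1 - (Ctx.inp a).length) n).setReg
      (d + 1) 0 = S.scanned d [] (Ctx.inp a).reverse 0 n := by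
    ext1
    · simp [Store.setReg, Store.scanned]
    · rfl
    · funext j
      simp only [Store.scanned, Store.setReg, update_apply]
      split_ifs <;> omega
  rw [e2] at h₃
  obtain ⟨t₄, ht₄, h₄⟩ := Exec.pour true (S.scanned d [] (Ctx.inp a).reverse 0 n)
  change Exec (.loopBit true (.pushBit false true) (.pushBit false false)) _ _ _ at h₄
  have hlen := length_le_size a
  refine ⟨t + 1 + (t₂ + t₃ + t₄), ?_, ?_⟩
  · simp [Store.scanned] at ht₃ ht₄
    simp only [eval_add, eval_mul, eval_one, eval_ofNat, eval_X]
    omega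
  · convert Exec.seq h' (Exec.seq (Exec.seq h₂ h₃) h₄) using 1
    ext1
    · funext j
      cases j
      · simp [Store.setReg, Store.setBits, Store.scanned, ha.inp]
      · simp [Store.setReg, Store.setBits, Store.scanned, ha.aux]
    · rfl
    · funext j
      simp only [Store.setReg, Store.setBits, Store.scanned, update_apply]
      simp only [Nat.succ_ne_zero, if_false, Nat.add_sub_cancel] at hn
      split_ifs with h1 h2
      · exact hn
      · rw [h2, z1]
      · rfl

end SinkEq

/-! ### Tests, composite words and binary numerals -/

namespace SinkEq

open Computability Turing Function Polynomial Ctx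

variable {α : Type} [Ctx α]

/-- A program can test the condition `P` in polynomial time. -/
def Test (P : α → Bool) : Prop := Count fun a => (P a).toNat

namespace Test

theorem const (b : Bool) : Test (fun _ : α => b) := Count.const _

theorem not {P : α → Bool} (h : Test P) : Test (fun a => !P a) := by
  have := (Count.const (α := α) 1).sub h
  unfold Test
  convert this using 2 with a
  cases hP : P a <;> simp [hP]

theorem and {P P' : α → Bool} (h : Test P) (h' : Test P') : Test (fun a => P a && P' a) := by
  have := Count.mul h h'
  unfold Test
  convert this using 2 with a
  cases hP : P a <;> cases hP' : P' a <;> simp [hP, hP']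

theorem or {P P' : α → Bool} (h : Test P) (h' : Test P') : Test (fun a => P a || P' a) := by
  convert (h.not.and h'.not).not using 2 with a
  cases P a <;> cases P' a <;> rfl

theorem fst {P : α → Bool} (h : Test P) : Test (fun b : α × ℕ => P b.1) := Count.fst h

/-- In truncated subtraction, `1 - (1 - k)` is `0` for `k = 0` and `1` otherwise; this is applied to
`e' - e`. -/
theorem lt {e e' : α → ℕ} (h : Count e) (h' : Count e') : Test (fun a => decide (e a < e' a)) := by
  have := (Count.const (α := α) 1).sub ((Count.const (α := α) 1).sub (h'.sub h))
  unfold Test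
  convert this using 2 with a
  by_cases h : e a < e' a
  · simp [h]; omega
  · simp [h]; omega

theorem eq {e e' : α → ℕ} (h : Count e) (h' : Count e') : Test (fun a => decide (e a = e' a)) := by
  convert ((lt h h').or (lt h' h)).not using 2 with a
  by_cases h : e a = e' a
  · simp [h]
  · rcases Nat.lt_or_gt_of_ne h with h' | h' <;> simp [h, h']

theorem cond {P f g : α → Bool} (h : Test P) (hf : Test f) (hg : Test g) :
    Test (fun a => if P a then f a else g a) := by
  convert (h.and hf).or (h.not.and hg) using 2 with a
  cases P a <;> simp

end Test

theorem Count.eval (p : ℕ[X]) {e : α → ℕ} (he : Count e) : Count (fun a => p.eval (e a)) := by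
  induction p using Polynomial.induction_on' with
  | add p q hp hq => simpa using hp.add hq
  | monomial k c =>
    simp only [eval_monomial]
    refine (Count.const c).mul ?_
    induction k with
    | zero => simpa using Count.const 1
    | succ k ih => simpa [pow_succ] using ih.mul he

namespace Printable

theorem nil : Printable (fun _ : α => []) :=
  ⟨.skip, 1, fun _ S _ _ => ⟨1, by simp, Exec.skip S⟩⟩

/-- The output grows at its front, so the second word is printed first. -/
theorem append {f g : α → Word} (hf : Printable f) (hg : Printable g) :
    Printable (fun a => f a ++ g a) := by
  obtain ⟨p, q, h⟩ := hf
  obtain ⟨p', q', h'⟩ := hg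
  refine ⟨.seq p' p, q' + q, fun a S ha hz => ?_⟩
  obtain ⟨t', ht', h'⟩ := h' a S ha hz
  obtain ⟨t, ht, h⟩ := h a (S.prepend (g a)) (ha.of_eq rfl fun _ _ => rfl) hz
  refine ⟨t' + t, by simpa using add_le_add ht' ht, ?_⟩
  convert Exec.seq h' h using 1
  simp [Store.prepend]

theorem single (s : Γ') : Printable (fun _ : α => [s]) :=
  ⟨.emit s, 1, fun _ S _ _ => ⟨1, by simp, Exec.emit S s⟩⟩

theorem const (w : Word) : Printable (fun _ : α => w) := by
  induction w with
  | nil => exact nil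
  | cons s w ih => exact (single s).append ih

theorem flatMap_fixed {β : Type} (l : List β) {f : α → β → Word}
    (hf : ∀ b ∈ l, Printable fun a => f a b) : Printable (fun a => l.flatMap (f a)) := by
  induction l with
  | nil => exact nil
  | cons b l ih =>
    simp only [List.flatMap_cons]
    exact (hf b (by simp)).append (ih fun b hb => hf b (by simp [hb]))

/-- The test leaves `0` or `1` in the first free register, and `ifpop` consumes it; so `f` is
printed from clean registers. -/
theorem cond {P : α → Bool} {f : α → Word} (hP : Test P) (hf : Printable f) :
    Printable (fun a => if P a then f a else []) := by
  obtain ⟨p, q, h⟩ := hP (depth α) le_rfl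
  obtain ⟨p', q', h'⟩ := hf
  refine ⟨.seq p (.ifpop (depth α) p' .skip), q + (q' + 2), fun a S ha hz => ?_⟩
  obtain ⟨t, ht, h⟩ := h a S ha (fun j hj => hz j hj.le)
  have h0 := hz _ le_rfl
  have e : (S.setReg (depth α) (S.reg (depth α) + (P a).toNat)).reg (depth α) = (P a).toNat := by
    simp [Store.setReg, h0]
  cases hPa : P a with
  | false =>
    refine ⟨t + (1 + 1), by simp; omega, ?_⟩
    simp only [hPa] at h e
    convert Exec.seq h (Exec.ifpop_zero e (Exec.skip _)) using 1
    simp [Store.prepend, Store.setReg, hPa]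
  | true =>
    obtain ⟨t', ht', h'⟩ := h' a S ha hz
    refine ⟨t + (1 + t'), by simp; omega, ?_⟩
    simp only [hPa] at h e
    refine Exec.seq h (Exec.ifpop_pos (n := 0) e ?_)
    convert h' using 1
    · simp only [Store.setReg, update_idem]
      rw [← h0, update_eq_self]
    · simp [hPa]

theorem ite {P : α → Bool} {f g : α → Word} (hP : Test P) (hf : Printable f) (hg : Printable g) :
    Printable (fun a => if P a then f a else g a) := by
  convert (cond hP hf).append (cond hP.not hg) using 2 with a
  cases P a <;> simp

/-- The loop counter is itself the last component of the enlarged context. It counts down while the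
output grows at the front, so the pieces appear in increasing order. -/
theorem forRange {e : α → ℕ} {f : α → ℕ → Word} (he : Count e)
    (hf : Printable fun b : α × ℕ => f b.1 b.2) :
    Printable fun a => (List.range (e a)).flatMap (f a) := by
  obtain ⟨p, q, h⟩ := he (depth α) le_rfl
  obtain ⟨p', q', h'⟩ := hf
  refine ⟨.seq p (.loop (depth α) p'), q + (q * (q'.comp (X + q) + 1) + 1), fun a S ha hz => ?_⟩
  obtain ⟨t, ht, h⟩ := h a S ha (fun j hj => hz j hj.le)
  have h0 := hz _ le_rfl
  have hle : e a ≤ q.eval (size a) := by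
    have := h.reg_le (depth α)
    simp [Store.setReg] at this
    omega
  obtain ⟨t₂, ht₂, h₂⟩ := Exec.loop_of (r := depth α) (p := p')
    (B := q'.eval (size a + q.eval (size a)))
    (fun n => (S.prepend (((List.range (e a)).drop n).flatMap (f a))).setReg (depth α) n) (e a)
    (fun n _ => by simp [Store.setReg])
    (fun n hn => by
      obtain ⟨t, ht, h⟩ := h' (a, n)
        ((S.prepend (((List.range (e a)).drop (n + 1)).flatMap (f a))).setReg (depth α) n)
        (by
          refine ⟨ha.inp, ha.aux, fun j hj => ?_⟩
          by_cases hj' : j = depth α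
          · subst hj'; simp [Store.setReg, Ctx.reg]
          · have : j < depth α := lt_of_le_of_ne (Nat.le_of_lt_succ hj) hj'
            simp [Store.setReg, Ctx.reg, hj', Store.prepend, ha.reg j this])
        (fun j hj => by
          have hj' : j ≠ depth α := (Nat.lt_of_succ_le hj).ne'
          simpa [Store.setReg, Store.prepend, hj'] using hz j (Nat.le_of_succ_le hj))
      refine ⟨t, ht.trans (eval_mono_nat q' ?_), ?_⟩
      · rw [size_prod]; omega
      · convert h using 1
        · simp [Store.setReg]
        · rw [List.drop_eq_getElem_cons (by simpa using hn)]
          simp [Store.setReg, Store.prepend])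
  refine ⟨t + t₂, ?_, ?_⟩
  · have : e a * (q'.eval (size a + q.eval (size a)) + 1) ≤
      q.eval (size a) * (q'.eval (size a + q.eval (size a)) + 1) := Nat.mul_le_mul_right _ hle
    simp only [eval_add, eval_mul, eval_comp, eval_one, eval_X]
    omega
  · refine Exec.seq h ?_
    convert h₂ using 1
    · rw [List.drop_of_length_le (by simp), h0]
      simp [Store.prepend, Store.setReg]
    · simp only [Store.prepend, Store.setReg, List.drop_zero]
      rw [← h0, update_eq_self]

end Printable

/-- The binary digits of register `d` are moved to the auxiliary stack. -/
theorem Exec.digits (d : ℕ) : ∃ p : Prog, ∀ (k : ℕ) (S : Store), S.reg d = k → S.reg (d + 1) = 0 →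
    S.reg (d + 2) = 0 → ∃ t ≤ 10 * k ^ 2 + 1, Exec (.loop d p) S
      ((S.setReg d 0).setBits true ((encodeNat k).reverse ++ S.bits true)) t := by
  -- The outer `loop` has already turned `k + 1` into `k`. The inner loop halves `k`, with quotient
  -- in `d + 1` and remainder in `d + 2`. Remainder `1` means that `k + 1` is even: the digit is
  -- `false` and the quotient must be raised by one.
  refine ⟨.seq (.loop d (.ifpop (d + 2) (.inc (d + 1)) (.inc (d + 2)))) (.seq (.ifpop (d + 2)
    (.seq (.pushBit true false) (.inc (d + 1))) (.pushBit true true)) (.loop (d + 1) (.inc d))),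
    fun k => ?_⟩
  induction k using Nat.strong_induction_on with
  | _ k ih =>
    intro S hk h1 h2
    rcases k with _ | k
    · refine ⟨1, by simp, ?_⟩
      convert Exec.loop_done hk using 1
      ext1
      · funext j; cases j <;> simp [Store.setReg, Store.setBits, encodeNat_zero]
      · rfl
      · simp only [Store.setReg, Store.setBits]; rw [← hk, update_eq_self]
    · have e2 : d + 1 ≠ d := by omega
      have e3 : d + 2 ≠ d := by omega
      have e4 : d + 2 ≠ d + 1 := by omega
      obtain ⟨t₁, ht₁, x₁⟩ := Exec.loop_of (r := d)
        (p := .ifpop (d + 2) (.inc (d + 1)) (.inc (d + 2))) (B := 2)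
        (fun n => ((S.setReg d n).setReg (d + 1) ((k - n) / 2)).setReg (d + 2) ((k - n) % 2)) k
        (fun n _ => by simp [Store.setReg])
        (fun n hn => by
          have hr : ((((S.setReg d (n + 1)).setReg (d + 1) ((k - (n + 1)) / 2)).setReg (d + 2)
            ((k - (n + 1)) % 2)).setReg d n).reg (d + 2) = (k - (n + 1)) % 2 := by
            simp [Store.setReg]
          refine ⟨1 + 1, le_rfl, ?_⟩
          rcases Nat.mod_two_eq_zero_or_one (k - (n + 1)) with h | h
          · convert Exec.ifpop_zero (hr.trans h) (Exec.inc _ _) using 1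
            ext1
            · rfl
            · rfl
            · funext j
              simp only [Store.setReg, update_apply]
              split_ifs <;> omega
          · convert Exec.ifpop_pos (hr.trans h) (Exec.inc _ _) using 1
            ext1
            · rfl
            · rfl
            · funext j
              simp only [Store.setReg, update_apply]
              split_ifs <;> omega)
      have x₂ : ∃ t ≤ 3, Exec (.ifpop (d + 2)
          (.seq (.pushBit true false) (.inc (d + 1))) (.pushBit true true))
          (((S.setReg d 0).setReg (d + 1) ((k - 0) / 2)).setReg (d + 2) ((k - 0) % 2))
          (((S.setReg d 0).setReg (d + 1) ((k + 1) / 2)).setBits true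
            (decide (k % 2 = 0) :: S.bits true)) t := by
        have hr : (((S.setReg d 0).setReg (d + 1) ((k - 0) / 2)).setReg (d + 2)
          ((k - 0) % 2)).reg (d + 2) = k % 2 := by simp [Store.setReg]
        rcases Nat.mod_two_eq_zero_or_one k with h | h
        · refine ⟨1 + 1, by norm_num, ?_⟩
          convert Exec.ifpop_zero (hr.trans h) (Exec.pushBit _ _ _) using 1
          ext1
          · simp [Store.setReg, Store.setBits, h]
          · rfl
          · funext j
            simp only [Store.setReg, Store.setBits, update_apply]
            split_ifs <;> first | omega | (subst_vars; omega)
        · refine ⟨1 + (1 + 1), by norm_num, ?_⟩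
          convert Exec.ifpop_pos (hr.trans h) (Exec.seq (Exec.pushBit _ _ _) (Exec.inc _ _)) using 1
          ext1
          · simp [Store.setReg, Store.setBits, h]
          · rfl
          · funext j
            simp only [Store.setReg, Store.setBits, update_apply]
            split_ifs <;> first | omega | (subst_vars; omega)
      obtain ⟨t₂, ht₂, x₂⟩ := x₂
      obtain ⟨t₃, ht₃, x₃⟩ := Exec.drain e2 (((S.setReg d 0).setReg (d + 1) ((k + 1) / 2)).setBits
        true (decide (k % 2 = 0) :: S.bits true))
      have e5 : (((((S.setReg d 0).setReg (d + 1) ((k + 1) / 2)).setBits true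
          (decide (k % 2 = 0) :: S.bits true)).setReg (d + 1) 0).setReg d
          ((((S.setReg d 0).setReg (d + 1) ((k + 1) / 2)).setBits true
          (decide (k % 2 = 0) :: S.bits true)).reg d +
          (((S.setReg d 0).setReg (d + 1) ((k + 1) / 2)).setBits true
          (decide (k % 2 = 0) :: S.bits true)).reg (d + 1))) =
          (S.setReg d ((k + 1) / 2)).setBits true (decide (k % 2 = 0) :: S.bits true) := by
        ext1
        · rfl
        · rfl
        · funext j
          simp only [Store.setReg, Store.setBits, update_apply]
          split_ifs <;> first | omega | (subst_vars; omega)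
      rw [e5] at x₃
      obtain ⟨t₄, ht₄, x₄⟩ := ih ((k + 1) / 2) (by omega)
        ((S.setReg d ((k + 1) / 2)).setBits true (decide (k % 2 = 0) :: S.bits true))
        (by simp [Store.setReg, Store.setBits]) (by simp [Store.setReg, Store.setBits, h1])
        (by simp [Store.setReg, Store.setBits, h2])
      have e6 : ((S.setReg d k).setReg (d + 1) ((k - k) / 2)).setReg (d + 2) ((k - k) % 2) =
          S.setReg d k := by
        ext1
        · rfl
        · rfl
        · funext j
          simp only [Store.setReg, update_apply]
          split_ifs <;> first | omega | (subst_vars; omega)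
      rw [e6] at x₁
      refine ⟨1 + (t₁ + (t₂ + t₃)) + t₄, ?_, ?_⟩
      · simp [Store.setReg, Store.setBits] at ht₃
        have : ((k + 1) / 2) ^ 2 ≤ k ^ 2 + 0 := by
          rcases Nat.eq_zero_or_pos k with rfl | hk'
          · simp
          · exact Nat.pow_le_pow_left (by omega) 2
        have e : 10 * (k + 1) ^ 2 = 10 * k ^ 2 + 20 * k + 10 := by ring
        omega
      · convert Exec.loop_step hk (Exec.seq x₁ (Exec.seq x₂ x₃)) x₄ using 1
        ext1
        · funext j
          cases j
          · simp [Store.setReg, Store.setBits]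
          · rcases Nat.mod_two_eq_zero_or_one k with h | h
            · obtain ⟨i, rfl⟩ : ∃ i, k = 2 * i := ⟨k / 2, by omega⟩
              have : (2 * i + 1) / 2 = i := by omega
              simp [Store.setReg, Store.setBits, encodeNat_odd, this]
            · obtain ⟨i, rfl⟩ : ∃ i, k = 2 * i + 1 := ⟨k / 2, by omega⟩
              have h3 : (2 * i + 1 + 1) / 2 = i + 1 := by omega
              have h4 : 2 * i + 1 + 1 = 2 * (i + 1) := by ring
              rw [h3, h4, encodeNat_even]
              simp [Store.setReg, Store.setBits]
        · rfl
        · funext j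
          simp only [Store.setReg, Store.setBits, update_apply]
          split_ifs <;> rfl

theorem length_encodeNat_le (k : ℕ) : (encodeNat k).length ≤ k := by
  induction k using Nat.strong_induction_on with
  | _ k ih =>
    rcases Nat.even_or_odd' k with ⟨j, rfl | rfl⟩
    · rcases j with _ | j
      · simp [encodeNat_zero]
      · rw [encodeNat_even, List.length_cons]
        have := ih (j + 1) (by omega)
        omega
    · rw [encodeNat_odd, List.length_cons]
      have := ih j (by omega)
      omega

/-- Since the output grows at its front, the comma is emitted first and then the digits from the
most significant one on, which is the top of the auxiliary stack. -/
theorem Printable.encNat {e : α → ℕ} (he : Count e) : Printable (fun a => encNat (e a)) := by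
  obtain ⟨p, q, h⟩ := he (depth α) le_rfl
  obtain ⟨p', h'⟩ := Exec.digits (depth α)
  refine ⟨.seq p (.seq (.seq (.emit .comma) (.loop (depth α) p'))
    (.loopBit true (.emit (.bit true)) (.emit (.bit false)))),
    q + ((1 + (10 * q ^ 2 + 1)) + (2 * q + 1)), fun a S ha hz => ?_⟩
  obtain ⟨t, ht, h⟩ := h a S ha (fun j hj => hz j hj.le)
  have h0 := hz _ le_rfl
  have hle : e a ≤ q.eval (size a) := by
    have := h.reg_le (depth α)
    simp [Store.setReg] at this
    omega
  rw [h0, zero_add] at h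
  obtain ⟨t₂, ht₂, h₂⟩ := h' (e a) ((S.setReg (depth α) (e a)).prepend [.comma])
    (by simp [Store.setReg, Store.prepend])
    (by simpa [Store.setReg, Store.prepend] using hz (depth α + 1) (by omega))
    (by simpa [Store.setReg, Store.prepend] using hz (depth α + 2) (by omega))
  obtain ⟨t₃, ht₃, h₃⟩ := Exec.emitBits true
    ((((S.setReg (depth α) (e a)).prepend [.comma]).setReg (depth α) 0).setBits true
      ((encodeNat (e a)).reverse ++ ((S.setReg (depth α) (e a)).prepend [.comma]).bits true))
  have haux := ha.aux
  refine ⟨t + (1 + t₂ + t₃), ?_, ?_⟩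
  · have h3 := length_encodeNat_le (e a)
    simp [Store.setReg, Store.setBits, Store.prepend, haux] at ht₃
    have : e a ^ 2 ≤ q.eval (size a) ^ 2 := Nat.pow_le_pow_left hle 2
    simp only [eval_add, eval_mul, eval_pow, eval_one, eval_ofNat]
    omega
  · convert Exec.seq h (Exec.seq (Exec.seq (Exec.emit _ _) h₂) h₃) using 1
    ext1
    · funext j
      cases j <;> simp [Store.setReg, Store.setBits, Store.prepend, haux]
    · simp [Store.setReg, Store.setBits, Store.prepend, haux, SinkEq.encNat]
    · simp only [Store.setReg, Store.setBits, Store.prepend, update_idem]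
      rw [← h0, update_eq_self]

/-- The context of an input word expects its length in register `0`; so the bits are carried to the
auxiliary stack and back while being counted. At the end the register and the input are erased,
because only the output may remain. -/
theorem Printable.polyTime {f : List Bool → Word} (hf : Printable f) :
    Nonempty (TM2ComputableInPolyTime (id : List Bool → List Bool) (id : Word → Word) f) := by
  obtain ⟨p, q, h⟩ := hf
  have scan : ∀ (l : List Bool) (S : Store), S.bits false = l → ∃ t ≤ l.length * 3 + 1,
      Exec (.loopBit false (.seq (.pushBit true true) (.inc 0)) (.seq (.pushBit true false)
        (.inc 0))) S (((S.setBits false []).setBits true (l.reverse ++ S.bits true)).setReg 0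
          (S.reg 0 + l.length)) t := by
    intro l
    induction l with
    | nil =>
      intro S hl
      refine ⟨1, by simp, ?_⟩
      convert Exec.loopBit_done hl using 1
      ext1
      · funext j; cases j <;> simp [Store.setReg, Store.setBits, hl]
      · rfl
      · simp [Store.setReg, Store.setBits]
    | cons b l ih =>
      intro S hl
      obtain ⟨t, ht, h⟩ := ih (((S.setBits false l).setBits true
        (b :: (S.setBits false l).bits true)).setReg 0 (S.reg 0 + 1))
        (by simp [Store.setReg, Store.setBits])
      have h1 : Exec (_root_.cond b (.seq (.pushBit true true) (.inc 0)) (.seq (.pushBit true false)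
        (.inc 0))) (S.setBits false l) (((S.setBits false l).setBits true
        (b :: (S.setBits false l).bits true)).setReg 0 (S.reg 0 + 1)) 2 := by
        cases b <;> exact Exec.seq (Exec.pushBit _ _ _) (Exec.inc _ _)
      refine ⟨1 + 2 + t, by simp only [List.length_cons]; omega, ?_⟩
      convert Exec.loopBit_step hl h1 h using 1
      ext1
      · funext j; cases j <;> simp [Store.setReg, Store.setBits]
      · rfl
      · funext j
        simp [Store.setReg, Store.setBits, update_apply]
        split_ifs <;> omega
  refine Prog.polyTime (.seq (.seq (.seq
    (.loopBit false (.seq (.pushBit true true) (.inc 0)) (.seq (.pushBit true false) (.inc 0)))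
    (.loopBit true (.pushBit false true) (.pushBit false false))) p)
    (.seq (.loop 0 .skip) (.loopBit false .skip .skip))) f
    ((3 * X + 1) + (2 * X + 1) + q.comp (2 * X) + ((2 * X + 1) + (2 * X + 1))) fun x => ?_
  obtain ⟨t₁, ht₁, x₁⟩ := scan x (Store.init x) rfl
  obtain ⟨t₂, ht₂, x₂⟩ := Exec.pour true ((((Store.init x).setBits false []).setBits true
    (x.reverse ++ (Store.init x).bits true)).setReg 0 ((Store.init x).reg 0 + x.length))
  change Exec (.loopBit true (.pushBit false true) (.pushBit false false)) _ _ _ at x₂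
  have e₂ : ((((((Store.init x).setBits false []).setBits true
    (x.reverse ++ (Store.init x).bits true)).setReg 0 ((Store.init x).reg 0 + x.length)).setBits
    true []).setBits (!true) (((((((Store.init x).setBits false []).setBits true
    (x.reverse ++ (Store.init x).bits true)).setReg 0 ((Store.init x).reg 0 + x.length))).bits
    true).reverse ++ (((((Store.init x).setBits false []).setBits true
    (x.reverse ++ (Store.init x).bits true)).setReg 0 ((Store.init x).reg 0 + x.length))).bits
    !true)) = (Store.init x).setReg 0 x.length := by
    ext1
    · funext j; cases j <;> simp [Store.init, Store.setReg, Store.setBits]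
    · rfl
    · simp [Store.init, Store.setReg, Store.setBits]
  rw [e₂] at x₂
  obtain ⟨t₃, ht₃, x₃⟩ := h x ((Store.init x).setReg 0 x.length)
    (by
      refine ⟨rfl, rfl, fun j hj => ?_⟩
      have : j = 0 := Nat.lt_one_iff.1 hj
      subst this
      simp [Store.setReg, Ctx.reg])
    (fun j hj => by
      have : j ≠ 0 := (Nat.lt_of_succ_le hj).ne'
      simp [Store.setReg, Store.init, this])
  obtain ⟨t₄, ht₄, x₄⟩ := Exec.zero 0 (((Store.init x).setReg 0 x.length).prepend (f x))
  obtain ⟨t₅, ht₅, x₅⟩ := Exec.clearBits false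
    ((((Store.init x).setReg 0 x.length).prepend (f x)).setReg 0 0)
  refine ⟨t₁ + t₂ + t₃ + (t₄ + t₅), ?_, ?_⟩
  · have hs : size x = 2 * x.length := by
      change x.length + ∑ j ∈ Finset.range 1, x.length = _
      simp; ring
    rw [hs] at ht₃
    simp [Store.setReg, Store.setBits, Store.prepend, Store.init] at ht₂ ht₄ ht₅
    simp only [eval_add, eval_mul, eval_comp, eval_one, eval_ofNat, eval_X]
    omega
  · convert Exec.seq (Exec.seq (Exec.seq x₁ x₂) x₃) (Exec.seq x₄ x₅) using 1
    ext1
    · funext j; cases j <;> simp [Store.init, Store.final, Store.setReg, Store.setBits,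
        Store.prepend]
    · simp [Store.init, Store.final, Store.setReg, Store.setBits, Store.prepend]
    · funext j
      simp [Store.init, Store.final, Store.setReg, Store.setBits, Store.prepend]

end SinkEq

namespace SinkEq

open Computability Function

/-! ## Instances are determined by their encodings -/

/-- A code whose words can be read off from the beginning of a string, and do not begin with a
closing bracket. -/
structure IsCode {α : Type} (e : α → Word) : Prop where
  head : ∀ a, ∃ s w, e a = s :: w ∧ s ≠ Γ'.ket
  inj : ∀ a b r r', e a ++ r = e b ++ r' → a = b ∧ r = r'

theorem IsCode.encNat : IsCode encNat := by
  have h : ∀ (l l' : List Bool) (r r' : Word), l.map Γ'.bit ++ [Γ'.comma] ++ r =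
      l'.map Γ'.bit ++ [Γ'.comma] ++ r' → l = l' ∧ r = r' := by
    intro l
    induction l with
    | nil => intro l' r r' h; cases l' <;> simp_all
    | cons b l ih =>
      intro l' r r' h
      cases l' with
      | nil => simp at h
      | cons b' l' =>
        simp only [List.map_cons, List.cons_append, List.cons.injEq, Γ'.bit.injEq] at h
        obtain ⟨h1, h2⟩ := ih l' r r' h.2
        exact ⟨by rw [h.1, h1], h2⟩
  refine ⟨fun k => ?_, fun k k' r r' hk => ?_⟩
  · unfold SinkEq.encNat
    cases encodeNat k <;> simp
  · obtain ⟨h1, h2⟩ := h _ _ _ _ hk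
    refine ⟨?_, h2⟩
    rw [← decode_encodeNat k, h1, decode_encodeNat]

theorem IsCode.encInt : IsCode encInt := by
  refine ⟨fun z => ⟨_, _, rfl, by simp⟩, fun z z' r r' h => ?_⟩
  simp only [SinkEq.encInt, List.cons_append, List.cons.injEq, Γ'.bit.injEq,
    decide_eq_decide] at h
  obtain ⟨h1, h2⟩ := IsCode.encNat.inj _ _ _ _ h.2
  exact ⟨by omega, h2⟩

theorem IsCode.prod {α β : Type} {e : α → Word} {e' : β → Word} (h : IsCode e) (h' : IsCode e') :
    IsCode fun a : α × β => e a.1 ++ e' a.2 := by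
  refine ⟨fun a => ?_, fun a b r r' hab => ?_⟩
  · obtain ⟨s, w, hw, hs⟩ := h.head a.1
    exact ⟨s, w ++ e' a.2, by simp [hw], hs⟩
  · simp only [List.append_assoc] at hab
    obtain ⟨h1, h2⟩ := h.inj _ _ _ _ hab
    obtain ⟨h3, h4⟩ := h'.inj _ _ _ _ h2
    exact ⟨Prod.ext h1 h3, h4⟩

/-- No entry begins with a closing bracket, so the next letter tells whether the list goes on. -/
theorem IsCode.encList {α : Type} {e : α → Word} (h : IsCode e) : IsCode (encList e) := by
  have key : ∀ (l l' : List α) (r r' : Word), l.flatMap e ++ [Γ'.ket] ++ r =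
      l'.flatMap e ++ [Γ'.ket] ++ r' → l = l' ∧ r = r' := by
    intro l
    induction l with
    | nil =>
      intro l' r r' hl
      cases l' with
      | nil => simpa using hl
      | cons b l' =>
        obtain ⟨s, w, hw, hs⟩ := h.head b
        simp [hw, hs.symm] at hl
    | cons b l ih =>
      intro l' r r' hl
      cases l' with
      | nil =>
        obtain ⟨s, w, hw, hs⟩ := h.head b
        simp [hw, hs] at hl
      | cons b' l' =>
        simp only [List.flatMap_cons, List.append_assoc] at hl
        obtain ⟨h1, h2⟩ := h.inj _ _ _ _ hl
        obtain ⟨h3, h4⟩ := ih l' r r' (by simpa using h2)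
        exact ⟨by rw [h1, h3], h4⟩
  refine ⟨fun l => ⟨_, _, rfl, by simp⟩, fun l l' r r' hl => ?_⟩
  simp only [SinkEq.encList, List.cons_append, List.cons.injEq, true_and] at hl
  exact key l l' r r' hl

theorem encList_map {α β : Type} (e : β → Word) (f : α → β) (l : List α) :
    encList e (l.map f) = encList (fun a => e (f a)) l := by
  simp [encList, List.flatMap_map]

theorem encFun_eq {α : Type} {k : ℕ} (c : α → Word) (a : Fin k → α) :
    encFun (fun i => c (a i)) = encList c (List.ofFn a) := by
  rw [List.ofFn_eq_map, encList_map]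
  rfl

/-- The values of the elements of a list. -/
def rawIdx {k : ℕ} (l : List (Fin k)) : List ℕ := l.map Fin.val

theorem rawIdx_injective {k : ℕ} : Injective (rawIdx (k := k)) :=
  List.map_injective_iff.2 Fin.val_injective

theorem encIdx_eq {k : ℕ} (l : List (Fin k)) : encIdx l = encList encNat (rawIdx l) :=
  (encList_map encNat Fin.val l).symm

theorem encList_encIdx_eq {k : ℕ} (l : List (List (Fin k))) :
    encList encIdx l = encList (encList encNat) (l.map rawIdx) := by
  rw [encList_map, ← funext encIdx_eq]

theorem map_rawIdx_injective {k : ℕ} : Injective (List.map (rawIdx (k := k))) :=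
  List.map_injective_iff.2 rawIdx_injective

def rawRule {α β : Type} (f : α → β) (r : Rule α) : (List β × List β) × ℤ :=
  ((r.pos.map f, r.neg.map f), r.val)

theorem rawRule_injective {α β : Type} {f : α → β} (hf : Injective f) :
    Injective (rawRule f) := by
  rintro ⟨p, n, v⟩ ⟨p', n', v'⟩ h
  simp only [rawRule, Prod.mk.injEq] at h
  obtain ⟨⟨h1, h2⟩, rfl⟩ := h
  rw [List.map_injective_iff.2 hf h1, List.map_injective_iff.2 hf h2]

def encRawRule {β : Type} (e : β → Word) (r : (List β × List β) × ℤ) : Word :=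
  (encList e r.1.1 ++ encList e r.1.2) ++ encInt r.2

theorem IsCode.encRawRule {β : Type} {e : β → Word} (h : IsCode e) : IsCode (encRawRule e) :=
  (h.encList.prod h.encList).prod IsCode.encInt

theorem encRules_eq {α β : Type} (e : β → Word) (f : α → β) (l : List (Rule α)) :
    encRules (fun a => e (f a)) l = encList (encRawRule e) (l.map (rawRule f)) := by
  rw [encList_map]
  simp [encRules, encRawRule, rawRule, encList_map]

theorem map_rawRule_injective {α β : Type} {f : α → β} (hf : Injective f) :
    Injective (List.map (rawRule f)) :=
  List.map_injective_iff.2 (rawRule_injective hf)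

theorem encProfile_eq {n m : ℕ} (p : Fin n → List (Fin m)) :
    encProfile p = encList (encList encNat) (List.ofFn fun i => rawIdx (p i)) := by
  rw [← encFun_eq]
  simp [encProfile, encIdx_eq]

theorem length_eq_of_ofFn_eq {α : Type} {k k' : ℕ} {a : Fin k → α} {a' : Fin k' → α}
    (h : List.ofFn a = List.ofFn a') : k = k' := by
  simpa using congrArg List.length h

theorem eq_of_ofFn_comp_eq {α β : Type} {k : ℕ} {f : α → β} (hf : Injective f) {a a' : Fin k → α}
    (h : List.ofFn (fun i => f (a i)) = List.ofFn fun i => f (a' i)) : a = a' := by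
  have := List.ofFn_injective h
  funext i
  exact hf (congrFun this i)

/-- The code is first rewritten over types that do not mention `n` and `m`, so that two instances of
unknown sizes can be compared. Unique readability then gives equal lists; their lengths give the
sizes, and after identifying these the entries give the data. -/
theorem UniformMarket.enc_inj {I I' : UniformMarket} {p : Fin I.n → List (Fin I.m)}
    {p' : Fin I'.n → List (Fin I'.m)} (h : I.enc ++ encProfile p = I'.enc ++ encProfile p') :
    (⟨I, p⟩ : Σ I : UniformMarket, Fin I.n → List (Fin I.m)) = ⟨I', p'⟩ := by
  have e : ∀ I : UniformMarket, I.enc =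
      encList (encList (encList encNat)) (List.ofFn fun x => (I.strat x).map rawIdx) ++
      encList (fun a : ℕ × List ℕ => encNat a.1 ++ encList encNat a.2)
        (List.ofFn fun y => (I.value y, rawIdx (I.pref y))) := by
    intro I
    rw [← encFun_eq, ← encFun_eq]
    simp [UniformMarket.enc, encIdx_eq, encList_encIdx_eq]
  rw [e, e, encProfile_eq, encProfile_eq, List.append_assoc, List.append_assoc] at h
  obtain ⟨h1, h⟩ := IsCode.encNat.encList.encList.encList.inj _ _ _ _ h
  obtain ⟨h2, h⟩ := (IsCode.encNat.prod IsCode.encNat.encList).encList.inj _ _ _ _ h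
  obtain ⟨h3, -⟩ := IsCode.encNat.encList.encList.inj _ _ [] [] (by simpa using h)
  obtain ⟨⟨n, m, strat, pref, hn, hm⟩, value⟩ := I
  obtain ⟨⟨n', m', strat', pref', hn', hm'⟩, value'⟩ := I'
  obtain rfl : n = n' := length_eq_of_ofFn_eq h1
  obtain rfl : m = m' := length_eq_of_ofFn_eq h2
  obtain rfl : strat = strat' := eq_of_ofFn_comp_eq map_rawIdx_injective h1
  have h2' := List.ofFn_injective h2
  obtain rfl : pref = pref' := funext fun y => rawIdx_injective (Prod.ext_iff.1 (congrFun h2' y)).2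
  obtain rfl : value = value' := funext fun y => (Prod.ext_iff.1 (congrFun h2' y)).1
  obtain rfl : p = p' := eq_of_ofFn_comp_eq rawIdx_injective h3
  rfl

theorem ManyToOneMarket.enc_inj {I I' : ManyToOneMarket} {p : Fin I.n → List (Fin I.m)}
    {p' : Fin I'.n → List (Fin I'.m)} (h : I.enc ++ encProfile p = I'.enc ++ encProfile p') :
    (⟨I, p⟩ : Σ I : ManyToOneMarket, Fin I.n → List (Fin I.m)) = ⟨I', p'⟩ := by
  have e : ∀ I : ManyToOneMarket, I.enc =
      encList (fun a : List (List ℕ) × List ((List ℕ × List ℕ) × ℤ) =>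
        encList (encList encNat) a.1 ++ encList (encRawRule encNat) a.2)
        (List.ofFn fun x => ((I.strat x).map rawIdx, (I.util x).map (rawRule Fin.val))) ++
      encList (encList encNat) (List.ofFn fun y => rawIdx (I.pref y)) := by
    intro I
    rw [← encFun_eq, ← encFun_eq]
    simp [ManyToOneMarket.enc, encIdx_eq, encList_encIdx_eq, encRules_eq encNat Fin.val]
  rw [e, e, encProfile_eq, encProfile_eq, List.append_assoc, List.append_assoc] at h
  obtain ⟨h1, h⟩ := (IsCode.encNat.encList.encList.prod
    IsCode.encNat.encRawRule.encList).encList.inj _ _ _ _ h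
  obtain ⟨h2, h⟩ := IsCode.encNat.encList.encList.inj _ _ _ _ h
  obtain ⟨h3, -⟩ := IsCode.encNat.encList.encList.inj _ _ [] [] (by simpa using h)
  obtain ⟨⟨n, m, strat, pref, hn, hm⟩, util⟩ := I
  obtain ⟨⟨n', m', strat', pref', hn', hm'⟩, util'⟩ := I'
  obtain rfl : n = n' := length_eq_of_ofFn_eq h1
  obtain rfl : m = m' := length_eq_of_ofFn_eq h2
  have h1' := List.ofFn_injective h1
  obtain rfl : strat = strat' :=
    funext fun x => map_rawIdx_injective (Prod.ext_iff.1 (congrFun h1' x)).1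
  obtain rfl : util = util' := funext fun x =>
    map_rawRule_injective Fin.val_injective (Prod.ext_iff.1 (congrFun h1' x)).2
  obtain rfl : pref = pref' := eq_of_ofFn_comp_eq rawIdx_injective h2
  obtain rfl : p = p' := eq_of_ofFn_comp_eq rawIdx_injective h3
  rfl

theorem CongestionData.enc_inj {I I' : CongestionData} {p : Fin I.n → List (Fin I.m)}
    {p' : Fin I'.n → List (Fin I'.m)} (h : I.enc ++ encProfile p = I'.enc ++ encProfile p') :
    (⟨I, p⟩ : Σ I : CongestionData, Fin I.n → List (Fin I.m)) = ⟨I', p'⟩ := by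
  have e : ∀ I : CongestionData, I.enc =
      encList (fun a : ℕ × List (List ℕ) => encNat a.1 ++ encList (encList encNat) a.2)
        (List.ofFn fun x => (I.weight x, (I.strat x).map rawIdx)) ++
      encList (encList fun a : ℕ × ℤ => encNat a.1 ++ encInt a.2)
        (List.ofFn fun y => I.delay y) := by
    intro I
    rw [← encFun_eq, ← encFun_eq]
    simp [CongestionData.enc, encList_encIdx_eq]
  rw [e, e, encProfile_eq, encProfile_eq, List.append_assoc, List.append_assoc] at h
  obtain ⟨h1, h⟩ := (IsCode.encNat.prod IsCode.encNat.encList.encList).encList.inj _ _ _ _ h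
  obtain ⟨h2, h⟩ := (IsCode.encNat.prod IsCode.encInt).encList.encList.inj _ _ _ _ h
  obtain ⟨h3, -⟩ := IsCode.encNat.encList.encList.inj _ _ [] [] (by simpa using h)
  obtain ⟨n, m, strat, weight, hw, delay⟩ := I
  obtain ⟨n', m', strat', weight', hw', delay'⟩ := I'
  obtain rfl : n = n' := length_eq_of_ofFn_eq h1
  obtain rfl : m = m' := length_eq_of_ofFn_eq h2
  have h1' := List.ofFn_injective h1
  obtain rfl : strat = strat' :=
    funext fun x => map_rawIdx_injective (Prod.ext_iff.1 (congrFun h1' x)).2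
  obtain rfl : weight = weight' := funext fun x => (Prod.ext_iff.1 (congrFun h1' x)).1
  obtain rfl : delay = delay' := List.ofFn_injective h2
  obtain rfl : p = p' := eq_of_ofFn_comp_eq rawIdx_injective h3
  rfl

theorem ValidUtilityData.enc_inj {I I' : ValidUtilityData} {p : Fin I.n → List (Fin I.m)}
    {p' : Fin I'.n → List (Fin I'.m)} (h : I.enc ++ encProfile p = I'.enc ++ encProfile p') :
    (⟨I, p⟩ : Σ I : ValidUtilityData, Fin I.n → List (Fin I.m)) = ⟨I', p'⟩ := by
  have hval : ∀ n m, Injective fun a : Fin n × Fin m => (a.1.val, a.2.val) := by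
    rintro n m ⟨a, b⟩ ⟨a', b'⟩ h
    simpa [Fin.ext_iff] using h
  have hpair : ∀ n m, (encPair : Fin n × Fin m → Word) =
      fun a => (fun b : ℕ × ℕ => encNat b.1 ++ encNat b.2) (a.1.val, a.2.val) := fun _ _ => rfl
  have e : ∀ I : ValidUtilityData, I.enc = encNat I.m ++
      encList (fun a : List (List ℕ) × List ((List (ℕ × ℕ) × List (ℕ × ℕ)) × ℤ) =>
        encList (encList encNat) a.1 ++
          encList (encRawRule fun b : ℕ × ℕ => encNat b.1 ++ encNat b.2) a.2)
        (List.ofFn fun x => ((I.strat x).map rawIdx,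
          (I.util x).map (rawRule fun a => (a.1.val, a.2.val)))) ++
      encList (encRawRule fun b : ℕ × ℕ => encNat b.1 ++ encNat b.2)
        (I.social.map (rawRule fun a => (a.1.val, a.2.val))) := by
    intro I
    rw [← encFun_eq]
    simp only [ValidUtilityData.enc, encList_encIdx_eq, hpair]
    simp only [encRules_eq (fun b : ℕ × ℕ => encNat b.1 ++ encNat b.2)
      (fun a : Fin I.n × Fin I.m => (a.1.val, a.2.val))]
  rw [e, e, encProfile_eq, encProfile_eq] at h
  simp only [List.append_assoc] at h
  have hc := IsCode.encNat.prod IsCode.encNat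
  obtain ⟨h0, h⟩ := IsCode.encNat.inj _ _ _ _ h
  obtain ⟨h1, h⟩ := (IsCode.encNat.encList.encList.prod
    hc.encRawRule.encList).encList.inj _ _ _ _ h
  obtain ⟨h2, h⟩ := hc.encRawRule.encList.inj _ _ _ _ h
  obtain ⟨h3, -⟩ := IsCode.encNat.encList.encList.inj _ _ [] [] (by simpa using h)
  obtain ⟨n, m, strat, util, social⟩ := I
  obtain ⟨n', m', strat', util', social'⟩ := I'
  obtain rfl : n = n' := length_eq_of_ofFn_eq h1
  -- No list of length `m` occurs in this code, so `m` is read from the numeral written in front.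
  obtain rfl : m = m' := h0
  have h1' := List.ofFn_injective h1
  obtain rfl : strat = strat' :=
    funext fun x => map_rawIdx_injective (Prod.ext_iff.1 (congrFun h1' x)).1
  obtain rfl : util = util' := funext fun x =>
    map_rawRule_injective (hval _ _) (Prod.ext_iff.1 (congrFun h1' x)).2
  obtain rfl : social = social' := map_rawRule_injective (hval _ _) h2
  obtain rfl : p = p' := eq_of_ofFn_comp_eq rawIdx_injective h3
  rfl

/-- The decision problem asks for some instance with the given code; injectivity leaves only the
intended one. -/
theorem mem_uniformInASink (I : UniformMarket) (p : Fin I.n → List (Fin I.m)) :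
    I.enc ++ encProfile p ∈ uniformInASink ↔ I.game.InASinkAt (profile p) := by
  refine ⟨?_, fun h => ⟨I, p, rfl, h⟩⟩
  rintro ⟨I', p', h, h'⟩
  cases UniformMarket.enc_inj h
  exact h'

theorem mem_uniformIdealInASink (I : UniformMarket) (p : Fin I.n → List (Fin I.m)) :
    I.enc ++ encProfile p ∈ uniformIdealInASink ↔ I.idealGame.InASinkAt (profile p) := by
  refine ⟨?_, fun h => ⟨I, p, rfl, h⟩⟩
  rintro ⟨I', p', h, h'⟩
  cases UniformMarket.enc_inj h
  exact h'

theorem mem_manyToOneInASink (I : ManyToOneMarket) (p : Fin I.n → List (Fin I.m)) :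
    I.enc ++ encProfile p ∈ manyToOneInASink ↔ I.game.InASinkAt (profile p) := by
  refine ⟨?_, fun h => ⟨I, p, rfl, h⟩⟩
  rintro ⟨I', p', h, h'⟩
  cases ManyToOneMarket.enc_inj h
  exact h'

theorem mem_validUtilityInASink (I : ValidUtilityData) (p : Fin I.n → List (Fin I.m)) :
    I.enc ++ encProfile p ∈ validUtilityInASink ↔
      IsValidUtility I.game I.γ ∧ I.game.InASinkAt (profile p) := by
  refine ⟨?_, fun h => ⟨I, p, rfl, h⟩⟩
  rintro ⟨I', p', h, h'⟩
  cases ValidUtilityData.enc_inj h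
  exact h'

theorem mem_congestionInASink (I : CongestionData) (p : Fin I.n → List (Fin I.m)) :
    I.enc ++ encProfile p ∈ congestionInASink ↔ I.game.InASinkAt (profile p) := by
  refine ⟨?_, fun h => ⟨I, p, rfl, h⟩⟩
  rintro ⟨I', p', h, h'⟩
  cases CongestionData.enc_inj h
  exact h'

end SinkEq

namespace SinkEq

open Function

/-! ## Sink equilibria of deterministic dynamics -/

namespace StrategicGame

variable {n : ℕ} {G : StrategicGame n} {S S' T : G.State}

/-- A component without outgoing arcs contains all that is reachable from it; conversely, if every
walk from `S` can be undone, the component of `S` is closed. -/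
theorem inASink_iff : G.InASink S ↔ ∀ T, G.Reach S T → G.Reach T S := by
  constructor
  · rintro ⟨C, ⟨⟨S₀, rfl⟩, hout⟩, hS⟩ T hT
    have : T ∈ {S' | G.Reach S₀ S' ∧ G.Reach S' S₀} := by
      induction hT with
      | refl => exact hS
      | tail _ h ih => exact hout _ ih _ h
    exact this.2.trans hS.1
  · intro h
    exact ⟨{S' | G.Reach S S' ∧ G.Reach S' S}, ⟨⟨S, rfl⟩, fun T hT T' hs =>
      ⟨hT.1.tail hs, h T' (hT.1.tail hs)⟩⟩, .refl, .refl⟩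

/-- `S'` is the only state to which an arc leads from `S`. -/
def UniqueStep (G : StrategicGame n) (S S' : G.State) : Prop := ∀ T, G.Step S T ↔ T = S'

theorem UniqueStep.step (h : G.UniqueStep S S') : G.Step S S' := (h S').2 rfl

theorem reach_of_uniqueStep (h : Relation.ReflTransGen G.UniqueStep S S') : G.Reach S S' :=
  Relation.ReflTransGen.mono (fun _ _ => UniqueStep.step) _ _ h

/-- The walk cannot leave the cycle: the induction carries a forced walk from the state reached so
far back to `S`, and the next arc must be the first one of that walk (or of the cycle, if the state
is `S`). -/
theorem inASink_of_cycle (h : Relation.TransGen G.UniqueStep S S) : G.InASink S := by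
  rw [inASink_iff]
  obtain ⟨S₁, h₁, h₂⟩ := Relation.TransGen.head'_iff.1 h
  intro T hT
  apply reach_of_uniqueStep
  induction hT with
  | refl => exact .refl
  | tail _ hs ih =>
    rcases Relation.ReflTransGen.cases_head ih with rfl | ⟨T', h₃, h₄⟩
    · rwa [(h₁ _).1 hs]
    · rwa [(h₃ _).1 hs]

/-- There is no return from the dead end `S'`. The arc from `S` is needed to know that `S` differs
from `S'`, since a dead end is a sink by itself. -/
theorem not_inASink_of_reach (h : G.Reach S S') (h' : ∀ T, ¬ G.Step S' T) (hS : G.Step S T) :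
    ¬ G.InASink S := by
  rw [inASink_iff]
  intro hs
  rcases Relation.ReflTransGen.cases_head (hs S' h) with rfl | ⟨T', h₃, _⟩
  · exact h' _ hS
  · exact h' _ h₃

end StrategicGame

theorem SetGame.coe_update {n m : ℕ} {G : SetGame n m} (S : G.toGame.State) (i : Fin n)
    (s : G.toGame.Strat i) :
    (fun k => (update S i s k).1) = update (fun k => (S k).1) i s.1 := by
  funext k
  by_cases hk : k = i
  · subst hk
    simp
  · simp [hk]

/-! ## A game that simulates a machine with finitely many cells -/

/-- A machine with `P` cells: in the control state `c`, at the cell `h` with content `g`, it writes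
`wr c h g` and enters the control state and the position `nx c h g`. -/
structure CellMachine (C Γ : Type) where
  P : ℕ
  P_pos : 0 < P
  wr : C → ℕ → Γ → Γ
  nx : C → ℕ → Γ → C × ℕ
  nx_lt : ∀ c h g, (nx c h g).2 < P
  /-- the control state at the beginning -/
  start : C
  /-- the contents of the cells at the beginning -/
  tape : ℕ → Γ

/-- The resources at one position. -/
inductive Loc (C Γ : Type)
  /-- forces the second controller to copy the first one -/
  | copy (a : C × Γ)
  /-- tells the first controller whether it may go to a label -/
  | go (a : C × Γ)
  /-- complements `go` -/
  | pad (a : C × Γ)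
  /-- tells the first controller the content of the cell -/
  | see (a : C × Γ)
  /-- tells the cell what to write -/
  | put (g : Γ)

namespace Loc

variable {C Γ : Type}

def equivSum : Loc C Γ ≃ (C × Γ) ⊕ (C × Γ) ⊕ (C × Γ) ⊕ (C × Γ) ⊕ Γ where
  toFun
    | copy a => .inl a
    | go a => .inr (.inl a)
    | pad a => .inr (.inr (.inl a))
    | see a => .inr (.inr (.inr (.inl a)))
    | put g => .inr (.inr (.inr (.inr g)))
  invFun
    | .inl a => copy a
    | .inr (.inl a) => go a
    | .inr (.inr (.inl a)) => pad a
    | .inr (.inr (.inr (.inl a))) => see a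
    | .inr (.inr (.inr (.inr g))) => put g
  left_inv l := by cases l <;> rfl
  right_inv l := by rcases l with _ | _ | _ | _ | _ <;> rfl

instance [Fintype C] [Fintype Γ] : Fintype (Loc C Γ) := Fintype.ofEquiv _ equivSum.symm

theorem sum_eq [Fintype C] [Fintype Γ] (F : Loc C Γ → ℕ) :
    ∑ l, F l = ∑ a, F (copy a) + ∑ a, F (go a) + ∑ a, F (pad a) + ∑ a, F (see a) +
      ∑ g, F (put g) := by
  rw [← Equiv.sum_comp equivSum.symm F]
  simp only [Fintype.sum_sum_type, add_assoc]
  rfl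

end Loc

namespace CellMachine

variable {C Γ : Type}

variable (M : CellMachine C Γ)

abbrev Label : Type := Fin M.P × C × Γ

variable {M} in
def Label.nat (s : M.Label) : ℕ × C × Γ := (s.1.val, s.2)

theorem Label.nat_injective : Injective (Label.nat : M.Label → _) := by
  rintro ⟨h, a⟩ ⟨h', a'⟩ e
  simpa [Label.nat, Fin.ext_iff] using e

variable {M} in
@[simp]
theorem Label.mk_eq_nat {h : Fin M.P} {a : C × Γ} {s : M.Label} : (h.val, a) = s.nat ↔ (h, a) = s :=
  ⟨fun e => Label.nat_injective M e, fun e => by rw [← e]; rfl⟩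

/-- The labels of the controllers and the contents of the cells. -/
@[ext]
structure Position where
  fst : M.Label
  snd : M.Label
  cell : Fin M.P → Γ

variable {M}

/-- The player that stands for a cell. -/
def agent (k : Fin M.P) : Fin (M.P + 2) := k.succ.succ

@[simp] theorem agent_ne_zero (k : Fin M.P) : agent k ≠ 0 := Fin.succ_ne_zero _

@[simp] theorem zero_ne_agent (k : Fin M.P) : 0 ≠ agent k := (agent_ne_zero k).symm

@[simp] theorem agent_ne_one (k : Fin M.P) : agent k ≠ 1 := by simp [agent, Fin.ext_iff]

@[simp] theorem one_ne_agent (k : Fin M.P) : 1 ≠ agent k := (agent_ne_one k).symm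

@[simp] theorem agent_inj {k k' : Fin M.P} : agent k = agent k' ↔ k = k' := by
  simp [agent]

@[elab_as_elim]
theorem player_cases {p : Fin (M.P + 2) → Prop} (h₀ : p 0) (h₁ : p 1) (h : ∀ k, p (agent k))
    (i : Fin (M.P + 2)) : p i :=
  Fin.cases h₀ (Fin.cases h₁ h) i

/-- The player with priority on a resource. -/
def high (h : Fin M.P) : Loc C Γ → Fin (M.P + 2)
  | .copy _ => 0
  | .go _ => 1
  | .pad _ => 1
  | .see _ => agent h
  | .put _ => 1

/-- The other player that may use a resource. -/
def low (h : Fin M.P) : Loc C Γ → Fin (M.P + 2)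
  | .copy _ => 1
  | .go _ => 0
  | .pad _ => 0
  | .see _ => 0
  | .put _ => agent h

theorem high_ne_low (h : Fin M.P) (l : Loc C Γ) : high h l ≠ low h l := by
  cases l <;> simp [high, low]

/-- The number of resources that a player uses with low priority. -/
def lowCount (i : Fin (M.P + 2)) : ℕ := if i = 0 then 2 else 1

theorem sum_resources [Fintype C] [Fintype Γ] (F : Fin M.P → Loc C Γ → ℕ) :
    ∑ x : Fin M.P × Loc C Γ, F x.1 x.2 =
      ∑ s : M.Label, F s.1 (.copy s.2) + ∑ s : M.Label, F s.1 (.go s.2) +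
      ∑ s : M.Label, F s.1 (.pad s.2) + ∑ s : M.Label, F s.1 (.see s.2) +
      ∑ x : Fin M.P × Γ, F x.1 (.put x.2) := by
  simp only [Fintype.sum_prod_type (γ := ℕ), Loc.sum_eq, Finset.sum_add_distrib]

section

variable [Fintype C] [Fintype Γ]

/-- The numbering of the resources. -/
noncomputable def resource : Fin M.P × Loc C Γ ≃ Fin (M.P * Fintype.card (Loc C Γ)) :=
  ((Equiv.refl _).prodCongr (Fintype.equivFin _)).trans finProdFinEquiv

noncomputable def owner (y : Fin (M.P * Fintype.card (Loc C Γ))) : Fin (M.P + 2) :=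
  high (resource.symm y).1 (resource.symm y).2

noncomputable def guest (y : Fin (M.P * Fintype.card (Loc C Γ))) : Fin (M.P + 2) :=
  low (resource.symm y).1 (resource.symm y).2

theorem owner_ne_guest (y : Fin (M.P * Fintype.card (Loc C Γ))) : owner y ≠ guest y :=
  high_ne_low _ _

end

/-! ### The strategies of controllers and cells, and what they win -/

variable [DecidableEq C] [DecidableEq Γ]

/-- The first controller may go to the label `s` when the second one plays `t`. -/
def ready (M : CellMachine C Γ) (s t : ℕ × C × Γ) : Bool :=
  if s = t then decide (M.wr s.2.1 s.1 s.2.2 ≠ s.2.2)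
  else decide (M.nx t.2.1 t.1 t.2.2 = (s.2.1, s.1))

/-- The resources that the first controller uses at the label `s`. -/
def plays₁ (s : ℕ × C × Γ) (h : ℕ) : Loc C Γ → Bool
  | .copy a => decide ((h, a) ≠ s)
  | .go a => decide ((h, a) = s)
  | .pad _ => false
  | .see a => decide ((h, a) = s)
  | .put _ => false

/-- The resources that the second controller uses at the label `t`. -/
def plays₂ (M : CellMachine C Γ) (t : ℕ × C × Γ) (h : ℕ) : Loc C Γ → Bool
  | .copy a => decide ((h, a) = t)
  | .go a => !M.ready (h, a) t
  | .pad a => M.ready (h, a) t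
  | .see _ => false
  | .put g => !(decide (h = t.1) && decide (M.wr t.2.1 t.1 t.2.2 = g))

/-- The resources that the cell `k` uses when its content is `g`. -/
def playsCell (k : ℕ) (g : Γ) (h : ℕ) : Loc C Γ → Bool
  | .copy _ => false
  | .go _ => false
  | .pad _ => false
  | .see a => decide (h = k) && decide (a.2 ≠ g)
  | .put g' => decide (h = k) && decide (g' = g)

namespace Position

def plays (z : M.Position) (i : Fin (M.P + 2)) : Fin M.P → Loc C Γ → Bool :=
  Fin.cases (fun h => plays₁ z.fst.nat h)
    (Fin.cases (fun h => M.plays₂ z.snd.nat h) fun k h => playsCell k (z.cell k) h) i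

@[simp] theorem plays_zero (z : M.Position) (h : Fin M.P) (l : Loc C Γ) :
    z.plays 0 h l = plays₁ z.fst.nat h l := rfl

@[simp] theorem plays_one (z : M.Position) (h : Fin M.P) (l : Loc C Γ) :
    z.plays 1 h l = M.plays₂ z.snd.nat h l := rfl

@[simp] theorem plays_agent (z : M.Position) (k h : Fin M.P) (l : Loc C Γ) :
    z.plays (agent k) h l = playsCell k (z.cell k) h l := rfl

/-- The player `i` changes its strategy to the one of `z'`. -/
def change (z z' : M.Position) (i : Fin (M.P + 2)) : M.Position where
  fst := if i = 0 then z'.fst else z.fst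
  snd := if i = 1 then z'.snd else z.snd
  cell k := if i = agent k then z'.cell k else z.cell k

theorem plays_change_self (z z' : M.Position) (i : Fin (M.P + 2)) :
    (z.change z' i).plays i = z'.plays i := by
  funext h l
  refine player_cases ?_ ?_ (fun k => ?_) i <;> simp [change]

theorem plays_change_of_ne (z z' : M.Position) {i j : Fin (M.P + 2)} (hij : j ≠ i) :
    (z.change z' i).plays j = z.plays j := by
  funext h l
  revert hij
  refine player_cases ?_ ?_ (fun k => ?_) j <;> intro h <;> simp [change, h.symm]

/-- The number of resources with low priority that the player `i` wins. -/
def gain (z : M.Position) (i : Fin (M.P + 2)) : ℕ :=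
  Fin.cases ((M.ready z.fst.nat z.snd.nat).toNat +
      (decide (z.cell z.fst.1 = z.fst.2.2)).toNat)
    (Fin.cases (decide (z.fst = z.snd)).toNat fun k =>
      (decide (k = z.snd.1) && decide (M.wr z.snd.2.1 z.snd.1 z.snd.2.2 = z.cell k)).toNat) i

@[simp] theorem gain_zero (z : M.Position) : z.gain 0 = (M.ready z.fst.nat z.snd.nat).toNat +
    (decide (z.cell z.fst.1 = z.fst.2.2)).toNat := rfl

@[simp] theorem gain_one (z : M.Position) : z.gain 1 = (decide (z.fst = z.snd)).toNat := rfl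

@[simp] theorem gain_agent (z : M.Position) (k : Fin M.P) : z.gain (agent k) =
    (decide (k = z.snd.1) && decide (M.wr z.snd.2.1 z.snd.1 z.snd.2.2 = z.cell k)).toNat := rfl

theorem gain_le (z : M.Position) (i : Fin (M.P + 2)) : z.gain i ≤ lowCount i := by
  refine player_cases ?_ ?_ (fun k => ?_) i
  · have h1 := Bool.toNat_le (M.ready z.fst.nat z.snd.nat)
    have h2 := Bool.toNat_le (decide (z.cell z.fst.1 = z.fst.2.2))
    simp only [gain_zero, lowCount, if_true]
    omega
  · exact Bool.toNat_le _
  · exact Bool.toNat_le _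

end Position

theorem eq_high_or_low (z : M.Position) {i : Fin (M.P + 2)} {h : Fin M.P} {l : Loc C Γ}
    (hp : z.plays i h l = true) : i = high h l ∨ i = low h l := by
  revert hp
  refine player_cases ?_ ?_ (fun k => ?_) i
  · cases l <;> simp [plays₁, high, low]
  · cases l <;> simp [plays₂, high, low]
  · cases l <;> simp [playsCell, high, low, ← Fin.ext_iff] <;> tauto

variable [Fintype C] [Fintype Γ]

theorem sum_ne {X : Type} [Fintype X] [DecidableEq X] (a : X) :
    (∑ x : X, if ¬ x = a then 1 else 0) = Fintype.card X - 1 := by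
  have h : (∑ x : X, if ¬ x = a then 1 else 0) + ∑ x : X, (if x = a then 1 else 0) =
      Fintype.card X := by
    rw [← Finset.sum_add_distrib, Fintype.card_eq_sum_ones]
    exact Finset.sum_congr rfl fun x _ => by split_ifs <;> rfl
  simp only [Finset.sum_ite_eq', Finset.mem_univ, if_true] at h
  omega

/-- The number of resources that a player uses with high priority. -/
def highCount (i : Fin (M.P + 2)) : ℕ :=
  Fin.cases (Fintype.card M.Label - 1)
    (Fin.cases (Fintype.card M.Label + (Fintype.card (Fin M.P × Γ) - 1))
      fun _ => ∑ _c : C, (Fintype.card Γ - 1)) i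

theorem sum_and {X : Type} [Fintype X] [DecidableEq X] (a : X) (Q : X → Prop) [DecidablePred Q] :
    (∑ x : X, if x = a ∧ Q x then 1 else 0) = if Q a then 1 else 0 := by
  simp only [ite_and, Finset.sum_ite_eq', Finset.mem_univ, if_true]

/-- The strategies are padded so that this count is constant: the first controller omits one `copy`
resource; the second plays exactly one of `go` and `pad` for each label and omits one `put`
resource; a cell omits its own symbol in `see` for each control state. -/
theorem sum_high (z : M.Position) (i : Fin (M.P + 2)) :
    (∑ x : Fin M.P × Loc C Γ, if z.plays i x.1 x.2 = true ∧ high x.1 x.2 = i then 1 else 0) =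
      highCount i := by
  rw [sum_resources (fun h l => if z.plays i h l = true ∧ high h l = i then 1 else 0)]
  refine player_cases ?_ ?_ (fun k => ?_) i
  · simp only [Position.plays_zero, plays₁, high, Label.mk_eq_nat, decide_eq_true_eq, ne_eq]
    simp only [and_true, and_false, if_false, Finset.sum_const_zero, add_zero, agent_ne_zero,
      Bool.false_eq_true, one_ne_zero]
    exact sum_ne z.fst
  · simp [plays₂, high, -Finset.sum_boole]
    have h1 : ((∑ x : M.Label, if M.ready (↑x.1, x.2) z.snd.nat = false then 1 else 0) +
        ∑ x : M.Label, if M.ready (↑x.1, x.2) z.snd.nat = true then 1 else 0) =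
        Fintype.card M.Label := by
      rw [← Finset.sum_add_distrib, Fintype.card_eq_sum_ones]
      refine Finset.sum_congr rfl fun x _ => ?_
      cases M.ready (↑x.1, x.2) z.snd.nat <;> rfl
    have h2 : (∑ x : Fin M.P × Γ, if ¬↑x.1 = z.snd.nat.1 ∨
        ¬M.wr z.snd.nat.2.1 z.snd.nat.1 z.snd.nat.2.2 = x.2 then 1 else 0) =
        Fintype.card (Fin M.P × Γ) - 1 := by
      rw [← sum_ne (z.snd.1, M.wr z.snd.nat.2.1 z.snd.nat.1 z.snd.nat.2.2)]
      refine Finset.sum_congr rfl fun x _ => if_congr ?_ rfl rfl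
      rw [← not_and_or, Prod.ext_iff, Fin.ext_iff, eq_comm (b := x.2)]
      rfl
    rw [h1, h2]
    rfl
  · simp [playsCell, high, -Finset.sum_boole]
    change _ = ∑ _c : C, _
    have h1 : (∑ x : M.Label, if ((x.1 : ℕ) = k ∧ ¬x.2.2 = z.cell k) ∧ x.1 = k then 1 else 0) =
        ∑ x : M.Label, if x.1 = k then (if ¬ x.2.2 = z.cell k then 1 else 0) else 0 := by
      refine Finset.sum_congr rfl fun x _ => ?_
      rw [← ite_and]
      exact if_congr (by rw [Fin.ext_iff]; tauto) rfl rfl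
    rw [h1, Fintype.sum_prod_type, Fintype.sum_eq_single k fun x hx => by simp [hx]]
    simp only [if_true]
    rw [Fintype.sum_prod_type]
    exact Finset.sum_congr rfl fun c _ => sum_ne (z.cell k)

theorem sum_low (z : M.Position) (i : Fin (M.P + 2)) :
    (∑ x : Fin M.P × Loc C Γ, if z.plays i x.1 x.2 = true ∧ low x.1 x.2 = i then 1 else 0) =
      lowCount i := by
  rw [sum_resources (fun h l => if z.plays i h l = true ∧ low h l = i then 1 else 0)]
  refine player_cases ?_ ?_ (fun k => ?_) i
  · simp [plays₁, low, lowCount, -Finset.sum_boole]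
  · simp [plays₂, low, lowCount, -Finset.sum_boole]
  · simp [playsCell, low, lowCount, -Finset.sum_boole]
    refine (Finset.sum_congr rfl fun x _ => if_congr ?_ rfl rfl).trans
      ((sum_and (X := Fin M.P × Γ) (k, z.cell k) (fun _ => True)).trans (if_pos trivial))
    rw [Prod.ext_iff, Fin.ext_iff]
    tauto

/-- A guest wins when the owner abstains. For `go` this means that the label is `ready`, for `see`
that its symbol is the content of the cell, for `copy` that the controllers agree, and for `put`
that the cell lies under the head and holds the symbol to be written. -/
theorem sum_gain (z : M.Position) (i : Fin (M.P + 2)) :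
    (∑ x : Fin M.P × Loc C Γ, if z.plays i x.1 x.2 = true ∧ low x.1 x.2 = i ∧
      z.plays (high x.1 x.2) x.1 x.2 = false then 1 else 0) = z.gain i := by
  rw [sum_resources (fun h l => if z.plays i h l = true ∧ low h l = i ∧
      z.plays (high h l) h l = false then 1 else 0)]
  refine player_cases ?_ ?_ (fun k => ?_) i
  · simp [plays₁, plays₂, playsCell, high, low, -Finset.sum_boole]
    rw [sum_and z.fst (fun x => M.ready (↑x.1, x.2) z.snd.nat = true),
      sum_and z.fst (fun x => x.2.2 = z.cell x.1)]
    congr 1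
    · change _ = (M.ready (↑z.fst.1, z.fst.2) z.snd.nat).toNat
      cases M.ready (↑z.fst.1, z.fst.2) z.snd.nat <;> rfl
    · by_cases h : z.fst.2.2 = z.cell z.fst.1 <;> simp [h, eq_comm]
  · simp [plays₁, plays₂, playsCell, high, low, -Finset.sum_boole]
    rw [sum_and z.snd (fun x => x = z.fst)]
    by_cases h : z.snd = z.fst
    · simp [h]
    · simp [h, Ne.symm h]
  · simp [plays₁, plays₂, playsCell, high, low, -Finset.sum_boole]
    have e : ∀ x : Fin M.P × Γ, ((↑x.1 = (k : ℕ) ∧ x.2 = z.cell k) ∧ x.1 = k ∧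
        ↑x.1 = z.snd.nat.1 ∧ M.wr z.snd.nat.2.1 z.snd.nat.1 z.snd.nat.2.2 = x.2) ↔
        x = (k, z.cell k) ∧ k = z.snd.1 ∧ M.wr z.snd.2.1 z.snd.1 z.snd.2.2 = z.cell k := by
      rintro ⟨h, g⟩
      constructor
      · rintro ⟨⟨_, h1⟩, h2, h3, h4⟩
        obtain rfl : h = k := h2
        obtain rfl : g = z.cell h := h1
        exact ⟨rfl, Fin.ext h3, h4⟩
      · rintro ⟨h1, h2, h3⟩
        obtain ⟨rfl, rfl⟩ := Prod.mk.injEq _ _ _ _ ▸ h1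
        exact ⟨⟨rfl, rfl⟩, rfl, congrArg Fin.val h2, h3⟩
    simp only [e]
    rw [sum_and (k, z.cell k) (fun _ => k = z.snd.1 ∧ M.wr z.snd.2.1 z.snd.1 z.snd.2.2 = z.cell k)]
    by_cases h : k = z.snd.1
    · subst h
      by_cases h' : M.wr z.snd.2.1 z.snd.1 z.snd.2.2 = z.cell z.snd.1 <;> simp [h']
    · simp [h]

/-! ### The game -/

/-- The strategy of the player `i` in the position `z`. -/
noncomputable def Position.full (z : M.Position) (i : Fin (M.P + 2)) :
    Finset (Fin (M.P * Fintype.card (Loc C Γ))) :=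
  {y | z.plays i (resource.symm y).1 (resource.symm y).2 = true}

theorem Position.mem_full {z : M.Position} {i : Fin (M.P + 2)}
    {y : Fin (M.P * Fintype.card (Loc C Γ))} :
    y ∈ z.full i ↔ z.plays i (resource.symm y).1 (resource.symm y).2 = true := by
  simp [full]

/-- The resources that the player `i` wins. -/
noncomputable def wins {n m : ℕ} (owner : Fin m → Fin n) (S : Fin n → Finset (Fin m)) (i : Fin n) :
    Finset (Fin m) :=
  {y ∈ S i | y ∈ S (owner y) → owner y = i}

namespace Position

theorem eq_owner_or_guest {z : M.Position} {i : Fin (M.P + 2)}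
    {y : Fin (M.P * Fintype.card (Loc C Γ))} (hy : y ∈ z.full i) : i = owner y ∨ i = guest y :=
  eq_high_or_low z (mem_full.1 hy)

theorem full_change (z z' : M.Position) (i : Fin (M.P + 2)) :
    (z.change z' i).full = update z.full i (z'.full i) := by
  funext j
  by_cases hj : j = i
  · subst hj
    simp only [full, plays_change_self, update_self]
  · simp only [full, plays_change_of_ne z z' hj, update_of_ne hj]

theorem card_full (z : M.Position) (i : Fin (M.P + 2)) :
    (z.full i).card = highCount i + lowCount i := by
  rw [← sum_high z i, ← sum_low z i, ← Finset.sum_add_distrib, Finset.card_eq_sum_ones, full,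
    Finset.sum_filter, ← Equiv.sum_comp resource]
  refine Finset.sum_congr rfl fun x _ => ?_
  rw [Equiv.symm_apply_apply]
  by_cases hp : z.plays i x.1 x.2 = true
  · have h := high_ne_low x.1 x.2
    rcases eq_high_or_low z hp with rfl | rfl
    · simp [hp, h.symm]
    · simp [hp, h]
  · simp [hp]

/-- An owner always wins what it plays, and the number of owned resources in a strategy is constant;
only the guest's share varies. -/
theorem card_wins (z : M.Position) (i : Fin (M.P + 2)) :
    (wins owner z.full i).card = highCount i + z.gain i := by
  rw [← sum_high z i, ← sum_gain z i, ← Finset.sum_add_distrib, Finset.card_eq_sum_ones, wins,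
    full, Finset.sum_filter, Finset.sum_filter, ← Equiv.sum_comp resource]
  refine Finset.sum_congr rfl fun x _ => ?_
  simp only [mem_full, owner, Equiv.symm_apply_apply]
  by_cases hp : z.plays i x.1 x.2 = true
  · have h := high_ne_low x.1 x.2
    rcases eq_high_or_low z hp with rfl | rfl
    · simp [hp, h.symm]
    · by_cases hq : z.plays (high x.1 x.2) x.1 x.2 = true
      · simp [hp, hq, h]
      · simp [hp, hq, h]
  · simp [hp]

end Position

/-- The strategies of `G` are those of the positions of `M`, and possibly subsets of them, and the
utility is the number of won resources up to a constant. -/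
structure Simulates (M : CellMachine C Γ)
    (G : SetGame (M.P + 2) (M.P * Fintype.card (Loc C Γ))) : Prop where
  full_mem : ∀ (z : M.Position) i, z.full i ∈ G.F i
  subset_full : ∀ i, ∀ T ∈ G.F i, ∃ z : M.Position, T ⊆ z.full i
  utility : ∀ i, ∃ c : ℝ, ∀ S, G.Feasible S → G.u i S = (wins owner S i).card + c

namespace Simulates

variable {G : SetGame (M.P + 2) (M.P * Fintype.card (Loc C Γ))} (hG : M.Simulates G)

include hG

theorem feasible (z : M.Position) : G.Feasible z.full := hG.full_mem z

theorem lt_iff (i : Fin (M.P + 2)) {S S' : Fin (M.P + 2) → Finset _} (hS : G.Feasible S)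
    (hS' : G.Feasible S') :
    G.u i S < G.u i S' ↔ (wins owner S i).card < (wins owner S' i).card := by
  obtain ⟨c, hc⟩ := hG.utility i
  rw [hc S hS, hc S' hS']
  simp

theorem gain_lt_iff (i : Fin (M.P + 2)) (z z' : M.Position) :
    G.u i z.full < G.u i z'.full ↔ z.gain i < z'.gain i := by
  rw [hG.lt_iff i (hG.feasible z) (hG.feasible z'), z.card_wins, z'.card_wins]
  simp

/-- If player `i` is at most one below its maximum, an improvement must win at least `highCount i +
lowCount i` resources. That is the size of a full strategy, so a subset of a full strategy that
achieves it is the whole set. Thus smaller strategies never matter here. -/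
theorem step_iff {z : M.Position} (hz : ∀ i, lowCount i ≤ z.gain i + 1) (T : G.toGame.State) :
    G.toGame.Step (G.state z.full (hG.feasible z)) T ↔
      ∃ i z', T = G.state (z.change z' i).full (hG.feasible _) ∧
        z.gain i < (z.change z' i).gain i := by
  constructor
  · rintro ⟨i, ⟨s, rfl⟩, hlt⟩
    obtain ⟨z', hs⟩ := hG.subset_full i s.1 s.2
    have hT : (fun k => (update (G.state z.full (hG.feasible z)) i s k).1) =
        update z.full i s.1 := SetGame.coe_update _ i s
    have hf : G.Feasible (update z.full i s.1) := by
      rw [← hT]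
      exact fun k => Subtype.prop _
    have hlt' : G.u i z.full < G.u i (update z.full i s.1) := by
      rw [← hT]
      exact hlt
    have hcard := (hG.lt_iff i (hG.feasible z) hf).1 hlt'
    have hle : (wins owner (update z.full i s.1) i).card ≤ s.1.card := by
      refine Finset.card_le_card ((Finset.filter_subset _ _).trans ?_)
      rw [update_self]
    have hs' : s.1 = z'.full i := by
      refine Finset.eq_of_subset_of_card_le hs ?_
      have := hz i
      rw [z.card_wins] at hcard
      rw [z'.card_full]
      omega
    have he : update z.full i s.1 = (z.change z' i).full := by
      rw [hs', z.full_change]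
    refine ⟨i, z', funext fun k => Subtype.ext ((congrFun hT k).trans (congrFun he k)), ?_⟩
    rw [he] at hlt'
    exact (hG.gain_lt_iff i z _).1 hlt'
  · rintro ⟨i, z', rfl, hlt⟩
    refine ⟨i, ⟨⟨z'.full i, hG.full_mem z' i⟩, funext fun k => Subtype.ext ?_⟩,
      (hG.gain_lt_iff i z _).2 hlt⟩
    refine Eq.trans ?_ (congrFun (SetGame.coe_update _ i _) k).symm
    exact congrFun (z.full_change z' i) k

/-- It suffices to compare full strategies in `h`, because `step_iff` rules out all others. -/
theorem uniqueStep {z z₂ : M.Position} (hz : ∀ i, lowCount i ≤ z.gain i + 1)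
    (h : ∀ i z', z.gain i < (z.change z' i).gain i → z.change z' i = z₂) (i : Fin (M.P + 2))
    (h₁ : z.change z₂ i = z₂) (h₂ : z.gain i < z₂.gain i) :
    G.toGame.UniqueStep (G.state z.full (hG.feasible z)) (G.state z₂.full (hG.feasible z₂)) := by
  intro T
  rw [hG.step_iff hz]
  constructor
  · rintro ⟨i, z', rfl, hlt⟩
    congr 2
    exact h i z' hlt
  · rintro rfl
    refine ⟨i, z₂, ?_, ?_⟩
    · congr 2
      exact h₁.symm
    · rwa [h₁]

end Simulates

end CellMachine

end SinkEq

namespace SinkEq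

open Function

/-! ## Runs of the machine -/

namespace CellMachine

variable {C Γ : Type}

@[ext]
structure Config (M : CellMachine C Γ) where
  ctl : C
  pos : Fin M.P
  cell : Fin M.P → Γ

variable {M : CellMachine C Γ}

namespace Config

def step (c : M.Config) : M.Config where
  ctl := (M.nx c.ctl c.pos (c.cell c.pos)).1
  pos := ⟨(M.nx c.ctl c.pos (c.cell c.pos)).2, M.nx_lt _ _ _⟩
  cell := update c.cell c.pos (M.wr c.ctl c.pos (c.cell c.pos))

variable (M) in
def initial : M.Config where
  ctl := M.start
  pos := ⟨0, M.P_pos⟩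
  cell k := M.tape k

def label (c : M.Config) : M.Label := (c.pos, c.ctl, c.cell c.pos)

/-- The position in which both controllers know the configuration. -/
def position (c : M.Config) : M.Position := ⟨c.label, c.label, c.cell⟩

/-- A repeated label means the same position and control state and the same symbol under the head.
Then the step wrote the symbol that it had read, and nothing has changed. -/
theorem label_ne {c : M.Config} (h : c.step ≠ c) : c.step.label ≠ c.label := by
  intro e
  obtain ⟨h₁, h₂, h₃⟩ : c.step.pos = c.pos ∧ c.step.ctl = c.ctl ∧
      c.step.cell c.step.pos = c.cell c.pos := by simpa [label, Prod.ext_iff] using e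
  refine h (Config.ext h₂ h₁ ?_)
  rw [h₁] at h₃
  simp only [step, update_self] at h₃ ⊢
  rw [h₃, update_eq_self]

theorem step_cell (c : M.Config) (k : Fin M.P) : c.step.cell k =
    if k.val = c.pos.val then M.wr c.ctl c.pos (c.cell k) else c.cell k := by
  by_cases h : k = c.pos
  · subst h
    simp [step]
  · rw [if_neg fun e => h (Fin.ext e)]
    exact update_of_ne h _ _

theorem step_cell_pos (c : M.Config) :
    c.step.cell c.pos = M.wr c.ctl c.pos (c.cell c.pos) := update_self _ _ _

end Config

theorem toNat_decide_pos {p : Prop} [Decidable p] : 0 < (decide p).toNat ↔ p := by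
  by_cases h : p <;> simp [h]

theorem one_lt_toNat_add {a b : Bool} : 1 < a.toNat + b.toNat ↔ a = true ∧ b = true := by
  cases a <;> cases b <;> decide

namespace Position

theorem change_zero (z z' : M.Position) : z.change z' 0 = ⟨z'.fst, z.snd, z.cell⟩ := by
  simp [change]

theorem change_one (z z' : M.Position) : z.change z' 1 = ⟨z.fst, z'.snd, z.cell⟩ := by
  simp [change]

theorem change_agent (z z' : M.Position) (k : Fin M.P) :
    z.change z' (agent k) = ⟨z.fst, z.snd, update z.cell k (z'.cell k)⟩ := by
  ext j <;> simp only [change, agent_ne_zero, agent_ne_one, if_false, agent_inj]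
  by_cases h : j = k
  · subst h
    simp
  · simp [h, Ne.symm h]

variable [DecidableEq C] [DecidableEq Γ]

theorem lowCount_le {z : M.Position} (h : 1 ≤ z.gain 0) (i : Fin (M.P + 2)) :
    lowCount i ≤ z.gain i + 1 := by
  refine player_cases ?_ ?_ (fun k => ?_) i
  · simp only [lowCount, if_true]
    omega
  · simp [lowCount]
  · simp [lowCount]

end Position

namespace Config

variable [DecidableEq C] [DecidableEq Γ]

/-- The position after the cell has been written. -/
def written (c : M.Config) : M.Position := ⟨c.label, c.label, c.step.cell⟩

/-- At the old label exactly one of `go` and `see` is won. If the symbol was changed, `see` is lost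
but `ready` rewards the old label; if it was not changed, it is the other way round. So the first
controller is exactly one below its maximum in both cases. -/
theorem gain_written_zero (c : M.Config) : c.written.gain 0 = 1 := by
  have h := c.step_cell_pos
  simp only [written, Position.gain_zero, ready, if_true]
  by_cases hw : M.wr c.ctl c.pos (c.cell c.pos) = c.cell c.pos <;>
    simp [Label.nat, label, h, hw]

/-- Winning `go` fixes the control state and the position to which the second controller's label
leads, and winning `see` fixes the symbol found there; together they determine the label. -/
theorem one_lt_gain_zero {c : M.Config} {s : M.Label} (hs : s ≠ c.label) :
    1 < (Position.mk s c.label c.step.cell).gain 0 ↔ s = c.step.label := by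
  have hs' : ¬ s.nat = c.label.nat := fun e => hs (Label.nat_injective M e)
  simp only [Position.gain_zero, one_lt_toNat_add, ready, if_neg hs', decide_eq_true_eq]
  obtain ⟨h, a, g⟩ := s
  simp only [Label.nat, label, Prod.ext_iff, Fin.ext_iff, step]
  constructor
  · rintro ⟨⟨rfl, h₂⟩, h₃⟩
    obtain rfl : h = ⟨_, M.nx_lt c.ctl c.pos (c.cell c.pos)⟩ := Fin.ext h₂.symm
    exact ⟨rfl, rfl, h₃.symm⟩
  · rintro ⟨h₁, rfl, rfl⟩
    obtain rfl : h = ⟨_, M.nx_lt c.ctl c.pos (c.cell c.pos)⟩ := Fin.ext h₁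
    exact ⟨⟨rfl, rfl⟩, rfl⟩

/-- The first controller goes on after the cell has been written. -/
theorem written_gain_lt {c : M.Config} {z' : M.Position} {i : Fin (M.P + 2)}
    (h : c.written.gain i < (c.written.change z' i).gain i) :
    i = 0 ∧ z'.fst = c.step.label ∧ c.step.label ≠ c.label := by
  revert h
  refine player_cases (fun h => ?_) (fun h => ?_) (fun k h => ?_) i
  · rw [Position.change_zero, gain_written_zero] at h
    have hs : z'.fst ≠ c.label := by
      intro e
      rw [e] at h
      exact h.ne' c.gain_written_zero
    have hs' := (one_lt_gain_zero hs).1 h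
    exact ⟨rfl, hs', hs' ▸ hs⟩
  · have := Position.gain_le (c.written.change z' 1) 1
    simp [written, lowCount] at h this
    omega
  · exfalso
    have := Position.gain_le (c.written.change z' (agent k)) (agent k)
    rw [Position.change_agent] at h this
    by_cases hk : k = c.pos
    · subst hk
      have h₁ : c.written.gain (agent c.pos) = 1 := by
        simp [written, label, step_cell_pos]
      rw [h₁] at h
      simp [lowCount] at this h
      omega
    · simp [written, label, hk] at h

variable [Fintype C] [Fintype Γ]

variable {G : SetGame (M.P + 2) (M.P * Fintype.card (Loc C Γ))}

/-- The cell is written first. -/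
theorem uniqueStep_written (hG : M.Simulates G) {c : M.Config} (h : c.step.cell ≠ c.cell) :
    G.toGame.UniqueStep (G.state c.position.full (hG.feasible _))
      (G.state c.written.full (hG.feasible _)) := by
  have hw : M.wr c.ctl c.pos (c.cell c.pos) ≠ c.cell c.pos := by
    intro e
    refine h ?_
    simp only [step]
    rw [e, update_eq_self]
  have h₀ : c.position.gain 0 = 2 := by
    simp [position, ready, Label.nat, label, hw]
  refine hG.uniqueStep (Position.lowCount_le (by omega)) (fun i z' => ?_) (agent c.pos) ?_ ?_
  · refine player_cases (fun h => ?_) (fun h => ?_) (fun k h => ?_) i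
    · have := Position.gain_le (c.position.change z' 0) 0
      simp only [lowCount, if_true] at this
      omega
    · have := Position.gain_le (c.position.change z' 1) 1
      simp [position, lowCount] at h this
      omega
    · rw [Position.change_agent] at h ⊢
      by_cases hk : k = c.pos
      · subst hk
        simp [position, label, hw] at h
        simp [position, written, step, label, toNat_decide_pos.1 h]
      · simp [position, label, hk] at h
  · rw [Position.change_agent]
    simp [position, written, step]
  · simp [position, written, label, hw, step_cell_pos]

theorem uniqueStep_go (hG : M.Simulates G) {c : M.Config} (h : c.step ≠ c) :
    G.toGame.UniqueStep (G.state c.written.full (hG.feasible _))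
      (G.state (Position.mk c.step.label c.label c.step.cell).full (hG.feasible _)) := by
  refine hG.uniqueStep (Position.lowCount_le c.gain_written_zero.ge) (fun i z' hlt => ?_) 0 ?_ ?_
  · obtain ⟨rfl, h₁, _⟩ := written_gain_lt hlt
    rw [Position.change_zero, h₁]
    rfl
  · rw [Position.change_zero]
    rfl
  · rw [gain_written_zero, one_lt_gain_zero (label_ne h)]

/-- The first controller has both of its guest resources, the cell just written is content, and no
other cell can win a `put` resource. Only the second controller, which disagrees with the first, can
improve. -/
theorem uniqueStep_copy (hG : M.Simulates G) {c : M.Config} (h : c.step ≠ c) :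
    G.toGame.UniqueStep
      (G.state (Position.mk c.step.label c.label c.step.cell).full (hG.feasible _))
      (G.state c.step.position.full (hG.feasible _)) := by
  have hl := label_ne h
  have h₀ := (one_lt_gain_zero hl).2 rfl
  refine hG.uniqueStep (Position.lowCount_le h₀.le) (fun i z' => ?_) 1 ?_ ?_
  · refine player_cases (fun h => ?_) (fun h => ?_) (fun k h => ?_) i
    · have := Position.gain_le ((Position.mk c.step.label c.label c.step.cell).change z' 0) 0
      simp only [lowCount, if_true] at this
      omega
    · rw [Position.change_one] at h ⊢
      simp [hl] at h
      simp [position, toNat_decide_pos.1 h]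
    · rw [Position.change_agent] at h
      by_cases hk : k = c.pos
      · subst hk
        simp [label, step_cell_pos] at h
        have := Bool.toNat_le (decide (M.wr c.ctl c.pos (c.cell c.pos) = z'.cell c.pos))
        omega
      · simp [label, hk] at h
  · rw [Position.change_one]
    rfl
  · simp [position, hl]

/-- If the write changes nothing, `written` is already `position` and the first move drops out; the
other two moves always occur, so the walk is not empty. -/
theorem transGen_uniqueStep (hG : M.Simulates G) {c : M.Config} (h : c.step ≠ c) :
    Relation.TransGen G.toGame.UniqueStep (G.state c.position.full (hG.feasible _))
      (G.state c.step.position.full (hG.feasible _)) := by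
  have h₁ : Relation.ReflTransGen G.toGame.UniqueStep
      (G.state c.position.full (hG.feasible _)) (G.state c.written.full (hG.feasible _)) := by
    by_cases he : c.step.cell = c.cell
    · have : c.written = c.position := by
        rw [written, he]
        rfl
      rw [this]
    · exact .single (uniqueStep_written hG he)
  exact (Relation.TransGen.tail' h₁ (uniqueStep_go hG h)).tail (uniqueStep_copy hG h)

/-- Nothing is left to write, and the only label to which the first controller could improve is the
one that it already plays. -/
theorem not_step (hG : M.Simulates G) {c : M.Config} (h : c.step = c) (T) :
    ¬ G.toGame.Step (G.state c.position.full (hG.feasible _)) T := by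
  have : c.position = c.written := by
    rw [written, h]
    rfl
  rw [this, hG.step_iff (Position.lowCount_le c.gain_written_zero.ge)]
  rintro ⟨i, z', -, hlt⟩
  exact (written_gain_lt hlt).2.2 (by rw [h])

theorem reflTransGen_uniqueStep (hG : M.Simulates G) (c : M.Config) (k : ℕ) :
    Relation.ReflTransGen G.toGame.UniqueStep (G.state c.position.full (hG.feasible _))
      (G.state (step^[k] c).position.full (hG.feasible _)) := by
  induction k with
  | zero => exact .refl
  | succ k ih =>
    rw [iterate_succ_apply' step k c]
    by_cases h : (step^[k] c).step = step^[k] c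
    · rwa [h]
    · exact ih.trans (transGen_uniqueStep hG h).to_reflTransGen

theorem inASinkAt_of_cycle (hG : M.Simulates G) {c : M.Config} {k : ℕ}
    (hk : step^[k + 1] c = c) (h : c.step ≠ c) : G.InASinkAt c.position.full := by
  refine ⟨hG.feasible _, StrategicGame.inASink_of_cycle
    ((transGen_uniqueStep hG h).trans_left ?_)⟩
  have := reflTransGen_uniqueStep hG c.step k
  rwa [← iterate_succ_apply step k c, hk] at this

theorem not_inASinkAt_of_reach (hG : M.Simulates G) {c c' : M.Config} {k : ℕ}
    (hk : step^[k] c = c') (h : c.step ≠ c) (h' : c'.step = c') :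
    ¬ G.InASinkAt c.position.full := by
  rintro ⟨_, hs⟩
  obtain ⟨T, hT, _⟩ := Relation.TransGen.head'_iff.1 (transGen_uniqueStep hG h)
  subst hk
  exact StrategicGame.not_inASink_of_reach
    (StrategicGame.reach_of_uniqueStep (reflTransGen_uniqueStep hG c k)) (not_step hG h') hT.step hs

end Config

end CellMachine

end SinkEq

namespace SinkEq

open Function

/-! ## The market, the valid-utility game and the congestion game of a machine -/

namespace CellMachine

variable {C Γ : Type}

/-- Distinct weights for the two controllers and the cells. -/
def weight (M : CellMachine C Γ) (i : Fin (M.P + 2)) : ℕ := Fin.cases 1 (Fin.cases 2 fun _ => 3) i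

theorem weight_pos (M : CellMachine C Γ) (i : Fin (M.P + 2)) : 0 < M.weight i :=
  player_cases Nat.one_pos Nat.two_pos (fun _ => Nat.succ_pos 2) i

variable [Fintype C] [Fintype Γ]

section

variable (M : CellMachine C Γ)

abbrev size : ℕ := M.P * Fintype.card (Loc C Γ)

/-- The list of the resources `l` at the positions `h` with `f h l = true`. -/
noncomputable def listOf (f : ℕ → Loc C Γ → Bool) : List (Fin M.size) :=
  (List.finRange M.size).filter fun y => f (resource.symm y).1 (resource.symm y).2

theorem mem_listOf {f : ℕ → Loc C Γ → Bool} {y : Fin M.size} :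
    y ∈ M.listOf f ↔ f (resource.symm y).1 (resource.symm y).2 = true := by
  simp [listOf]

theorem weight_ne (y : Fin M.size) : M.weight (owner y) ≠ M.weight (guest y) := by
  unfold owner guest
  cases (resource.symm y).2 <;> simp only [high, low] <;>
    exact ne_of_beq_false rfl

end

/-- Every resource is used only by the two players that are meant to use it. -/
def Supported {M : CellMachine C Γ} (S : Fin (M.P + 2) → Finset (Fin M.size)) : Prop :=
  ∀ i, ∀ y ∈ S i, i = owner y ∨ i = guest y

theorem lookup_singleton_getD (a b : ℕ) (c : ℤ) :
    ((([(b, c)] : List (ℕ × ℤ)).lookup a).getD 0) = if a = b then c else 0 := by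
  by_cases h : a = b
  · simp [h]
  · simp [List.lookup_cons, h, beq_eq_false_iff_ne.2 h]

/-- As the two weights are positive and distinct, the load equals the guest's weight only if the
guest is alone. The delay is thus `-1` for a winning guest and `0` in all other cases, in particular
`0` for an owner. Subtracting the indicator of a win from that of ownership gives the same values.
-/
theorem lookup_load (M : CellMachine C Γ) {S : Fin (M.P + 2) → Finset (Fin M.size)} (hS : Supported S)
    (i : Fin (M.P + 2)) (y : Fin M.size) (hy : y ∈ S i) :
    ((([(M.weight (guest y), -1)] : List (ℕ × ℤ)).lookup
      (∑ k with y ∈ S k, M.weight k)).getD 0 : ℝ) =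
      (if owner y = i then 1 else 0) - (if y ∈ wins owner S i then 1 else 0) := by
  have hw := M.weight_ne y
  have h := owner_ne_guest y
  have hp := M.weight_pos (owner y)
  have hl : (∑ k with y ∈ S k, M.weight k) =
      (if y ∈ S (owner y) then M.weight (owner y) else 0) +
      (if y ∈ S (guest y) then M.weight (guest y) else 0) := by
    rw [Finset.sum_filter, ← Finset.sum_subset (Finset.subset_univ {owner y, guest y}),
      Finset.sum_pair h]
    intro k _ hk
    rw [if_neg]
    intro hyk
    rcases hS k y hyk with rfl | rfl <;> simp at hk
  rw [hl, lookup_singleton_getD]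
  simp only [wins, Finset.mem_filter, hy, true_and]
  rcases hS i y hy with rfl | rfl
  · by_cases hg : y ∈ S (guest y)
    · simp [hy, hg, hp.ne']
    · simp [hy, hg, hw]
  · by_cases hg : y ∈ S (owner y)
    · simp [hy, hg, hp.ne', h]
    · simp [hy, hg, h]

variable [DecidableEq C] [DecidableEq Γ]

noncomputable def Position.list {M : CellMachine C Γ} (z : M.Position) (i : Fin (M.P + 2)) :
    List (Fin M.size) :=
  Fin.cases (M.listOf (plays₁ z.fst.nat)) (Fin.cases (M.listOf (M.plays₂ z.snd.nat))
    fun k => M.listOf (playsCell k (z.cell k))) i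

theorem Position.toFinset_list {M : CellMachine C Γ} (z : M.Position) (i : Fin (M.P + 2)) :
    (z.list i).toFinset = z.full i := by
  ext y
  rw [List.mem_toFinset, mem_full]
  exact player_cases (M.mem_listOf) (M.mem_listOf) (fun _ => M.mem_listOf) i

variable (M : CellMachine C Γ)

noncomputable def strat (i : Fin (M.P + 2)) : List (List (Fin M.size)) :=
  Fin.cases
    ((List.finRange M.P).flatMap fun h => (Finset.univ : Finset (C × Γ)).toList.map fun a =>
      M.listOf (plays₁ (h.val, a)))
    (Fin.cases
      ((List.finRange M.P).flatMap fun h => (Finset.univ : Finset (C × Γ)).toList.map fun a =>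
        M.listOf (M.plays₂ (h.val, a)))
      fun k => (Finset.univ : Finset Γ).toList.map fun g => M.listOf (playsCell k g)) i

variable {M} in
-- The strategy of a player depends on one component of the position; the other components of the
-- witnesses are arbitrary.
theorem mem_strat {i : Fin (M.P + 2)} {a : List (Fin M.size)} :
    a ∈ M.strat i ↔ ∃ z : M.Position, z.list i = a := by
  refine player_cases ?_ ?_ (fun k => ?_) i
  · simp only [strat, Fin.cases_zero, List.mem_flatMap, List.mem_finRange, List.mem_map,
      Finset.mem_toList, Finset.mem_univ, true_and]
    constructor
    · rintro ⟨h, b, rfl⟩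
      exact ⟨⟨(h, b), (h, b), fun _ => b.2⟩, rfl⟩
    · rintro ⟨z, rfl⟩
      exact ⟨z.fst.1, z.fst.2, rfl⟩
  · change a ∈ List.flatMap _ _ ↔ _
    simp only [List.mem_flatMap, List.mem_finRange, List.mem_map,
      Finset.mem_toList, Finset.mem_univ, true_and]
    constructor
    · rintro ⟨h, b, rfl⟩
      exact ⟨⟨(h, b), (h, b), fun _ => b.2⟩, rfl⟩
    · rintro ⟨z, rfl⟩
      exact ⟨z.snd.1, z.snd.2, rfl⟩
  · change a ∈ List.map _ _ ↔ _
    simp only [List.mem_map, Finset.mem_toList, Finset.mem_univ, true_and]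
    constructor
    · rintro ⟨g, rfl⟩
      exact ⟨⟨(k, M.start, g), (k, M.start, g), fun _ => g⟩, rfl⟩
    · rintro ⟨z, rfl⟩
      exact ⟨z.cell k, rfl⟩

theorem listed_strat {i : Fin (M.P + 2)} {T : Finset (Fin M.size)} :
    T ∈ listed (M.strat i) ↔ ∃ z : M.Position, T = z.full i := by
  simp only [listed, Set.mem_ofPred_eq, mem_strat]
  constructor
  · rintro ⟨_, ⟨z, rfl⟩, rfl⟩
    exact ⟨z, z.toFinset_list i⟩
  · rintro ⟨z, rfl⟩
    exact ⟨_, ⟨z, rfl⟩, (z.toFinset_list i).symm⟩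

theorem lowerIdeal_strat {i : Fin (M.P + 2)} {T : Finset (Fin M.size)} :
    T ∈ lowerIdeal (M.strat i) ↔ ∃ z : M.Position, T ⊆ z.full i := by
  simp only [lowerIdeal, Set.mem_ofPred_eq, mem_strat]
  constructor
  · rintro ⟨_, ⟨z, rfl⟩, h⟩
    exact ⟨z, h.trans (z.toFinset_list i).subset⟩
  · rintro ⟨z, h⟩
    exact ⟨_, ⟨z, rfl⟩, h.trans (z.toFinset_list i).symm.subset⟩

theorem listed_nil_strat {i : Fin (M.P + 2)} {T : Finset (Fin M.size)} :
    T ∈ listed ([] :: M.strat i) ↔ T = ∅ ∨ ∃ z : M.Position, T = z.full i := by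
  rw [← listed_strat]
  simp [listed]

theorem supported_of_subset {M : CellMachine C Γ} {S : Fin (M.P + 2) → Finset (Fin M.size)}
    (h : ∀ i, ∃ z : M.Position, S i ⊆ z.full i) : Supported S := by
  intro i y hy
  obtain ⟨z, hz⟩ := h i
  exact z.eq_owner_or_guest (hz hy)

/-! ### Markets -/

noncomputable def marketData : MarketData where
  n := M.P + 2
  m := M.size
  strat := M.strat
  pref y := [owner y, guest y]
  pref_nodup y := by simp [owner_ne_guest]
  mem_pref i a ha y hy := by
    obtain ⟨z, rfl⟩ := mem_strat.1 ha
    have := z.eq_owner_or_guest (i := i) (by rwa [← z.toFinset_list i, List.mem_toFinset])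
    simpa using this

/-- On supported profiles only the owner, with rank `0`, and the guest, with rank `-1`, compete for
a resource. -/
theorem won_eq_wins (A : TwoSidedMarket (M.P + 2) M.size) (hA : A.r = M.marketData.rank)
    {S : Fin (M.P + 2) → Finset (Fin M.size)} (hS : Supported S) (i : Fin (M.P + 2)) :
    A.won S i = wins owner S i := by
  have h₀ : ∀ y : Fin M.size, A.r y (owner y) = 0 := fun y => by
    rw [hA]
    change -((List.idxOf (owner y) [owner y, guest y] : ℕ) : ℝ) = 0
    simp
  have h₁ : ∀ y : Fin M.size, A.r y (guest y) = -1 := fun y => by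
    rw [hA]
    change -((List.idxOf (guest y) [owner y, guest y] : ℕ) : ℝ) = -1
    simp [owner_ne_guest]
  ext y
  simp only [TwoSidedMarket.won, wins, Finset.mem_filter]
  refine and_congr_right fun hy => ?_
  rcases hS i y hy with rfl | rfl
  · refine ⟨fun _ _ => rfl, fun _ j hj hyj => ?_⟩
    rcases hS j y hyj with rfl | rfl
    · exact absurd rfl hj
    · rw [h₀, h₁]
      norm_num
  · refine ⟨fun h ho => ?_, fun h j hj hyj => ?_⟩
    · have := h _ (owner_ne_guest y) ho
      rw [h₀, h₁] at this
      norm_num at this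
    · rcases hS j y hyj with rfl | rfl
      · exact absurd (h hyj) (owner_ne_guest y)
      · exact absurd rfl hj

noncomputable def uniformMarket : UniformMarket where
  toMarketData := M.marketData
  value _ := 1

noncomputable def manyToOneMarket : ManyToOneMarket where
  toMarketData := M.marketData
  util _ := (List.finRange M.size).map fun y => ⟨[y], [], 1⟩

theorem evalRules_map {α : Type} {m : ℕ} (f : Fin m → Rule α) (T : Set α) :
    evalRules ((List.finRange m).map f) T = ∑ y, evalRules [f y] T := by
  simp [evalRules, Fin.sum_univ_def, Function.comp_def]

theorem simulates_uniformMarket : M.Simulates M.uniformMarket.game where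
  full_mem z i := M.listed_strat.2 ⟨z, rfl⟩
  subset_full i T hT := by
    obtain ⟨z, rfl⟩ := M.listed_strat.1 hT
    exact ⟨z, subset_rfl⟩
  utility i := by
    refine ⟨0, fun S hS => ?_⟩
    have hs : Supported S := supported_of_subset fun j => by
      obtain ⟨z, hz⟩ := M.listed_strat.1 (hS j)
      exact ⟨z, hz.subset⟩
    exact (congrArg (fun T : Finset (Fin M.size) => ∑ _y ∈ T, ((1 : ℕ) : ℝ)) (M.won_eq_wins
      (M.uniformMarket.explicitMarket M.uniformMarket.u) rfl hs i)).trans (by simp)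

theorem simulates_uniformMarket_ideal : M.Simulates M.uniformMarket.idealGame where
  full_mem z i := M.lowerIdeal_strat.2 ⟨z, subset_rfl⟩
  subset_full i T hT := M.lowerIdeal_strat.1 hT
  utility i := by
    refine ⟨0, fun S hS => ?_⟩
    have hs : Supported S := supported_of_subset fun j => M.lowerIdeal_strat.1 (hS j)
    exact (congrArg (fun T : Finset (Fin M.size) => ∑ _y ∈ T, ((1 : ℕ) : ℝ)) (M.won_eq_wins
      (M.uniformMarket.idealMarket M.uniformMarket.u) rfl hs i)).trans (by simp)

theorem simulates_manyToOneMarket : M.Simulates M.manyToOneMarket.game where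
  full_mem z i := M.lowerIdeal_strat.2 ⟨z, subset_rfl⟩
  subset_full i T hT := M.lowerIdeal_strat.1 hT
  utility i := by
    refine ⟨0, fun S hS => ?_⟩
    have hs : Supported S := supported_of_subset fun j => M.lowerIdeal_strat.1 (hS j)
    refine (congrArg (fun T : Finset (Fin M.size) =>
      evalRules ((List.finRange M.size).map fun y => ⟨[y], [], 1⟩) (T : Set (Fin M.size)))
      (M.won_eq_wins (M.manyToOneMarket.idealMarket fun x T => evalRules
        (M.manyToOneMarket.util x) (↑(show Finset (Fin M.size) from T) : Set (Fin M.size))) rfl hs i)).trans ?_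
    simp only [evalRules_map]
    simp [evalRules]

/-! ### Valid-utility games -/

noncomputable def utilRules (i : Fin (M.P + 2)) : List (Rule (Fin (M.P + 2) × Fin M.size)) :=
  (List.finRange M.size).map fun y => ⟨[(i, y)], if owner y = i then [] else [(owner y, y)], 1⟩

/-- The two rules of a resource exclude each other, so a used resource counts once. -/
noncomputable def socialRules : List (Rule (Fin (M.P + 2) × Fin M.size)) :=
  (List.finRange M.size).map (fun y => ⟨[(owner y, y)], [], 1⟩) ++
    (List.finRange M.size).map fun y => ⟨[(guest y, y)], [(owner y, y)], 1⟩

noncomputable def validUtilityData : ValidUtilityData where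
  n := M.P + 2
  m := M.size
  strat i := [] :: M.strat i
  util := M.utilRules
  social := M.socialRules

noncomputable def validUtilityGame : SetGame (M.P + 2) M.size := M.validUtilityData.game

noncomputable def social : (Fin (M.P + 2) → Finset (Fin M.size)) → ℝ := M.validUtilityData.γ

theorem supported_validUtilityGame {S : Fin (M.P + 2) → Finset (Fin M.size)}
    (hS : M.validUtilityGame.Feasible S) : Supported S := by
  refine supported_of_subset fun j => ?_
  rcases M.listed_nil_strat.1 (hS j) with h | ⟨z, hz⟩
  · exact ⟨(Config.initial M).position, by simp [h]⟩
  · exact ⟨z, hz.subset⟩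

theorem validUtilityGame_u (S : Fin (M.P + 2) → Finset (Fin M.size)) (i : Fin (M.P + 2)) :
    M.validUtilityGame.u i S = ∑ y, if y ∈ wins owner S i then 1 else 0 := by
  change evalRules (M.utilRules i) (pairs S) = _
  rw [utilRules, evalRules_map]
  refine Finset.sum_congr rfl fun y _ => ?_
  by_cases h : owner y = i
  · simp [evalRules, pairs, wins, h]
  · simp [evalRules, pairs, wins, h]

theorem social_eq (S : Fin (M.P + 2) → Finset (Fin M.size)) :
    M.social S = ∑ y, if y ∈ S (owner y) ∨ y ∈ S (guest y) then 1 else 0 := by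
  change evalRules M.socialRules (pairs S) = _
  have : ∀ {α : Type} (l l' : List (Rule α)) (T : Set α),
      evalRules (l ++ l') T = evalRules l T + evalRules l' T := by simp [evalRules]
  rw [socialRules, this, evalRules_map, evalRules_map, ← Finset.sum_add_distrib]
  refine Finset.sum_congr rfl fun y _ => ?_
  by_cases h : y ∈ S (owner y) <;> simp [evalRules, pairs, h]

theorem simulates_validUtilityGame : M.Simulates M.validUtilityGame where
  full_mem z i := M.listed_nil_strat.2 (.inr ⟨z, rfl⟩)
  subset_full i T hT := by
    rcases M.listed_nil_strat.1 hT with rfl | ⟨z, rfl⟩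
    · exact ⟨(Config.initial M).position, Finset.empty_subset _⟩
    · exact ⟨z, subset_rfl⟩
  utility i := by
    refine ⟨0, fun S hS => ?_⟩
    rw [validUtilityGame_u]
    simp

/-- The social function is a sum of indicators that a resource is used by its owner or its guest,
which is monotone and submodular term by term. If the withdrawal of a player makes a resource
unused, that player was alone on it and wins it. No resource is won by two players, which bounds the
sum of the utilities. -/
theorem isValidUtility : IsValidUtility M.validUtilityGame M.social where
  null_mem i := M.listed_nil_strat.2 (.inl rfl)
  nonneg A := by
    rw [social_eq]
    positivity
  mono A B h := by
    rw [social_eq, social_eq]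
    refine Finset.sum_le_sum fun y _ => ?_
    have h₁ := @h (owner y) y
    have h₂ := @h (guest y) y
    split_ifs <;> first | (norm_num; done) | tauto
  submodular A B := by
    simp only [social_eq, ← Finset.sum_add_distrib]
    refine Finset.sum_le_sum fun y _ => ?_
    simp only [Finset.mem_union, Finset.mem_inter]
    split_ifs <;> first | (norm_num; done) | tauto
  marginal S hS i := by
    have hs := M.supported_validUtilityGame hS
    rw [social_eq, social_eq, validUtilityGame_u, sub_le_iff_le_add,
      ← Finset.sum_add_distrib]
    refine Finset.sum_le_sum fun y _ => ?_
    have h := owner_ne_guest y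
    by_cases h₁ : owner y = i
    · subst h₁
      by_cases h₁ : y ∈ S (owner y) <;> by_cases h₂ : y ∈ S (guest y) <;>
        simp [update_of_ne h.symm, wins, h₁, h₂]
    · by_cases h₂ : guest y = i
      · subst h₂
        by_cases h₁ : y ∈ S (owner y) <;> by_cases h₂ : y ∈ S (guest y) <;>
          simp [wins, h₁, h₂, h]
      · rw [update_of_ne h₁, update_of_ne h₂]
        split_ifs <;> norm_num
  sum_le S hS := by
    have hs := M.supported_validUtilityGame hS
    simp only [social_eq, validUtilityGame_u]
    rw [Finset.sum_comm]
    refine Finset.sum_le_sum fun y _ => ?_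
    have h := owner_ne_guest y
    -- The only player that can win `y`.
    set j : Fin (M.P + 2) := if y ∈ S (owner y) then owner y else guest y with hj
    calc ∑ i, (if y ∈ wins owner S i then (1 : ℝ) else 0)
        ≤ ∑ i, if i = j then
            (if y ∈ S (owner y) ∨ y ∈ S (guest y) then (1 : ℝ) else 0) else 0 := by
          refine Finset.sum_le_sum fun i _ => ?_
          by_cases hi : y ∈ wins owner S i
          · obtain ⟨h₁, h₂⟩ := Finset.mem_filter.1 hi
            have : i = j ∧ (y ∈ S (owner y) ∨ y ∈ S (guest y)) := by
              rcases hs i y h₁ with rfl | rfl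
              · simp [hj, h₁]
              · have : y ∉ S (owner y) := fun ho => h (h₂ ho)
                simp [hj, h₁, this]
            rw [if_pos hi, if_pos this.1, if_pos this.2]
          · rw [if_neg hi]
            positivity
      _ = _ := by simp

/-! ### Congestion games -/

noncomputable def congestionData : CongestionData where
  n := M.P + 2
  m := M.size
  strat := M.strat
  weight := M.weight
  weight_pos := M.weight_pos
  delay y := [(M.weight (guest y), -1)]

theorem card_owned (z : M.Position) (i : Fin (M.P + 2)) :
    ∑ y ∈ z.full i, (if owner y = i then (1 : ℝ) else 0) = highCount i := by
  rw [← sum_high z i, Position.full, Finset.sum_filter, ← Equiv.sum_comp resource]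
  push_cast
  refine Finset.sum_congr rfl fun x _ => ?_
  simp only [owner, Equiv.symm_apply_apply, ite_and]

/-- By `lookup_load` the utility differs from the number of won resources by the number of owned
ones in the strategy, which is the constant `highCount i`. -/
theorem simulates_congestionData : M.Simulates M.congestionData.game where
  full_mem z i := M.listed_strat.2 ⟨z, rfl⟩
  subset_full i T hT := by
    obtain ⟨z, rfl⟩ := M.listed_strat.1 hT
    exact ⟨z, subset_rfl⟩
  utility i := by
    refine ⟨-highCount i, fun S hS => ?_⟩
    have hs : Supported S := supported_of_subset fun j => by
      obtain ⟨z, hz⟩ := M.listed_strat.1 (hS j)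
      exact ⟨z, hz.subset⟩
    obtain ⟨z, hz⟩ := M.listed_strat.1 (hS i)
    refine (congrArg Neg.neg (Finset.sum_congr rfl fun y hy => M.lookup_load hs i y hy)).trans ?_
    rw [Finset.sum_sub_distrib, ← M.card_owned z i, ← hz, ← Finset.sum_filter (s := S i)
      (p := fun y => y ∈ wins owner S i), Finset.filter_mem_eq_inter,
      Finset.inter_eq_right.2 (show wins owner S i ⊆ S i from Finset.filter_subset _ _)]
    simp [sub_eq_add_neg]

/-- Both utilities are ordered like the number of won resources, so with equal strategy families the
identity preserves the arcs, on all states and not only on the simulated run. -/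
theorem dynamicsIsoAt_of_simulates {G H : SetGame (M.P + 2) M.size} (hF : G.F = H.F)
    (hG : M.Simulates G) (hH : M.Simulates H) (z : M.Position) :
    G.DynamicsIsoAt z.full H z.full := by
  refine ⟨hG.feasible z, hH.feasible z, ?_⟩
  obtain ⟨F, u⟩ := G
  obtain ⟨F', u'⟩ := H
  obtain rfl : F = F' := hF
  refine ⟨Equiv.refl _, Equiv.refl _, rfl, fun i S S' => and_congr Iff.rfl ?_⟩
  exact (hG.lt_iff i (fun k => (S k).2) fun k => (S' k).2).trans
    (hH.lt_iff i (fun k => (S k).2) fun k => (S' k).2).symm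

end CellMachine

end SinkEq

namespace SinkEq

open Computability Function

/-! ## Printing the games -/

namespace Printable

variable {α : Type} [Ctx α]

theorem bracket {f : α → Word} (hf : Printable f) :
    Printable fun a => Γ'.bra :: (f a ++ [Γ'.ket]) :=
  (single Γ'.bra).append (hf.append (single Γ'.ket))

/-- There are finitely many candidates for `t a`, fixed in advance; the words of all of them are
concatenated, each behind a test that suppresses it unless it is the right one. -/
theorem select {X : Type} [Fintype X] [DecidableEq X] {t : α → X} {w : α → X → Word}
    (ht : ∀ g, Test fun a => decide (t a = g)) (hw : ∀ g, Printable fun a => w a g) :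
    Printable fun a => w a (t a) := by
  have key : ∀ a, ∀ l : List X, l.Nodup →
      l.flatMap (fun g => if decide (t a = g) then w a g else []) =
        if t a ∈ l then w a (t a) else [] := by
    intro a l hl
    induction l with
    | nil => rfl
    | cons b l ih =>
      rw [List.flatMap_cons, ih (List.nodup_cons.1 hl).2]
      by_cases h : t a = b
      · subst h
        simp [(List.nodup_cons.1 hl).1]
      · simp [h]
  have h := flatMap_fixed (Finset.univ : Finset X).toList
    (f := fun a g => if decide (t a = g) then w a g else []) fun g _ => (hw g).cond (ht g)
  have e : (fun a => w a (t a)) = fun a => (Finset.univ : Finset X).toList.flatMap fun g =>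
      if decide (t a = g) then w a g else [] := by
    funext a
    rw [key a _ (Finset.nodup_toList _)]
    simp
  rw [e]
  exact h

/-- A loop with one round supplies the value `0` of the additional component. -/
theorem at_zero {w : α × ℕ → Word} (hw : Printable w) : Printable fun a => w (a, 0) := by
  have := forRange (f := fun a h => w (a, h)) (Count.const (α := α) 1) hw
  simpa using this

end Printable

theorem finRange_mul (m n : ℕ) : List.finRange (m * n) =
    (List.finRange m).flatMap fun i => (List.finRange n).map fun j => finProdFinEquiv (i, j) := by
  refine (List.map_injective_iff.2 Fin.val_injective) ?_
  have h : ((List.finRange m).flatMap fun i => (List.finRange n).map fun j =>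
      finProdFinEquiv (i, j)).map Fin.val =
      ((List.finRange m).map Fin.val).flatMap fun i =>
        ((List.finRange n).map Fin.val).map fun j => j + n * i := by
    simp only [List.map_flatMap, List.flatMap_map, List.map_map]
    rfl
  rw [h]
  clear h
  simp only [List.map_coe_finRange_eq_range]
  induction m with
  | zero => simp
  | succ m ih =>
    rw [List.range_succ, List.flatMap_append, ← ih, Nat.succ_mul, List.range_add]
    simp [Nat.mul_comm, Nat.add_comm]

theorem flatMap_finRange {n : ℕ} (f : ℕ → Word) :
    (List.finRange n).flatMap (fun i => f i.val) = (List.range n).flatMap f := by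
  rw [← List.map_coe_finRange_eq_range, List.flatMap_map]

namespace CellMachine

variable {C Γ : Type}

/-- The number of the player with priority on a resource. -/
def highNat (h : ℕ) : Loc C Γ → ℕ
  | .copy _ => 0
  | .go _ => 1
  | .pad _ => 1
  | .see _ => h + 2
  | .put _ => 1

/-- The number of the other player. -/
def lowNat (h : ℕ) : Loc C Γ → ℕ
  | .copy _ => 1
  | .go _ => 0
  | .pad _ => 0
  | .see _ => 0
  | .put _ => h + 2

/-- The weight of the other player. -/
def lowWeight : Loc C Γ → ℕ
  | .copy _ => 2
  | .go _ => 1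
  | .pad _ => 1
  | .see _ => 1
  | .put _ => 3

theorem highNat_count {α : Type} [Ctx α] (l : Loc C Γ) : Count fun b : α × ℕ => highNat b.2 l := by
  cases l with
  | see => exact Count.snd.add (Count.const 2)
  | _ => exact Count.const _

theorem lowNat_count {α : Type} [Ctx α] (l : Loc C Γ) : Count fun b : α × ℕ => lowNat b.2 l := by
  cases l with
  | put => exact Count.snd.add (Count.const 2)
  | _ => exact Count.const _

variable [Fintype C] [Fintype Γ]

/-- The resources at one position in the order of their numbers. -/
noncomputable def locs : List (Loc C Γ) :=
  (List.finRange (Fintype.card (Loc C Γ))).map (Fintype.equivFin _).symm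

/-- The number of a resource. -/
noncomputable def code (h : ℕ) (l : Loc C Γ) : ℕ :=
  (Fintype.equivFin _ l).val + Fintype.card (Loc C Γ) * h

theorem resource_val {M : CellMachine C Γ} (h : Fin M.P) (l : Loc C Γ) :
    (resource (h, l)).val = code h.val l := rfl

/-- This makes words over all resources printable: the outer loop over positions has a length that
depends on the input, while the inner list depends only on the types `C` and `Γ` and is unrolled. -/
theorem flatMap_resources (M : CellMachine C Γ) {g : Fin M.size → Word} {g' : ℕ → Loc C Γ → Word}
    (hg : ∀ h l, g (resource (h, l)) = g' h.val l) :
    (List.finRange M.size).flatMap g =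
      (List.range M.P).flatMap fun h => locs.flatMap fun l => g' h l := by
  rw [finRange_mul, List.flatMap_assoc, ← flatMap_finRange]
  congr 1
  funext h
  rw [List.flatMap_map, locs, List.flatMap_map]
  congr 1
  funext j
  rw [← hg]
  simp [resource]

theorem code_count {α : Type} [Ctx α] (l : Loc C Γ) : Count fun b : α × ℕ => code b.2 l :=
  (Count.const _).add ((Count.const _).mul Count.snd)

theorem printable_flatMap_resources {α : Type} [Ctx α] {P : α → ℕ} (hP : Count P)
    {g' : α → ℕ → Loc C Γ → Word} (hg' : ∀ l, Printable fun b : α × ℕ => g' b.1 b.2 l) :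
    Printable fun a => (List.range (P a)).flatMap fun h => locs.flatMap fun l => g' a h l :=
  Printable.forRange hP (Printable.flatMap_fixed locs fun l _ => hg' l)

theorem printable_encIdx_listOf {α : Type} [Ctx α] (N : α → CellMachine C Γ)
    (hP : Count fun a => (N a).P) {f : α → ℕ → Loc C Γ → Bool}
    (hf : ∀ l, Test fun b : α × ℕ => f b.1 b.2 l) :
    Printable fun a => encIdx ((N a).listOf (f a)) := by
  have h := (printable_flatMap_resources hP (g' := fun a h l =>
    if f a h l then encNat (code h l) else [])
    fun l => (Printable.encNat (code_count l)).cond (hf l)).bracket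
  have e : (fun a => encIdx ((N a).listOf (f a))) = fun a => Γ'.bra ::
      (((List.range (N a).P).flatMap fun h => locs.flatMap fun l =>
        if f a h l then encNat (code h l) else []) ++ [Γ'.ket]) := by
    funext a
    rw [← flatMap_resources (N a) (g := fun y =>
      if f a (resource.symm y).1 (resource.symm y).2 then encNat y.val else [])]
    · unfold encIdx encList listOf
      congr 2
      induction List.finRange (N a).size with
      | nil => rfl
      | cons y l ih =>
        rw [List.filter_cons, List.flatMap_cons, ← ih]
        split_ifs <;> simp
    · intro h l
      rw [Equiv.symm_apply_apply, resource_val]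
  rw [e]
  exact h

section

variable {M : CellMachine C Γ} (h : Fin M.P) (l : Loc C Γ)

theorem owner_val : (owner (resource (h, l))).val = highNat h.val l := by
  rw [owner, Equiv.symm_apply_apply]
  cases l <;> rfl

theorem guest_val : (guest (resource (h, l))).val = lowNat h.val l := by
  rw [guest, Equiv.symm_apply_apply]
  cases l <;> rfl

theorem weight_guest : M.weight (guest (resource (h, l))) = lowWeight l := by
  rw [guest, Equiv.symm_apply_apply]
  cases l <;> rfl

end

section

variable (M : CellMachine C Γ)

/-- The word of a list of one pair of a player and a resource. -/
def pairWord (i y : ℕ) : Word := Γ'.bra :: (encNat i ++ encNat y ++ [Γ'.ket])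

/-- The rules do not involve the transitions, so the machine enters only through `P`. -/
noncomputable def utilWord (P i : ℕ) : Word :=
  Γ'.bra :: (((List.range P).flatMap fun h => (locs : List (Loc C Γ)).flatMap fun l =>
    pairWord i (code h l) ++ (if decide (highNat h l = i) then [Γ'.bra, Γ'.ket] else
      pairWord (highNat h l) (code h l)) ++ encInt 1) ++ [Γ'.ket])

noncomputable def socialWord (P : ℕ) : Word :=
  Γ'.bra :: (((List.range P).flatMap fun h => (locs : List (Loc C Γ)).flatMap fun l =>
    pairWord (highNat h l) (code h l) ++ [Γ'.bra, Γ'.ket] ++ encInt 1) ++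
    ((List.range P).flatMap fun h => (locs : List (Loc C Γ)).flatMap fun l =>
    pairWord (lowNat h l) (code h l) ++ pairWord (highNat h l) (code h l) ++ encInt 1) ++ [Γ'.ket])

noncomputable def cardWord (P : ℕ) : Word :=
  Γ'.bra :: (((List.range P).flatMap fun h => (locs : List (Loc C Γ)).flatMap fun l =>
    Γ'.bra :: (encNat (code h l) ++ [Γ'.ket]) ++ [Γ'.bra, Γ'.ket] ++ encInt 1) ++ [Γ'.ket])

theorem encRules_utilRules (i : Fin (M.P + 2)) :
    encRules encPair (M.utilRules i) = utilWord (C := C) (Γ := Γ) M.P i.val := by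
  unfold encRules encList utilRules utilWord
  rw [List.flatMap_map]
  congr 2
  refine flatMap_resources M fun h l => ?_
  have e : owner (resource (h, l)) = i ↔ highNat h.val l = i.val := by
    rw [Fin.ext_iff, owner_val]
  by_cases hi : owner (resource (h, l)) = i
  · simp [hi, e.1 hi, pairWord, encPair, resource_val]
  · simp [hi, mt e.2 hi, pairWord, encPair, resource_val, owner_val]

theorem encRules_socialRules :
    encRules encPair M.socialRules = socialWord (C := C) (Γ := Γ) M.P := by
  unfold encRules encList socialRules socialWord
  rw [List.flatMap_append, List.flatMap_map, List.flatMap_map]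
  congr 3
  · exact flatMap_resources M fun h l => by simp [pairWord, encPair, resource_val, owner_val]
  · exact flatMap_resources M fun h l => by
      simp [pairWord, encPair, resource_val, owner_val, guest_val]

theorem encRules_card :
    encRules (fun y : Fin M.size => encNat y.val)
      ((List.finRange M.size).map fun y => ⟨[y], [], 1⟩) = cardWord (C := C) (Γ := Γ) M.P := by
  unfold encRules encList cardWord
  rw [List.flatMap_map]
  congr 2
  exact flatMap_resources M fun h l => by simp [resource_val]

end

section

variable {α : Type} [Ctx α]

theorem printable_pairWord {e e' : α → ℕ} (he : Count e) (he' : Count e') :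
    Printable fun a => pairWord (e a) (e' a) :=
  (Printable.append (.encNat he) (.encNat he')).bracket

theorem printable_utilWord {P i : α → ℕ} (hP : Count P) (hi : Count i) :
    Printable fun a => utilWord (C := C) (Γ := Γ) (P a) (i a) :=
  (printable_flatMap_resources hP fun l => ((printable_pairWord hi.fst (code_count l)).append
    (.ite (Test.eq (highNat_count l) hi.fst) (.const _)
      (printable_pairWord (highNat_count l) (code_count l)))).append (.const _)).bracket

theorem printable_socialWord {P : α → ℕ} (hP : Count P) :
    Printable fun a => socialWord (C := C) (Γ := Γ) (P a) :=
  (Printable.append (printable_flatMap_resources hP fun l =>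
      ((printable_pairWord (highNat_count l) (code_count l)).append (.const _)).append (.const _))
    (printable_flatMap_resources hP fun l =>
      ((printable_pairWord (lowNat_count l) (code_count l)).append
        (printable_pairWord (highNat_count l) (code_count l))).append (.const _))).bracket

theorem printable_cardWord {P : α → ℕ} (hP : Count P) :
    Printable fun a => cardWord (C := C) (Γ := Γ) (P a) :=
  (printable_flatMap_resources hP fun l =>
    ((Printable.bracket (.encNat (code_count l))).append (.const _)).append (.const _)).bracket

theorem printable_encFun_resources (N : α → CellMachine C Γ) (hP : Count fun a => (N a).P)
    {e : ∀ a, Fin (N a).size → Word} {w : α → ℕ → Loc C Γ → Word}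
    (he : ∀ a h l, e a (resource (h, l)) = w a h.val l)
    (hw : ∀ l, Printable fun b : α × ℕ => w b.1 b.2 l) : Printable fun a => encFun (e a) := by
  have h := (printable_flatMap_resources hP hw).bracket
  simp only [← flatMap_resources (N _) (he _)] at h
  exact h

theorem printable_encFun_pref (N : α → CellMachine C Γ) (hP : Count fun a => (N a).P) (w : Word) :
    Printable fun a => encFun fun y : Fin (N a).size => w ++ encIdx [owner y, guest y] := by
  refine printable_encFun_resources N hP (w := fun _ h l =>
    w ++ Γ'.bra :: (encNat (highNat h l) ++ encNat (lowNat h l) ++ [Γ'.ket])) (fun a h l => ?_)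
    fun l => (Printable.const w).append
      (Printable.append (.encNat (highNat_count l)) (.encNat (lowNat_count l))).bracket
  simp [encIdx, encList, owner_val, guest_val]

theorem printable_encFun_delay (N : α → CellMachine C Γ) (hP : Count fun a => (N a).P) :
    Printable fun a => encFun fun y : Fin (N a).size =>
      encList (fun a : ℕ × ℤ => encNat a.1 ++ encInt a.2) [((N a).weight (guest y), -1)] :=
  printable_encFun_resources N hP (w := fun _ _ l =>
    encList (fun a : ℕ × ℤ => encNat a.1 ++ encInt a.2) [(lowWeight l, -1)])
    (fun a h l => by rw [weight_guest]) fun l => .const _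

end

end CellMachine

end SinkEq

/-! ### Words indexed by players, and machines uniform in the input -/

namespace SinkEq

open Computability Function

namespace CellMachine

variable {C Γ : Type}

/-- A word for each player that can be printed in polynomial time. -/
structure PlayerPrintable (M : List Bool → CellMachine C Γ)
    (e : ∀ x, Fin ((M x).P + 2) → Word) : Prop where
  zero : Printable fun x => e x 0
  one : Printable fun x => e x 1
  agent : ∃ f : List Bool × ℕ → Word, Printable f ∧ ∀ x k, e x (agent k) = f (x, k.val)

namespace PlayerPrintable

variable {M : List Bool → CellMachine C Γ} {e e' : ∀ x, Fin ((M x).P + 2) → Word}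

theorem append (h : PlayerPrintable M e) (h' : PlayerPrintable M e') :
    PlayerPrintable M fun x i => e x i ++ e' x i := by
  obtain ⟨f, hf, hf'⟩ := h.agent
  obtain ⟨g, hg, hg'⟩ := h'.agent
  exact ⟨h.zero.append h'.zero, h.one.append h'.one,
    _, hf.append hg, fun x k => by rw [hf', hg']⟩

theorem bracket (h : PlayerPrintable M e) :
    PlayerPrintable M fun x i => Γ'.bra :: (e x i ++ [Γ'.ket]) := by
  obtain ⟨f, hf, hf'⟩ := h.agent
  exact ⟨h.zero.bracket, h.one.bracket, _, hf.bracket, fun x k => by rw [hf']⟩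

theorem const (w : Word) : PlayerPrintable M fun _ _ => w :=
  ⟨.const w, .const w, _, .const w, fun _ _ => rfl⟩

theorem weight : PlayerPrintable M fun x i => encNat ((M x).weight i) :=
  ⟨.const (encNat 1), .const (encNat 2), _, .const (encNat 3), fun _ _ => rfl⟩

end PlayerPrintable

variable [DecidableEq Γ]

theorem test_playsCell {α : Type} [Ctx α] (g : Γ) (l : Loc C Γ) :
    Test fun b : (α × ℕ) × ℕ => playsCell (C := C) b.1.2 g b.2 l := by
  cases l with
  | see a => exact (Test.eq Count.snd Count.snd.fst).and (Test.const _)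
  | put g' => exact (Test.eq Count.snd Count.snd.fst).and (Test.const _)
  | _ => exact Test.const false

variable [DecidableEq C]

theorem test_label {α : Type} [Ctx α] {h h' : α → ℕ} (hh : Count h) (hh' : Count h')
    (a a' : C × Γ) : Test fun b => decide ((h b, a) = (h' b, a')) := by
  by_cases e : a = a'
  · simpa [e] using Test.eq hh hh'
  · simpa [e] using Test.const false

theorem test_plays₁ {α : Type} [Ctx α] (a : C × Γ) (l : Loc C Γ) :
    Test fun b : (α × ℕ) × ℕ => plays₁ (b.1.2, a) b.2 l := by
  cases l with
  | copy a' =>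
    simpa [plays₁] using (test_label (α := (α × ℕ) × ℕ) Count.snd Count.snd.fst a' a).not
  | go a' => exact test_label Count.snd Count.snd.fst a' a
  | see a' => exact test_label Count.snd Count.snd.fst a' a
  | _ => exact Test.const false

/-- The machines `M x` can be constructed from `x` in polynomial time. -/
structure IsUniform (M : List Bool → CellMachine C Γ) : Prop where
  P : Count fun x => (M x).P
  wr : ∀ c g g', Test fun b : List Bool × ℕ => decide ((M b.1).wr c b.2 g = g')
  nx : ∀ c g c',
    Test fun b : (List Bool × ℕ) × ℕ => decide ((M b.1.1).nx c b.1.2 g = (c', b.2))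
  start : ∃ c, ∀ x, (M x).start = c
  tape : ∀ g, Test fun b : List Bool × ℕ => decide ((M b.1).tape b.2 = g)

namespace IsUniform

variable {M : List Bool → CellMachine C Γ} (hM : IsUniform M)

include hM

/-- The target of `nx` need not be computed: its position is compared with a loop variable, its
control state with a fixed one. -/
theorem test_ready (a a' : C × Γ) : Test fun b : (List Bool × ℕ) × ℕ =>
    (M b.1.1).ready (b.2, a') (b.1.2, a) := by
  have h₁ := test_label (α := (List Bool × ℕ) × ℕ) Count.snd Count.snd.fst a' a
  have h₂ := (hM.wr a.1 a.2 a.2).fst.not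
  have h₃ := hM.nx a.1 a.2 a'.1
  convert h₁.cond h₂ h₃ using 2 with b
  by_cases h : (b.2, a') = (b.1.2, a)
  · obtain ⟨e₁, rfl⟩ := Prod.mk.inj h
    simp [ready, e₁]
  · simp [ready, h]

theorem test_plays₂ (a : C × Γ) (l : Loc C Γ) : Test fun b : (List Bool × ℕ) × ℕ =>
    (M b.1.1).plays₂ (b.1.2, a) b.2 l := by
  cases l with
  | copy a' => exact test_label Count.snd Count.snd.fst a' a
  | go a' => exact (hM.test_ready a a').not
  | pad a' => exact hM.test_ready a a'
  | see a' => exact Test.const false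
  | put g => exact ((Test.eq Count.snd Count.snd.fst).and (hM.wr a.1 a.2 g).fst).not

variable [Fintype C] [Fintype Γ]

theorem printable_plays₁ (a : C × Γ) :
    Printable fun b : List Bool × ℕ => encIdx ((M b.1).listOf (plays₁ (b.2, a))) :=
  printable_encIdx_listOf (fun b : List Bool × ℕ => M b.1) hM.P.fst (test_plays₁ a)

theorem printable_plays₂ (a : C × Γ) :
    Printable fun b : List Bool × ℕ => encIdx ((M b.1).listOf ((M b.1).plays₂ (b.2, a))) :=
  printable_encIdx_listOf (fun b : List Bool × ℕ => M b.1) hM.P.fst (hM.test_plays₂ a)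

theorem printable_playsCell (g : Γ) :
    Printable fun b : List Bool × ℕ => encIdx ((M b.1).listOf (playsCell b.2 g)) :=
  printable_encIdx_listOf (fun b : List Bool × ℕ => M b.1) hM.P.fst (test_playsCell g)

end IsUniform

namespace PlayerPrintable

variable {M : List Bool → CellMachine C Γ} {e : ∀ x, Fin ((M x).P + 2) → Word}

theorem encFun (hM : IsUniform M) (h : PlayerPrintable M e) : Printable fun x => encFun (e x) := by
  obtain ⟨f, hf, hf'⟩ := h.agent
  have hp := (h.zero.append (h.one.append (Printable.forRange (f := fun x k => f (x, k))
    hM.P hf))).bracket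
  have he : ∀ x, SinkEq.encFun (e x) = Γ'.bra :: ((e x 0 ++ (e x 1 ++
      (List.range (M x).P).flatMap fun k => f (x, k))) ++ [Γ'.ket]) := by
    intro x
    rw [← flatMap_finRange]
    simp only [← hf']
    simp [SinkEq.encFun, encList, List.finRange_succ, List.flatMap_map, CellMachine.agent]
  simpa only [he] using hp

variable [Fintype C] [Fintype Γ]

theorem strat (hM : IsUniform M) : PlayerPrintable M fun x i => ((M x).strat i).flatMap encIdx := by
  refine ⟨?_, ?_, fun b => ((Finset.univ : Finset Γ).toList.flatMap fun g =>
    encIdx ((M b.1).listOf (playsCell b.2 g))), Printable.flatMap_fixed _ fun g _ =>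
    hM.printable_playsCell g, fun x k => ?_⟩
  · have h := Printable.forRange hM.P (f := fun x h => (Finset.univ : Finset (C × Γ)).toList.flatMap
      fun a => encIdx ((M x).listOf (plays₁ (h, a))))
      (Printable.flatMap_fixed _ fun a _ => hM.printable_plays₁ a)
    simp only [← flatMap_finRange] at h
    simpa only [CellMachine.strat, Fin.cases_zero, List.flatMap_assoc, List.flatMap_map] using h
  · have h := Printable.forRange hM.P (f := fun x h => (Finset.univ : Finset (C × Γ)).toList.flatMap
      fun a => encIdx ((M x).listOf ((M x).plays₂ (h, a))))
      (Printable.flatMap_fixed _ fun a _ => hM.printable_plays₂ a)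
    simp only [← flatMap_finRange] at h
    change Printable fun x => List.flatMap encIdx (List.flatMap _ _)
    simpa only [List.flatMap_assoc, List.flatMap_map] using h
  · change List.flatMap encIdx (List.map _ _) = _
    rw [List.flatMap_map]

theorem util (hM : IsUniform M) :
    PlayerPrintable M fun x i => encRules encPair ((M x).utilRules i) := by
  simp only [encRules_utilRules]
  exact ⟨printable_utilWord hM.P (Count.const 0), printable_utilWord hM.P (Count.const 1),
    _, printable_utilWord hM.P.fst (Count.snd.add (Count.const 2)), fun _ _ => rfl⟩

/-- The initial control state is the same for all inputs, but the symbols on the tape are not;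
`select` runs through the possible symbols. -/
theorem position (hM : IsUniform M) :
    PlayerPrintable M fun x i => encIdx ((Config.initial (M x)).position.list i) := by
  obtain ⟨c, hc⟩ := hM.start
  have h₁ := (Printable.select (t := fun b : List Bool × ℕ => (M b.1).tape b.2)
    (w := fun b g => encIdx ((M b.1).listOf (plays₁ (b.2, c, g)))) hM.tape
    fun g => hM.printable_plays₁ (c, g)).at_zero
  have h₂ := (Printable.select (t := fun b : List Bool × ℕ => (M b.1).tape b.2)
    (w := fun b g => encIdx ((M b.1).listOf ((M b.1).plays₂ (b.2, c, g)))) hM.tape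
    fun g => hM.printable_plays₂ (c, g)).at_zero
  have h₃ := (Printable.select (t := fun b : List Bool × ℕ => (M b.1).tape b.2)
    (w := fun b g => encIdx ((M b.1).listOf (playsCell b.2 g))) hM.tape
    fun g => hM.printable_playsCell g)
  have e₁ : ∀ x, encIdx ((Config.initial (M x)).position.list 0) =
      encIdx ((M x).listOf (plays₁ (0, c, (M x).tape 0))) := fun x => by
    rw [← hc x]
    rfl
  have e₂ : ∀ x, encIdx ((Config.initial (M x)).position.list 1) =
      encIdx ((M x).listOf ((M x).plays₂ (0, c, (M x).tape 0))) := fun x => by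
    rw [← hc x]
    rfl
  exact ⟨by simpa only [e₁] using h₁, by simpa only [e₂] using h₂, _, h₃, fun _ _ => rfl⟩

end PlayerPrintable

namespace IsUniform

variable {M : List Bool → CellMachine C Γ} (hM : IsUniform M)

variable [Fintype C] [Fintype Γ]

include hM

theorem printable_profile :
    Printable fun x => encProfile (Config.initial (M x)).position.list :=
  (PlayerPrintable.position hM).encFun hM

theorem printable_strat :
    Printable fun x => encFun fun i => encList encIdx ((M x).strat i) :=
  (PlayerPrintable.strat hM).bracket.encFun hM

theorem printable_uniformMarket : Printable fun x =>
    (M x).uniformMarket.enc ++ encProfile (Config.initial (M x)).position.list :=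
  (hM.printable_strat.append (printable_encFun_pref M hM.P (encNat 1))).append
    hM.printable_profile

theorem printable_manyToOneMarket : Printable fun x =>
    (M x).manyToOneMarket.enc ++ encProfile (Config.initial (M x)).position.list := by
  have h : PlayerPrintable M fun x (_ : Fin ((M x).P + 2)) =>
      encRules (fun y : Fin (M x).size => encNat y.val)
        ((List.finRange (M x).size).map fun y => ⟨[y], [], 1⟩) := by
    simp only [encRules_card]
    exact ⟨printable_cardWord hM.P, printable_cardWord hM.P, _, printable_cardWord hM.P.fst,
      fun _ _ => rfl⟩
  exact ((((PlayerPrintable.strat hM).bracket.append h).encFun hM).append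
    (printable_encFun_pref M hM.P [])).append hM.printable_profile

theorem printable_validUtilityData : Printable fun x =>
    (M x).validUtilityData.enc ++ encProfile (Config.initial (M x)).position.list := by
  have h : Printable fun x => encRules encPair (M x).socialRules := by
    simp only [encRules_socialRules]
    exact printable_socialWord hM.P
  exact (((Printable.encNat (hM.P.mul (Count.const _))).append
    -- The empty strategy has the same code for every number of resources, so `k := 0` will do.
    (((((PlayerPrintable.const (encIdx (k := 0) [])).append
      (PlayerPrintable.strat hM)).bracket.append (PlayerPrintable.util hM))).encFun hM)).append
    h).append hM.printable_profile

theorem printable_congestionData : Printable fun x =>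
    (M x).congestionData.enc ++ encProfile (Config.initial (M x)).position.list :=
  (((PlayerPrintable.weight.append (PlayerPrintable.strat hM).bracket).encFun hM).append
    (printable_encFun_delay M hM.P)).append hM.printable_profile

end IsUniform

end CellMachine

end SinkEq

namespace SinkEq

open Computability Function

/-! ## From Turing machines with bounded tape to cell machines -/

namespace CellMachine.Config

variable {C Γ : Type} {M : CellMachine C Γ}

def Leads (c c' : M.Config) : Prop := ∃ k, step^[k] c = c'

theorem Leads.trans {c₁ c₂ c₃ : M.Config} (h : Leads c₁ c₂) (h' : Leads c₂ c₃) : Leads c₁ c₃ := by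
  obtain ⟨k, rfl⟩ := h
  obtain ⟨k', rfl⟩ := h'
  exact ⟨k' + k, iterate_add_apply _ _ _ _⟩

theorem Leads.head {c c' : M.Config} (h : Leads c.step c') : Leads c c' :=
  Leads.trans ⟨1, rfl⟩ h

end CellMachine.Config

namespace TapeMachine

variable (T : TapeMachine)

/-- The symbol in the cell `k` at the beginning. -/
def input (x : List Bool) (k : ℕ) : T.Γ := (x.map T.symbol).getD k T.blank

open scoped Classical in
/-- The machine `T` with `m + 1` cells. When it accepts, it restores its input and starts again. -/
noncomputable def cellMachine (m : ℕ) (x : List Bool) : CellMachine (T.Q ⊕ Bool) T.Γ where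
  P := m + 1
  P_pos := m.succ_pos
  wr c h g := c.elim (fun q => if q = T.accept ∨ q = T.reject then g else (T.δ q g).2.1)
    fun b => if b then g else T.input x h
  nx c h g := c.elim (fun q => if q = T.accept then (.inr false, 0)
      else if q = T.reject then (.inl T.reject, m - (m - h))
      else (.inl (T.δ q g).1, m - (m - moveHead (T.δ q g).2.2 h)))
    fun b => if b then (.inl T.start, 0)
      else if h < m then (.inr false, h + 1) else (.inr true, 0)
  nx_lt c h g := by
    rcases c with q | _ | _
    · simp only [Sum.elim_inl]
      split_ifs <;> simp only <;> omega
    · simp only [Sum.elim_inr]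
      split_ifs <;> simp only <;> omega
    · simp only [Sum.elim_inr]
      split_ifs <;> simp only <;> omega
  start := .inr true
  tape := T.input x

section

variable {T} {m : ℕ} {x : List Bool}

open CellMachine Config

open scoped Classical in
theorem wr_inl (q : T.Q) (h : ℕ) (g : T.Γ) : (T.cellMachine m x).wr (.inl q) h g =
    if q = T.accept ∨ q = T.reject then g else (T.δ q g).2.1 := rfl

theorem wr_reset (h : ℕ) (g : T.Γ) :
    (T.cellMachine m x).wr (.inr false) h g = T.input x h := rfl

open scoped Classical in
theorem nx_inl (q : T.Q) (h : ℕ) (g : T.Γ) : (T.cellMachine m x).nx (.inl q) h g =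
    if q = T.accept then (.inr false, 0) else if q = T.reject then (.inl T.reject, m - (m - h))
    else (.inl (T.δ q g).1, m - (m - moveHead (T.δ q g).2.2 h)) := rfl

theorem nx_reset (h : ℕ) (g : T.Γ) : (T.cellMachine m x).nx (.inr false) h g =
    if h < m then (.inr false, h + 1) else (.inr true, 0) := rfl

def config (d : T.Cfg) (hd : d.head < m + 1) : (T.cellMachine m x).Config where
  ctl := .inl d.state
  pos := ⟨d.head, hd⟩
  cell k := d.tape k.val

theorem config_nx {d : T.Cfg} (hd : d.head < m + 1) :
    ((config (x := x) d hd).step.ctl, (config (x := x) d hd).step.pos.val) =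
      (T.cellMachine m x).nx (.inl d.state) d.head (d.tape d.head) := rfl

theorem config_step_cell {d : T.Cfg} (hd : d.head < m + 1) (k : Fin (T.cellMachine m x).P) :
    (config (x := x) d hd).step.cell k = if k.val = d.head then
      (T.cellMachine m x).wr (.inl d.state) d.head (d.tape k.val) else d.tape k.val :=
  Config.step_cell _ _

/-- In `cellMachine`, `m - (m - k)` is the minimum of `m` and `k`. It keeps all positions in range
and has no effect while the head stays below `m + 1`. -/
theorem config_step {d : T.Cfg} (hd : d.head < m + 1) (hd' : (T.step d).head < m + 1)
    (h : ¬ (d.state = T.accept ∨ d.state = T.reject)) :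
    (config (x := x) d hd).step = config (T.step d) hd' := by
  obtain ⟨h₁, h₂⟩ := not_or.1 h
  have e : T.step d = ⟨(T.δ d.state (d.tape d.head)).1,
      moveHead (T.δ d.state (d.tape d.head)).2.2 d.head,
      update d.tape d.head (T.δ d.state (d.tape d.head)).2.1⟩ := if_neg h
  revert hd'
  rw [e]
  intro hd'
  have hn := config_nx (x := x) hd
  rw [nx_inl, if_neg h₁, if_neg h₂, Prod.mk.injEq] at hn
  refine Config.ext hn.1 (Fin.ext (hn.2.trans ?_)) (funext fun k => ?_)
  · simp only at hd'
    simp only [config]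
    omega
  · rw [config_step_cell, wr_inl, if_neg h]
    simp only [config, update_apply]
    split_ifs with hk
    · rw [hk]
    · rfl

theorem initial_step :
    (initial (T.cellMachine m x)).step = config (T.init x) m.succ_pos := by
  refine Config.ext rfl rfl (funext fun k => ?_)
  rw [Config.step_cell]
  exact ite_self _

/-- After halting, `T` idles, whereas the cell machine goes on if `T` has accepted; `Leads` does not
fix the number of steps, so the configuration reached at the halting time serves for all later
times. -/
theorem leads_run (hm : ∀ t, (T.run x t).head < m + 1) (t : ℕ) :
    Leads (initial (T.cellMachine m x)) (config (T.run x t) (hm t)) := by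
  induction t with
  | zero => exact ⟨1, initial_step⟩
  | succ t ih =>
    have e : T.run x (t + 1) = T.step (T.run x t) := iterate_succ_apply' _ _ _
    by_cases h : (T.run x t).state = T.accept ∨ (T.run x t).state = T.reject
    · have e' : T.run x (t + 1) = T.run x t := e.trans (if_pos h)
      simpa only [e'] using ih
    · refine ih.trans ⟨1, ?_⟩
      refine (config_step (x := x) (hm t) (e ▸ hm (t + 1)) h).trans ?_
      simp only [e]

/-- Induction on the distance `n` of the head from the last cell; the invariant is that all cells to
the left of the head are restored. -/
theorem leads_initial_of_reset (n : ℕ) : ∀ c : (T.cellMachine m x).Config, c.ctl = .inr false →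
    m = c.pos.val + n → (∀ k, k.val < c.pos.val → c.cell k = T.input x k) →
    Leads c (initial (T.cellMachine m x)) := by
  have hcell : ∀ c : (T.cellMachine m x).Config, c.ctl = .inr false →
      (∀ k, k.val < c.pos.val → c.cell k = T.input x k) →
      ∀ k, k.val < c.pos.val + 1 → c.step.cell k = T.input x k := by
    intro c h₁ h₂ k hk
    rw [Config.step_cell, h₁, wr_reset]
    split_ifs with hk'
    · rw [hk']
    · exact h₂ k (by omega)
  have hnx : ∀ c : (T.cellMachine m x).Config, c.ctl = .inr false →
      (c.step.ctl, c.step.pos.val) = if c.pos.val < m then (.inr false, c.pos.val + 1)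
        else (.inr true, 0) := by
    intro c h₁
    rw [← nx_reset (x := x) c.pos.val (c.cell c.pos), ← h₁]
    rfl
  induction n with
  | zero =>
    intro c h₁ h₂ h₃
    have hn := hnx c h₁
    rw [if_neg (by omega), Prod.mk.injEq] at hn
    refine ⟨1, Config.ext hn.1 (Fin.ext hn.2) (funext fun k => hcell c h₁ h₃ k ?_)⟩
    have : k.val < m + 1 := k.isLt
    omega
  | succ n ih =>
    intro c h₁ h₂ h₃
    have hn := hnx c h₁
    rw [if_pos (by omega), Prod.mk.injEq] at hn
    exact (ih c.step hn.1 (by omega) fun k hk => hcell c h₁ h₃ k (by omega)).head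

theorem leads_initial_of_accept {d : T.Cfg} (hd : d.head < m + 1) (h : d.state = T.accept) :
    Leads (config d hd) (initial (T.cellMachine m x)) := by
  have hn := config_nx (x := x) hd
  rw [nx_inl, if_pos h, Prod.mk.injEq] at hn
  exact (leads_initial_of_reset m _ hn.1 (by omega) fun k hk => by omega).head

theorem step_eq_of_reject {d : T.Cfg} (hd : d.head < m + 1) (h : d.state = T.reject) :
    (config (x := x) d hd).step = config d hd := by
  have hn := config_nx (x := x) hd
  rw [nx_inl, h, if_neg T.accept_ne_reject.symm, if_pos rfl, Prod.mk.injEq] at hn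
  refine Config.ext (hn.1.trans (congrArg _ h.symm)) (Fin.ext (hn.2.trans ?_)) (funext fun k => ?_)
  · simp only [config]
    omega
  · rw [config_step_cell, wr_inl, if_pos (show d.state = T.accept ∨ d.state = T.reject from .inr h)]
    exact ite_self _

/-- The separate control state `.inr true` ensures this even if `T` starts in `reject`; a first
profile without improving moves would be a sink by itself. -/
theorem initial_step_ne : (initial (T.cellMachine m x)).step ≠ initial (T.cellMachine m x) := by
  intro e
  rw [initial_step] at e
  exact Sum.inl_ne_inr (congrArg Config.ctl e)

variable [Fintype T.Q] [Fintype T.Γ] [DecidableEq T.Q] [DecidableEq T.Γ]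

theorem mem_iff_inASinkAt {L : Set (List Bool)} (hm : ∀ t, (T.run x t).head < m)
    (h₁ : x ∈ L → ∃ t, (T.run x t).state = T.accept)
    (h₂ : x ∉ L → ∃ t, (T.run x t).state = T.reject)
    {G} (hG : (T.cellMachine m x).Simulates G) :
    x ∈ L ↔ G.InASinkAt (initial (T.cellMachine m x)).position.full := by
  have hm' := fun t => (hm t).trans m.lt_succ_self
  constructor
  · intro hx
    obtain ⟨t, ht⟩ := h₁ hx
    obtain ⟨k, hk⟩ := (leads_run hm' t).trans (leads_initial_of_accept (hm' t) ht)
    -- A cycle needs positive length, but the composite walk comes with an unspecified `k`. If `k =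
    -- 0`, it is taken apart: its first piece is not empty, because it leads from a control state
    -- `.inr` to one of the form `.inl`.
    cases k with
    | zero =>
      obtain ⟨k, hk⟩ := leads_initial_of_accept (x := x) (hm' t) ht
      obtain ⟨k', hk'⟩ := leads_run hm' t
      cases k' with
      | zero => exact absurd (congrArg Config.ctl hk') Sum.inr_ne_inl
      | succ k' =>
        refine inASinkAt_of_cycle hG (k := k + k') ?_ initial_step_ne
        rw [Nat.add_assoc, iterate_add_apply, hk', hk]
    | succ k => exact inASinkAt_of_cycle hG hk initial_step_ne
  · contrapose
    intro hx
    obtain ⟨t, ht⟩ := h₂ hx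
    obtain ⟨k, hk⟩ := leads_run hm' t
    exact not_inASinkAt_of_reach hG hk initial_step_ne (step_eq_of_reject (hm' t) ht)

end

/-! ### Uniformity -/

section

variable {T}

theorem test_pair {α X : Type} [Ctx α] [DecidableEq X] {e e' : α → ℕ} (he : Count e)
    (he' : Count e') (c c' : X) : Test fun a => decide ((c, e a) = (c', e' a)) := by
  by_cases h : c = c'
  · simpa [h] using Test.eq he he'
  · simpa [h] using Test.const false

variable [DecidableEq T.Γ]

theorem test_input (g : T.Γ) : Test fun b : List Bool × ℕ => decide (T.input b.1 b.2 = g) := by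
  have hc : Count fun b : List Bool × ℕ => letterCode b.1[b.2]? := Count.inp Count.snd
  have h := (((Test.eq hc (Count.const 0)).and (Test.const (decide (T.blank = g)))).or
    ((Test.eq hc (Count.const 1)).and (Test.const (decide (T.symbol false = g))))).or
    ((Test.eq hc (Count.const 2)).and (Test.const (decide (T.symbol true = g))))
  convert h using 2 with b
  rcases hb : b.1[b.2]? with _ | _ | _ <;> simp [input, List.getD, hb, letterCode]

variable [DecidableEq T.Q]

theorem isUniform_cellMachine (p : Polynomial ℕ) :
    CellMachine.IsUniform fun x => T.cellMachine (p.eval x.length) x := by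
  have hp : Count fun x : List Bool => p.eval x.length := Count.eval p Count.length
  refine ⟨hp.add (Count.const 1), fun c g g' => ?_, fun c g c' => ?_, ⟨_, fun _ => rfl⟩, fun g => ?_⟩
  · rcases c with q | _ | _
    · by_cases hq : q = T.accept ∨ q = T.reject
      · simp only [wr_inl, if_pos hq]
        exact Test.const _
      · simp only [wr_inl, if_neg hq]
        exact Test.const _
    · exact test_input g'
    · exact Test.const (α := List Bool × ℕ) (decide (g = g'))
  · have hm : Count fun b : (List Bool × ℕ) × ℕ => p.eval b.1.1.length := hp.fst.fst
    have hh : Count fun b : (List Bool × ℕ) × ℕ => b.1.2 := Count.snd.fst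
    rcases c with q | _ | _
    · by_cases h₁ : q = T.accept
      · simp only [cellMachine, Sum.elim_inl, if_pos h₁]
        exact test_pair (Count.const 0) Count.snd _ _
      · by_cases h₂ : q = T.reject
        · simp only [cellMachine, Sum.elim_inl, if_neg h₁, if_pos h₂]
          exact test_pair (hm.sub (hm.sub hh)) Count.snd _ _
        · simp only [cellMachine, Sum.elim_inl, if_neg h₁, if_neg h₂]
          refine test_pair (hm.sub (hm.sub ?_)) Count.snd _ _
          cases (T.δ q g).2.2
          · exact hh.sub (Count.const 1)
          · exact hh
          · exact hh.add (Count.const 1)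
    · have h := (Test.lt hh hm).cond
        (test_pair (hh.add (Count.const 1)) Count.snd (.inr false : T.Q ⊕ Bool) c')
        (test_pair (Count.const 0) Count.snd (.inr true : T.Q ⊕ Bool) c')
      convert h using 2 with b
      by_cases hb : b.1.2 < p.eval b.1.1.length <;> simp [cellMachine, hb]
    · exact test_pair (Count.const 0) Count.snd _ _
  · exact test_input g

end

end TapeMachine

/-- The reduction from a language in PSPACE. -/
theorem InPSPACE.exists_cellMachine {L : Set (List Bool)} (hL : InPSPACE L) :
    ∃ (C Γ : Type) (_ : Fintype C) (_ : Fintype Γ) (_ : DecidableEq C) (_ : DecidableEq Γ)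
      (M : List Bool → CellMachine C Γ), CellMachine.IsUniform M ∧
      ∀ x G, (M x).Simulates G →
        (x ∈ L ↔ G.InASinkAt (profile (CellMachine.Config.initial (M x)).position.list)) := by
  classical
  obtain ⟨T, p, h⟩ := hL
  have := T.finite_Q
  have := T.finite_Γ
  have := Fintype.ofFinite T.Q
  have := Fintype.ofFinite T.Γ
  refine ⟨T.Q ⊕ Bool, T.Γ, inferInstance, inferInstance, inferInstance, inferInstance,
    fun x => T.cellMachine (p.eval x.length) x, T.isUniform_cellMachine p, fun x G hG => ?_⟩
  have e : profile (CellMachine.Config.initial (T.cellMachine (p.eval x.length) x)).position.list =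
      (CellMachine.Config.initial (T.cellMachine (p.eval x.length) x)).position.full :=
    funext fun i => CellMachine.Position.toFinset_list _ i
  rw [e]
  exact TapeMachine.mem_iff_inASinkAt (h x).1 (h x).2.1 (h x).2.2 hG

end SinkEq

open SinkEq in
theorem mainTheorem7 :
    PSPACEHard uniformInASink ∧
    PSPACEHard uniformIdealInASink ∧
    PSPACEHard manyToOneInASink ∧
    PSPACEHard validUtilityInASink ∧
    (∀ L : Set (List Bool), InPSPACE L →
      ∃ f g : List Bool → Word,
        IsPolyReduction f L uniformInASink ∧
        IsPolyReduction g L congestionInASink ∧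
        ∀ x, ∃ (I : UniformMarket) (p : Fin I.n → List (Fin I.m))
          (J : CongestionData) (q : Fin J.n → List (Fin J.m)),
          f x = I.enc ++ encProfile p ∧ g x = J.enc ++ encProfile q ∧
          I.game.DynamicsIsoAt (profile p) J.game (profile q)) := by
  refine ⟨fun L hL => ?_, fun L hL => ?_, fun L hL => ?_, fun L hL => ?_, fun L hL => ?_⟩
  all_goals obtain ⟨C, Γ, _, _, _, _, M, hM, h⟩ := hL.exists_cellMachine
  · exact ⟨_, hM.printable_uniformMarket.polyTime, fun x =>
      (h x _ (M x).simulates_uniformMarket).trans (mem_uniformInASink (M x).uniformMarket _).symm⟩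
  -- The same word is printed as for listed strategies; only its sets are now read as generators.
  · exact ⟨_, hM.printable_uniformMarket.polyTime, fun x =>
      (h x _ (M x).simulates_uniformMarket_ideal).trans
        (mem_uniformIdealInASink (M x).uniformMarket _).symm⟩
  · exact ⟨_, hM.printable_manyToOneMarket.polyTime, fun x =>
      (h x _ (M x).simulates_manyToOneMarket).trans
        (mem_manyToOneInASink (M x).manyToOneMarket _).symm⟩
  · exact ⟨_, hM.printable_validUtilityData.polyTime, fun x =>
      ((h x _ (M x).simulates_validUtilityGame).trans
        (and_iff_right (M x).isValidUtility).symm).trans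
        (mem_validUtilityInASink (M x).validUtilityData _).symm⟩
  · refine ⟨_, _, ⟨hM.printable_uniformMarket.polyTime, fun x =>
      (h x _ (M x).simulates_uniformMarket).trans (mem_uniformInASink (M x).uniformMarket _).symm⟩,
      ⟨hM.printable_congestionData.polyTime, fun x =>
      (h x _ (M x).simulates_congestionData).trans
        (mem_congestionInASink (M x).congestionData _).symm⟩, fun x =>
      ⟨(M x).uniformMarket, _, (M x).congestionData, _, rfl, rfl, ?_⟩⟩
    have e : profile (CellMachine.Config.initial (M x)).position.list =
        (CellMachine.Config.initial (M x)).position.full :=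
      funext fun i => CellMachine.Position.toFinset_list _ i
    have := (M x).dynamicsIsoAt_of_simulates
      (G := (M x).uniformMarket.game) (H := (M x).congestionData.game) rfl (M x).simulates_uniformMarket
      (M x).simulates_congestionData (CellMachine.Config.initial (M x)).position
    rw [← e] at this
    exact this
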